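/- **Setting.** Let $\{f(\cdot;\theta)\}$ be a parametric family of lifetime densities on $[0,\infty)$, $\theta\in\Theta\subset\mathbb R^d$, $d\ge 1$, with $F(t;\theta)=\int_0^t f(s;\theta)\,ds$. The data $\mathcal D_n=\{x_i=(t_i,C_i,t_{il})\}_{i=1}^n$ are i.i.d.; $t_i$ is the failure or right-censoring time, $C_i=1$ if the $i$-th observation is censored and $C_i=0$ otherwise, and $0\le t_{il}\le t_i$ is the left-truncation time. Put $$l(x_i,\theta)=l_i(\theta)=(1-C_i)\log f(t_i;\theta)+C_i\log\{1-F(t_i;\theta)\}-\log\{1-F(t_{il};\theta)\},$$ assumed to be well defined and twice continuously differentiable in $\theta$ on $\Theta$ almost surely, with gradient $\dot l$ and Hessian $\ddot l=(\ddot l_{(jk)})$. Let $n_0=\#\{i:C_i=0\}$, let $\hat\theta\in\arg\max_{\theta\in\Theta}\frac1n\sum_{i=1}^n l_i(\theta)$, and let $M_g=\frac1n\sum_{i=1}^n\ddot l_i(\hat\theta)$. Write $A^{2}=AA^\top$. **Algorithm.** Fix $\xi_c\in(0,1)$. (1) Draw $r_0$ indices uniformly with replacement from $\{1,\dots,n\}$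 and let $\tilde\theta_{cp}$ maximize over $\Theta$ the average log-likelihood of these data. (2) For censored $i$ put $$\tilde\pi_i(\theta)=\frac{\|\dot l_i(\theta)\|}{\sum_{j:C_j=1}\|\dot l_j(\theta)\|},\qquad \tilde\pi_{\xi,i}(\theta)=(1-\xi_c)\tilde\pi_i(\theta)+\frac{\xi_c}{n-n_0}.$$ (3) Keep all $n_0$ uncensored data with weight $1$, draw $r-n_0$ censored data independently with replacement with probabilities $\tilde\pi_{\xi,i}(\tilde\theta_{cp})$, give a drawn datum $i$ the weight $1/\{(r-n_0)\tilde\pi_{\xi,i}(\tilde\theta_{cp})\}$, and let $\tilde\theta_{RDCS}$ maximize over $\Theta$ the weighted log-likelihood of this subsample of size $r$. **Assumptions.** (A) $\Theta$ is compact and convex, $\mathbb E\{l^2(x,\theta)\}<\infty$ for all $\theta\in\Theta$, $\hat\theta$ is unique with probability tending to one, and $\theta\mapsto\mathbb E\{l(x,\theta)\}$ is maximized over $\Theta$ at an interior point of $\Theta$ (the true parameter, if the model is correct). (B) For every $\theta\in\Theta$, $-\mathbb E\{\ddot l(x,\theta)\}$ is positive definite and $\mathbb E\{\ddot l_{(jk)}^2(x,\theta)\}<\infty$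 for all $j,k$; there is $\psi$ with $\mathbb E\{\psi^2(x)\}<\infty$ such that $|\ddot l_{(jk)}(x,\theta_1)-\ddot l_{(jk)}(x,\theta_2)|\le\psi(x)\|\theta_1-\theta_2\|$ for all $\theta_1,\theta_2\in\Theta$ and all $j,k$. (C) For every $\theta\in\Theta$, $\Lambda(\theta)=\mathbb E\{\dot l(x,\theta)^2\}$ is finite and positive definite; there is $\delta>0$ such that $\frac1n\sum_{i=1}^n\|\dot l_i(\theta)\|^4=O_p(1)$, uniformly over $\theta\in\Theta$ with $\|\theta-\hat\theta\|<\delta$. (D) The smallest eigenvalue of $$\Lambda_{RDCS}=\frac1{n^2}\sum_{i:C_i=1}\frac{1}{\tilde\pi_{\xi,i}(\hat\theta)}\dot l_i(\hat\theta)^{2}-\Big[\frac1n\sum_{i:C_i=1}\dot l_i(\hat\theta)\Big]^{2}$$ is bounded away from zero in probability as $n\to\infty$. **Claim.** Let $r_0=r_0(n)\to\infty$ and $r=r(n)\to\infty$ as $n\to\infty$, with $n_0/r\to0$ in probability. Then, with $V_{RDCS}=M_g^{-1}\Lambda_{RDCS}M_g^{-1}$, conditionally on $\mathcal D_n$ and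 $\tilde\theta_{cp}$, $$\sqrt r\,V_{RDCS}^{-1/2}(\tilde\theta_{RDCS}-\hat\theta)\xrightarrow{d}N(0,I)\quad\text{in probability},$$ that is, for every bounded continuous $g:\mathbb R^d\to\mathbb R$, $\mathbb E\{g(\sqrt r\,V_{RDCS}^{-1/2}(\tilde\theta_{RDCS}-\hat\theta))\mid\mathcal D_n,\tilde\theta_{cp}\}\to\mathbb E\,g(Z)$ in probability, where $Z\sim N(0,I)$. -/

import Mathlib

open MeasureTheory ProbabilityTheory Filter Topology

noncomputable section

namespace RDCS

/-- The parameter space `ℝ^d` with its Euclidean norm. -/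
abbrev Param (d : ℕ) := EuclideanSpace ℝ (Fin d)

/-- One observation `(t, C, t_l)`: failure or right-censoring time, censoring indicator
(`true` means censored), left-truncation time (`0` if there is no truncation). -/
abbrev Obs := ℝ × Bool × ℝ

/-- The observed failure or censoring time. -/
def obsTime (x : Obs) : ℝ := x.1

/-- The censoring indicator. -/
def censored (x : Obs) : Bool := x.2.1

/-- The left-truncation time. -/
def truncTime (x : Obs) : ℝ := x.2.2

/-- The lifetime distribution function `F(t; θ) = ∫₀ᵗ f(s; θ) ds`. -/
def lifeCDF {d : ℕ} (f : ℝ → Param d → ℝ) (t : ℝ) (θ : Param d) : ℝ :=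
  ∫ s in Set.Ioc 0 t, f s θ

/-- The log-likelihood of one observation,
`l(x, θ) = (1 - C) log f(t; θ) + C log (1 - F(t; θ)) - log (1 - F(t_l; θ))`. -/
def logLik {d : ℕ} (f : ℝ → Param d → ℝ) (x : Obs) (θ : Param d) : ℝ :=
  (if censored x then Real.log (1 - lifeCDF f (obsTime x) θ) else Real.log (f (obsTime x) θ))
    - Real.log (1 - lifeCDF f (truncTime x) θ)

/-- The score: the gradient of `l(x, ·)`. For a censored observation this is the gradient of
`log (1 - F(t; ·))` minus that of `log (1 - F(t_l; ·))`. -/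
def score {d : ℕ} (f : ℝ → Param d → ℝ) (x : Obs) (θ : Param d) : Param d :=
  gradient (fun ϑ => logLik f x ϑ) θ

/-- The Hessian matrix of `l(x, ·)`. -/
def hess {d : ℕ} (f : ℝ → Param d → ℝ) (x : Obs) (θ : Param d) : Matrix (Fin d) (Fin d) ℝ :=
  Matrix.of fun j k => fderiv ℝ (fun ϑ => score f x ϑ j) θ (EuclideanSpace.single k 1)

/-- The outer product `v vᵀ`. -/
def outer {d : ℕ} (v : Param d) : Matrix (Fin d) (Fin d) ℝ :=
  Matrix.of fun j k => v j * v k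

/-! ### Full data -/

/-- The law of `n` independent observations with common law `P`. -/
def dataLaw (P : Measure Obs) (n : ℕ) : Measure (Fin n → Obs) :=
  Measure.pi fun _ => P

/-- The normalized log-likelihood of the full data, `l_f(θ) = n⁻¹ ∑ l(x_i, θ)`. -/
def fullLogLik {d n : ℕ} (f : ℝ → Param d → ℝ) (D : Fin n → Obs) (θ : Param d) : ℝ :=
  (n : ℝ)⁻¹ * ∑ i, logLik f (D i) θ

/-- The indices of the censored observations. -/
def censIdx {n : ℕ} (D : Fin n → Obs) : Finset (Fin n) :=
  Finset.univ.filter fun i => censored (D i) = true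

/-- The indices of the uncensored observations. -/
def uncensIdx {n : ℕ} (D : Fin n → Obs) : Finset (Fin n) :=
  Finset.univ.filter fun i => censored (D i) = false

/-- `n₀`, the number of uncensored observations. -/
def numUncens {n : ℕ} (D : Fin n → Obs) : ℕ := (uncensIdx D).card

/-- `M_g = n⁻¹ ∑ l̈_i(θ)`. -/
def meanHess {d n : ℕ} (f : ℝ → Param d → ℝ) (D : Fin n → Obs) (θ : Param d) :
    Matrix (Fin d) (Fin d) ℝ :=
  (n : ℝ)⁻¹ • ∑ i, hess f (D i) θ

/-! ### The subsampling algorithm -/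

/-- The pilot criterion: the average log-likelihood of the `r₀` data with indices
`J 0, …, J (r₀ - 1)`. -/
def pilotLogLik {d n r₀ : ℕ} (f : ℝ → Param d → ℝ) (D : Fin n → Obs) (J : Fin r₀ → Fin n)
    (θ : Param d) : ℝ :=
  (r₀ : ℝ)⁻¹ * ∑ j, logLik f (D (J j)) θ

/-- The law of the `r₀` pilot indices: uniform draws with replacement. -/
def pilotLaw (n r₀ : ℕ) : Measure (Fin r₀ → Fin n) := uniformOn Set.univ

/-- The optimal probabilities for censored data: proportional to `‖l̇_i(θ)‖`, with sum one over
the censored observations. -/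
def optProb {d n : ℕ} (f : ℝ → Param d → ℝ) (D : Fin n → Obs) (θ : Param d) (i : Fin n) : ℝ :=
  ‖score f (D i) θ‖ / ∑ j ∈ censIdx D, ‖score f (D j) θ‖

/-- The mixed probabilities for censored data,
`(1 - ξ) π_i(θ) + ξ / (n - n₀)`. -/
def mixProb {d n : ℕ} (f : ℝ → Param d → ℝ) (ξ : ℝ) (D : Fin n → Obs) (θ : Param d)
    (i : Fin n) : ℝ :=
  (1 - ξ) * optProb f D θ i + ξ / ((n : ℝ) - numUncens D)

/-- The weights: `1` for an uncensored observation, `1 / ((r - n₀) π_{ξ,i}(θ))` for a censored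
one. -/
def weight {d n : ℕ} (f : ℝ → Param d → ℝ) (ξ : ℝ) (r : ℕ) (D : Fin n → Obs) (θ : Param d)
    (i : Fin n) : ℝ :=
  if censored (D i) then (((r : ℝ) - numUncens D) * mixProb f ξ D θ i)⁻¹ else 1

/-- The law of one draw from the censored data with the mixed probabilities at `θ`. -/
def drawLaw {d n : ℕ} (f : ℝ → Param d → ℝ) (ξ : ℝ) (D : Fin n → Obs) (θ : Param d) :
    Measure (Fin n) :=
  ∑ i ∈ censIdx D, ENNReal.ofReal (mixProb f ξ D θ i) • Measure.dirac i

/-- The conditional law, given the full data `D` and the pilot estimate `θ`, of the indices of the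
`r - n₀` censored data that enter the subsample (independent draws, with replacement). -/
def subsampleLaw {d n : ℕ} (f : ℝ → Param d → ℝ) (ξ : ℝ) (r : ℕ) (D : Fin n → Obs)
    (θ : Param d) : Measure (Fin (r - numUncens D) → Fin n) :=
  Measure.pi fun _ => drawLaw f ξ D θ

/-- The weighted pseudo log-likelihood `r⁻¹ ∑ ω_i^c l_i^c(ϑ)` of the subsample that consists of all
uncensored data and of the censored data with indices `I`; the weights are computed at the pilot
estimate `θ`. -/
def subsampleLogLik {d n : ℕ} (f : ℝ → Param d → ℝ) (ξ : ℝ) (r : ℕ) (D : Fin n → Obs)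
    (θ : Param d) (I : Fin (r - numUncens D) → Fin n) (ϑ : Param d) : ℝ :=
  (r : ℝ)⁻¹ * (∑ i ∈ uncensIdx D, weight f ξ r D θ i * logLik f (D i) ϑ
    + ∑ j, weight f ξ r D θ (I j) * logLik f (D (I j)) ϑ)

/-! ### The asymptotic covariance matrix -/

/-- `Λ_RDCS`, with all quantities evaluated at `θ`. -/
def covLambda {d n : ℕ} (f : ℝ → Param d → ℝ) (ξ : ℝ) (D : Fin n → Obs) (θ : Param d) :
    Matrix (Fin d) (Fin d) ℝ :=
  ((n : ℝ) ^ 2)⁻¹ • ∑ i ∈ censIdx D, (mixProb f ξ D θ i)⁻¹ • outer (score f (D i) θ)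
    - outer ((n : ℝ)⁻¹ • ∑ i ∈ censIdx D, score f (D i) θ)

/-- `V_RDCS = M_g⁻¹ Λ_RDCS M_g⁻¹`. -/
def covV {d n : ℕ} (f : ℝ → Param d → ℝ) (ξ : ℝ) (D : Fin n → Obs) (θ : Param d) :
    Matrix (Fin d) (Fin d) ℝ :=
  (meanHess f D θ)⁻¹ * covLambda f ξ D θ * (meanHess f D θ)⁻¹

/-- `V^{-1/2}` for a symmetric positive definite matrix `V`, by functional calculus. -/
def invSqrt {d : ℕ} (V : Matrix (Fin d) (Fin d) ℝ) : Matrix (Fin d) (Fin d) ℝ :=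
  cfc (fun s : ℝ => (√s)⁻¹) V

/-- The standardized error `√r V^{-1/2} (θtilde - θhat)`. -/
def stdError {d : ℕ} (r : ℕ) (V : Matrix (Fin d) (Fin d) ℝ) (θtilde θhat : Param d) : Param d :=
  WithLp.toLp 2 ((√(r : ℝ) • invSqrt V).mulVec (θtilde - θhat).ofLp)

/-! ### Model and assumptions -/

/-- A parametric family of lifetime densities on `[0, ∞)`, and observations (with law `P`) whose
likelihood contributions are well defined and twice continuously differentiable on `Θ`. -/
structure LifetimeModel {d : ℕ} (f : ℝ → Param d → ℝ) (Θ : Set (Param d)) (P : Measure Obs) :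
    Prop where
  measurable : ∀ θ ∈ Θ, Measurable fun t => f t θ
  nonneg : ∀ θ ∈ Θ, ∀ t, 0 ≤ t → 0 ≤ f t θ
  integrableOn : ∀ θ ∈ Θ, IntegrableOn (fun t => f t θ) (Set.Ici 0)
  integral_eq_one : ∀ θ ∈ Θ, ∫ t in Set.Ici 0, f t θ = 1
  times : ∀ᵐ x ∂P, 0 ≤ truncTime x ∧ truncTime x ≤ obsTime x
  positive : ∀ᵐ x ∂P, ∀ θ ∈ Θ, lifeCDF f (truncTime x) θ < 1 ∧
    (if censored x then lifeCDF f (obsTime x) θ < 1 else 0 < f (obsTime x) θ)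
  smooth : ∀ᵐ x ∂P, ∀ θ ∈ Θ, ContDiffAt ℝ 2 (fun ϑ => logLik f x ϑ) θ

/-- `Θ` is compact (and convex), `l(x, θ)` has a finite second moment for every `θ ∈ Θ`, and the
full-data maximum likelihood estimator is unique, with probability tending to one. -/
structure UniqueMLE {d : ℕ} (f : ℝ → Param d → ℝ) (Θ : Set (Param d)) (P : Measure Obs)
    (θhat : ∀ n, (Fin n → Obs) → Param d) : Prop where
  isCompact : IsCompact Θ
  convex : Convex ℝ Θ
  memLp_logLik : ∀ θ ∈ Θ, MemLp (fun x => logLik f x θ) 2 P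
  unique : Tendsto (fun n => dataLaw P n
    {D | ∃ θ ∈ Θ, θ ≠ θhat n D ∧ IsMaxOn (fullLogLik f D) Θ θ}) atTop (𝓝 0)

/-- Second-derivative conditions: `-E l̈(x, θ)` is positive definite, the entries of `l̈(x, θ)` have
finite second moments, and they are Lipschitz on `Θ` with a square-integrable constant `ψ(x)`. -/
structure HessianCondition {d : ℕ} (f : ℝ → Param d → ℝ) (Θ : Set (Param d)) (P : Measure Obs) :
    Prop where
  posDef : ∀ θ ∈ Θ, (-Matrix.of fun j k => ∫ x, hess f x θ j k ∂P).PosDef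
  memLp_hess : ∀ θ ∈ Θ, ∀ j k, MemLp (fun x => hess f x θ j k) 2 P
  lipschitz : ∃ ψ : Obs → ℝ, MemLp ψ 2 P ∧ ∀ᵐ x ∂P, ∀ θ₁ ∈ Θ, ∀ θ₂ ∈ Θ, ∀ j k,
    |hess f x θ₁ j k - hess f x θ₂ j k| ≤ ψ x * ‖θ₁ - θ₂‖

/-- Score conditions: `Λ(θ) = E l̇(x, θ) l̇(x, θ)ᵀ` exists and is positive definite, and
`n⁻¹ ∑ ‖l̇_i(θ)‖⁴` is bounded in probability, over all `θ` within some fixed distance `δ` of the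
estimator `θhat`. -/
structure ScoreCondition {d : ℕ} (f : ℝ → Param d → ℝ) (Θ : Set (Param d)) (P : Measure Obs)
    (θhat : ∀ n, (Fin n → Obs) → Param d) : Prop where
  memLp_score : ∀ θ ∈ Θ, ∀ j, MemLp (fun x => score f x θ j) 2 P
  posDef : ∀ θ ∈ Θ, (Matrix.of fun j k => ∫ x, outer (score f x θ) j k ∂P).PosDef
  fourth_moment : ∃ δ : ℝ, 0 < δ ∧ ∀ ε : ENNReal, 0 < ε → ∃ K : ℝ, ∀ᶠ n : ℕ in atTop,
    dataLaw P n {D | ∃ θ ∈ Θ, ‖θ - θhat n D‖ < δ ∧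
      K < (n : ℝ)⁻¹ * ∑ i, ‖score f (D i) θ‖ ^ 4} ≤ ε

/-- The smallest eigenvalue of `Λ_RDCS`, evaluated at `θhat`, is bounded away from zero in
probability. -/
def NondegenerateCov {d : ℕ} (f : ℝ → Param d → ℝ) (ξ : ℝ) (P : Measure Obs)
    (θhat : ∀ n, (Fin n → Obs) → Param d) : Prop :=
  ∀ ε : ENNReal, 0 < ε → ∃ c : ℝ, 0 < c ∧ ∀ᶠ n : ℕ in atTop,
    dataLaw P n {D | ¬ (covLambda f ξ D (θhat n D) - c • 1).PosSemidef} ≤ ε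

/-- `θ` maximizes `L` over `Θ`. -/
def IsArgmax {d : ℕ} (L : Param d → ℝ) (Θ : Set (Param d)) (θ : Param d) : Prop :=
  θ ∈ Θ ∧ IsMaxOn L Θ θ

end RDCS

end

/-! Given the data and the pilot estimate, the rescaled subsample criterion is an unbiased estimate
of the full-data log-likelihood, built from m = r - n₀ independent draws from a finite set. The
theorem is asymptotic normality of an M-estimator in this conditional experiment, made uniform over
well-behaved data.

Linearization. At `θhat`, an interior point of `Θ` with high probability, the full-data score
vanishes, so the subsample gradient there is a centred average of i.i.d. terms, of order m^{-1/2}.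
The expected Hessian is negative definite at every point of the compact set `Θ`, hence uniformly so.
Finite nets and a square-integrable Lipschitz envelope carry this over to the full-data Hessian
(`highProb_inner_hess_le`) and then to the subsample Hessian (`exists_measureReal_hess_le`). A
strongly concave criterion on a convex set has its maximizer within a constant times the gradient
norm of any chosen point (`mul_norm_sub_le_of_strongConcave`). This bounds the error directly,
without a separate consistency argument, and makes `norm_linearization_le` effective: the full-data
Hessian applied to the error equals minus the subsample gradient, up to terms negligible against
r^{-1/2}.

Central limit theorem. Whitening by V^{-1/2} M_g⁻¹ (`exists_whitening`) turns the gradient into a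
normalized sum of i.i.d. vectors. The uniform component of the mixture bounds inverse probabilities
by n/ξ, so third moments of the summands are controlled by fourth moments of the scores. Their
covariance uses probabilities at the pilot estimate, while `covLambda` uses those at `θhat`; the two
differ by O(‖p - θhat‖) (`abs_secondMoment_sub_le`), provided the normalizing sum of censored score
norms is at least of order n. That lower bound follows from the nondegeneracy of `covLambda` and the
fourth moments (`scoreFloor_le`). Characteristic functions then give the limit for arrays
(`tendsto_integral_of_array`).

Convergence in probability. `GoodSample` collects deterministic inequalities with a tolerance η. The
conditional limit holds along every sequence of good samples with η → 0 (`tendsto_of_goodSample`),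
so by contradiction the approximation is uniform over good samples with small η
(`exists_forall_goodSample`). It remains to bound the probability of a bad sample. The main input is
that the full-data and the pilot estimates both converge to `θ₀`, again by strong concavity
(`highProb_norm_argmax_sub_le`). -/

namespace RDCS

/-! ### Maximizers of strongly concave functions -/

/-- A maximizer over a convex set of a function whose second derivative is at most `-c` is within
`‖∇L(θ₁)‖ / c` of any point `θ₁` of the set. -/
theorem mul_norm_sub_le_of_strongConcave {d : ℕ} {Θ : Set (Param d)} (hΘ : Convex ℝ Θ)
    {L : Param d → ℝ} {G : Param d → Param d} {H : Param d → Param d →L[ℝ] Param d} {c : ℝ}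
    (hL : ∀ θ ∈ Θ, HasGradientAt L (G θ) θ) (hG : ∀ θ ∈ Θ, HasFDerivAt G (H θ) θ)
    (hH : ∀ θ ∈ Θ, ∀ v, inner ℝ (H θ v) v ≤ -c * ‖v‖ ^ 2) {θs θ₁ : Param d}
    (hs : IsArgmax L Θ θs) (h₁ : θ₁ ∈ Θ) : c * ‖θs - θ₁‖ ≤ ‖G θ₁‖ := by
  obtain ⟨hsΘ, hmax⟩ := hs
  -- The maximizer may lie on the boundary of `Θ`, so the gradient need not vanish there; convexity
  -- makes `θ₁ - θs` an admissible direction, along which the derivative is nonpositive.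
  have hopt : inner ℝ (G θs) (θ₁ - θs) ≤ 0 := by
    have := hmax.localize.hasFDerivWithinAt_nonpos (y := θ₁ - θs)
      (hL θs hsΘ).hasFDerivAt.hasFDerivWithinAt
      (mem_posTangentConeAt_of_segment_subset (by
        rw [add_sub_cancel]; exact hΘ.segment_subset hsΘ h₁))
    simpa using this
  set v := θs - θ₁ with hv
  have hseg : ∀ t ∈ Set.Icc (0 : ℝ) 1, θ₁ + t • v ∈ Θ := fun t ht =>
    hΘ.add_smul_sub_mem h₁ hsΘ ht
  have hder : ∀ t ∈ Set.Icc (0 : ℝ) 1, HasDerivAt (fun t : ℝ => inner ℝ (G (θ₁ + t • v)) v)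
      (inner ℝ (H (θ₁ + t • v) v) v) t := by
    intro t ht
    have h1 : HasDerivAt (fun t : ℝ => θ₁ + t • v) v t := by
      simpa using ((hasDerivAt_id t).smul_const v).const_add θ₁
    have h2 := (hG _ (hseg t ht)).comp_hasDerivAt t h1
    simpa using h2.inner ℝ (hasDerivAt_const t v)
  -- By the mean value theorem the inner product of the gradient with `v` drops by at least `c * ‖v‖
  -- ^ 2` from `θ₁` to `θs`, where it is still nonnegative.
  obtain ⟨t, ht, hteq⟩ := exists_hasDerivAt_eq_slope (fun t : ℝ => inner ℝ (G (θ₁ + t • v)) v)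
    (fun t => inner ℝ (H (θ₁ + t • v) v) v) (zero_lt_one' ℝ)
    (fun t ht => (hder t ht).continuousAt.continuousWithinAt)
    (fun t ht => hder t (Set.Ioo_subset_Icc_self ht))
  have hneg := hH _ (hseg t (Set.Ioo_subset_Icc_self ht)) v
  have hone : θ₁ + (1 : ℝ) • v = θs := by simp [hv]
  simp only [hone, zero_smul, add_zero, sub_zero, div_one] at hteq
  have hopt' : 0 ≤ inner ℝ (G θs) v := by
    have : θ₁ - θs = -v := by simp [hv]
    rw [this, inner_neg_right] at hopt
    linarith
  have hcs := real_inner_le_norm (G θ₁) v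
  have hkey : c * ‖v‖ ^ 2 ≤ ‖G θ₁‖ * ‖v‖ := by linarith
  rcases (norm_nonneg v).eq_or_lt with h0 | h0
  · rw [← h0]; simp
  · exact le_of_mul_le_mul_right (by linarith [sq ‖v‖]) h0

/-- The mean value inequality for a map whose derivative is close to a fixed linear map. -/
theorem norm_sub_sub_le_of_fderiv_close {d : ℕ} {Θ : Set (Param d)} (hΘ : Convex ℝ Θ)
    {G : Param d → Param d} {H : Param d → Param d →L[ℝ] Param d} {M : Param d →L[ℝ] Param d}
    {τ : ℝ} {θs θ₁ : Param d} (hG : ∀ θ ∈ Θ, HasFDerivAt G (H θ) θ) (hs : θs ∈ Θ) (h₁ : θ₁ ∈ Θ)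
    (hM : ∀ θ ∈ Θ, ‖θ - θ₁‖ ≤ ‖θs - θ₁‖ → ‖H θ - M‖ ≤ τ) :
    ‖G θs - G θ₁ - M (θs - θ₁)‖ ≤ τ * ‖θs - θ₁‖ := by
  have hseg : segment ℝ θ₁ θs ⊆ Θ := hΘ.segment_subset h₁ hs
  refine (convex_segment θ₁ θs).norm_image_sub_le_of_norm_hasFDerivWithin_le'
    (fun x hx => (hG x (hseg hx)).hasFDerivWithinAt) (fun x hx => hM x (hseg hx) ?_)
    (left_mem_segment ℝ θ₁ θs) (right_mem_segment ℝ θ₁ θs)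
  obtain ⟨t, ht, rfl⟩ := segment_eq_image' ℝ θ₁ θs ▸ hx
  rw [add_sub_cancel_left, norm_smul, Real.norm_of_nonneg ht.1]
  exact mul_le_of_le_one_left (norm_nonneg _) ht.2

/-- At an interior maximizer the gradient vanishes. -/
theorem IsArgmax.gradient_eq_zero {d : ℕ} {Θ : Set (Param d)} {L : Param d → ℝ}
    {g θs : Param d} {ρ : ℝ} (hρ : 0 < ρ) (hball : Metric.ball θs ρ ⊆ Θ)
    (hL : HasGradientAt L g θs) (hs : IsArgmax L Θ θs) : g = 0 := by
  have hloc : IsLocalMax L θs :=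
    hs.2.isLocalMax (Filter.mem_of_superset (Metric.ball_mem_nhds θs hρ) hball)
  simpa using hloc.hasFDerivAt_eq_zero hL.hasFDerivAt

/-- Two Lipschitz functions that are close on a net of `Θ` are close on `Θ`. -/
theorem norm_sub_le_of_net {E F : Type*} [NormedAddCommGroup E] [NormedAddCommGroup F]
    {Θ T : Set E} {κ τ K₁ K₂ : ℝ} {H₁ H₂ : E → F} (hTΘ : T ⊆ Θ)
    (hT : ∀ θ ∈ Θ, ∃ t ∈ T, ‖θ - t‖ ≤ κ) (hK₁ : 0 ≤ K₁) (hK₂ : 0 ≤ K₂)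
    (h₁ : ∀ θ ∈ Θ, ∀ θ' ∈ Θ, ‖H₁ θ - H₁ θ'‖ ≤ K₁ * ‖θ - θ'‖)
    (h₂ : ∀ θ ∈ Θ, ∀ θ' ∈ Θ, ‖H₂ θ - H₂ θ'‖ ≤ K₂ * ‖θ - θ'‖)
    (hτ : ∀ t ∈ T, ‖H₁ t - H₂ t‖ ≤ τ) : ∀ θ ∈ Θ, ‖H₁ θ - H₂ θ‖ ≤ τ + (K₁ + K₂) * κ := by
  intro θ hθ
  obtain ⟨t, ht, hd⟩ := hT θ hθ
  have e : H₁ θ - H₂ θ = (H₁ θ - H₁ t) + (H₁ t - H₂ t) - (H₂ θ - H₂ t) := by abel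
  have a₁ := (h₁ θ hθ t (hTΘ ht)).trans (mul_le_mul_of_nonneg_left hd hK₁)
  have a₂ := (h₂ θ hθ t (hTΘ ht)).trans (mul_le_mul_of_nonneg_left hd hK₂)
  have := (norm_sub_le (H₁ θ - H₁ t + (H₁ t - H₂ t)) (H₂ θ - H₂ t)).trans
    (add_le_add_left (norm_add_le _ _) _)
  rw [e]
  linarith [hτ t ht]

/-- Compact sets have finite nets. -/
theorem exists_finite_net {E : Type*} [NormedAddCommGroup E] {Θ : Set E} (hΘ : IsCompact Θ)
    {κ : ℝ} (hκ : 0 < κ) : ∃ T : Finset E, (T : Set E) ⊆ Θ ∧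
      ∀ θ ∈ Θ, ∃ t ∈ (T : Set E), ‖θ - t‖ ≤ κ := by
  obtain ⟨T, hT, hfin, hcov⟩ := hΘ.finite_cover_balls hκ
  refine ⟨hfin.toFinset, by simpa using hT, fun θ hθ => ?_⟩
  obtain ⟨t, ht, hd⟩ := Set.mem_iUnion₂.1 (hcov hθ)
  exact ⟨t, by simpa using ht, by simpa [dist_eq_norm] using (Metric.mem_ball.1 hd).le⟩

/-- The Euclidean norm is at most the sum of the absolute values of the coordinates. -/
theorem norm_le_sum_abs {d : ℕ} (w : Param d) : ‖w‖ ≤ ∑ j, |w j| := by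
  rw [EuclideanSpace.norm_eq, Real.sqrt_le_iff]
  refine ⟨by positivity, ?_⟩
  simp only [Real.norm_eq_abs]
  exact Finset.sum_sq_le_sq_sum_of_nonneg fun i _ => abs_nonneg _

/-- A linear map is bounded by the sum of the absolute values of its matrix entries. -/
theorem opNorm_le_sum_entries {d : ℕ} (A : Param d →L[ℝ] Param d) :
    ‖A‖ ≤ ∑ j, ∑ k, |A (EuclideanSpace.single k 1) j| := by
  refine A.opNorm_le_bound (by positivity) fun v => ?_
  have hv : v = ∑ k, v k • EuclideanSpace.single k (1 : ℝ) := by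
    ext j
    simp [Finset.sum_apply, Pi.single_apply]
  refine (norm_le_sum_abs _).trans ?_
  rw [Finset.sum_mul]
  refine Finset.sum_le_sum fun j _ => ?_
  have : A v j = ∑ k, v k * A (EuclideanSpace.single k 1) j := by
    conv_lhs => rw [hv]
    simp [map_sum, Finset.sum_apply]
  rw [this, Finset.sum_mul]
  refine (Finset.abs_sum_le_sum_abs _ _).trans (Finset.sum_le_sum fun k _ => ?_)
  rw [abs_mul, mul_comm]
  refine mul_le_mul_of_nonneg_left ?_ (abs_nonneg _)
  simpa using PiLp.norm_apply_le v k

end RDCS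

namespace RDCS

/-! ### A central limit theorem for arrays -/

/-- For |x| ≤ 1 this is the Taylor remainder. For |x| > 1 all terms are dominated by the cube, since
1 + 1 + |x| + |x|²/2 ≤ 4|x|³. Validity for all x removes the need for any truncation when
integrating. -/
theorem norm_exp_I_sub_taylor_le (x : ℝ) :
    ‖Complex.exp (x * Complex.I) - (1 + x * Complex.I - (x : ℂ) ^ 2 / 2)‖ ≤ 4 * |x| ^ 3 := by
  by_cases hx : |x| ≤ 1
  · have hn : ‖(x : ℂ) * Complex.I‖ = |x| := by simp
    have := Complex.exp_bound (x := x * Complex.I) (by rw [hn]; exact hx) (n := 3) (by norm_num)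
    rw [hn] at this
    have e : ∑ m ∈ Finset.range 3, ((x : ℂ) * Complex.I) ^ m / (m.factorial : ℂ)
        = 1 + x * Complex.I - (x : ℂ) ^ 2 / 2 := by
      simp [Finset.sum_range_succ, mul_pow, Complex.I_sq]
      ring
    rw [e] at this
    refine this.trans ?_
    have : 0 ≤ |x| ^ 3 := by positivity
    norm_num [Nat.factorial]
    linarith
  · push Not at hx
    have h1 : ‖Complex.exp (x * Complex.I)‖ = 1 := Complex.norm_exp_ofReal_mul_I x
    have h2 : ‖(1 : ℂ) + x * Complex.I - (x : ℂ) ^ 2 / 2‖ ≤ 1 + |x| + |x| ^ 2 / 2 := by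
      refine (norm_sub_le _ _).trans (add_le_add ((norm_add_le _ _).trans ?_) ?_)
      · simp
      · simp
    refine (norm_sub_le _ _).trans ?_
    rw [h1]
    have a : |x| ≤ |x| ^ 3 := by nlinarith [abs_nonneg x, sq_nonneg (|x| - 1)]
    have b : |x| ^ 2 ≤ |x| ^ 3 := by nlinarith [sq_nonneg (|x|)]
    have c : 1 ≤ |x| ^ 3 := by linarith
    linarith

/-- A telescoping argument: an error in one characteristic function is multiplied by at most the
number of independent summands. -/
theorem norm_pow_sub_pow_le_mul {a b : ℂ} (ha : ‖a‖ ≤ 1) (hb : ‖b‖ ≤ 1) (m : ℕ) :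
    ‖a ^ m - b ^ m‖ ≤ m * ‖a - b‖ := by
  induction m with
  | zero => simp
  | succ m ih =>
    have e : a ^ (m + 1) - b ^ (m + 1) = a ^ m * (a - b) + (a ^ m - b ^ m) * b := by ring
    rw [e]
    refine (norm_add_le _ _).trans ?_
    rw [norm_mul, norm_mul, norm_pow]
    have h1 : ‖a‖ ^ m * ‖a - b‖ ≤ ‖a - b‖ :=
      mul_le_of_le_one_left (norm_nonneg _) (pow_le_one₀ (norm_nonneg _) ha)
    have h2 : ‖a ^ m - b ^ m‖ * ‖b‖ ≤ m * ‖a - b‖ :=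
      (mul_le_of_le_one_right (norm_nonneg _) hb).trans ih
    push_cast
    linarith

/-- Second-order expansion of the characteristic function of a centred random variable. -/
theorem norm_integral_exp_sub_le {Ω : Type*} [MeasurableSpace Ω] {ν : Measure Ω}
    [IsProbabilityMeasure ν] {U : Ω → ℝ} (hU : MemLp U 3 ν) (h0 : ∫ x, U x ∂ν = 0) (s : ℝ) :
    ‖∫ x, Complex.exp ((s * U x : ℝ) * Complex.I) ∂ν
      - (1 - ((s ^ 2 * ∫ x, U x ^ 2 ∂ν) / 2 : ℝ))‖ ≤ 4 * |s| ^ 3 * ∫ x, |U x| ^ 3 ∂ν := by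
  have hint1 : Integrable U ν := hU.integrable (by norm_num)
  have hint2 : Integrable (fun x => U x ^ 2) ν :=
    (hU.mono_exponent (p := 2) (by norm_num)).integrable_sq
  have hint3 : Integrable (fun x => |U x| ^ 3) ν := by
    have := hU.integrable_norm_pow (by norm_num)
    simpa using this
  have hexp : Integrable (fun x => Complex.exp ((s * U x : ℝ) * Complex.I)) ν := by
    refine Integrable.of_bound (C := 1) ?_ (ae_of_all _ fun x => ?_)
    · have := hU.aestronglyMeasurable.aemeasurable
      exact (by fun_prop : AEMeasurable
        (fun x => Complex.exp ((s * U x : ℝ) * Complex.I)) ν).aestronglyMeasurable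
    · rw [Complex.norm_exp_ofReal_mul_I]
  have hi1 : Integrable (fun x => ((s * U x : ℝ) : ℂ) * Complex.I) ν :=
    (hint1.const_mul s).ofReal.mul_const _
  have hi2 : Integrable (fun x => ((s * U x : ℝ) : ℂ) ^ 2 / 2) ν := by
    have h := ((hint2.const_mul (s ^ 2)).ofReal (𝕜 := ℂ)).div_const 2
    refine h.congr (ae_of_all _ fun x => ?_)
    simp [mul_pow]
  have hi3 : Integrable (fun x => (1 : ℂ) + ((s * U x : ℝ) : ℂ) * Complex.I) ν :=
    (integrable_const _).add hi1
  have e : (∫ x, ((1 : ℂ) + ((s * U x : ℝ) : ℂ) * Complex.I - ((s * U x : ℝ) : ℂ) ^ 2 / 2) ∂ν : ℂ)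
      = 1 - (((s ^ 2 * ∫ x, U x ^ 2 ∂ν) / 2 : ℝ) : ℂ) := by
    rw [integral_sub hi3 hi2, integral_add (integrable_const _) hi1,
      integral_mul_const, integral_div, integral_complex_ofReal, integral_const_mul, h0]
    have : ∫ x, ((s * U x : ℝ) : ℂ) ^ 2 ∂ν = ((s ^ 2 * ∫ x, U x ^ 2 ∂ν : ℝ) : ℂ) := by
      rw [← integral_const_mul, ← integral_complex_ofReal]
      congr 1; ext x; push_cast; ring
    rw [this]
    simp
  have hi4 : Integrable
      (fun x => (1 : ℂ) + ((s * U x : ℝ) : ℂ) * Complex.I - ((s * U x : ℝ) : ℂ) ^ 2 / 2) ν :=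
    hi3.sub hi2
  rw [← e, ← integral_sub hexp hi4]
  refine (norm_integral_le_integral_norm _).trans ?_
  rw [← integral_const_mul]
  refine integral_mono_of_nonneg (ae_of_all _ fun x => norm_nonneg _) (hint3.const_mul _)
    (ae_of_all _ fun x => ?_)
  refine (norm_exp_I_sub_taylor_le _).trans (le_of_eq ?_)
  rw [abs_mul]; ring

theorem exp_neg_sub_le {a : ℝ} (ha : 0 ≤ a) : |(1 - a) - Real.exp (-a)| ≤ a ^ 2 := by
  have h1 : 1 - a ≤ Real.exp (-a) := by have := Real.add_one_le_exp (-a); linarith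
  rw [abs_sub_comm, abs_of_nonneg (by linarith)]
  by_cases h : a ≤ 1
  · have := Real.norm_exp_sub_one_sub_id_le (x := -a) (by simpa [abs_of_nonneg ha] using h)
    rw [Real.norm_eq_abs, Real.norm_eq_abs] at this
    have h2 := (le_abs_self _).trans this
    rw [abs_neg, abs_of_nonneg ha] at h2
    linarith
  · push Not at h
    have : Real.exp (-a) ≤ 1 := Real.exp_le_one_iff.2 (by linarith)
    nlinarith

/-- Convergence of the characteristic functions of normalized row sums, with the variance of the
row and the number of summands varying. -/
theorem tendsto_integral_exp_pow {Ω : ℕ → Type*} [∀ k, MeasurableSpace (Ω k)]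
    {ν : ∀ k, Measure (Ω k)} [∀ k, IsProbabilityMeasure (ν k)] {U : ∀ k, Ω k → ℝ}
    {m : ℕ → ℕ} {s : ℕ → ℝ} {K σ2 : ℝ} (hU : ∀ k, MemLp (U k) 3 (ν k))
    (h0 : ∀ k, ∫ x, U k x ∂(ν k) = 0) (hK : ∀ k, ∫ x, |U k x| ^ 3 ∂(ν k) ≤ K)
    (hσ : Tendsto (fun k => ∫ x, U k x ^ 2 ∂(ν k)) atTop (𝓝 σ2)) (hm : Tendsto m atTop atTop)
    (hs : Tendsto (fun k => m k * s k ^ 2) atTop (𝓝 1)) :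
    Tendsto (fun k => (∫ x, Complex.exp ((s k * U k x : ℝ) * Complex.I) ∂(ν k)) ^ (m k)) atTop
      (𝓝 (Complex.exp (-σ2 / 2 : ℝ))) := by
  have hσ0 : 0 ≤ σ2 := ge_of_tendsto' hσ fun k => integral_nonneg fun x => sq_nonneg _
  rw [tendsto_iff_norm_sub_tendsto_zero]
  have hmR : Tendsto (fun k => (m k : ℝ)) atTop atTop := tendsto_natCast_atTop_atTop.comp hm
  have hminv : Tendsto (fun k => ((m k : ℝ))⁻¹) atTop (𝓝 0) := tendsto_inv_atTop_zero.comp hmR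
  have hs2 : Tendsto (fun k => s k ^ 2) atTop (𝓝 0) := by
    have := hs.mul hminv
    rw [one_mul] at this
    refine this.congr' ?_
    filter_upwards [hm.eventually_gt_atTop 0] with k hk
    have : (m k : ℝ) ≠ 0 := by positivity
    field_simp
  have hsabs : Tendsto (fun k => |s k|) atTop (𝓝 0) := by
    have := (Real.continuous_sqrt.tendsto 0).comp hs2
    simpa [Function.comp_def, Real.sqrt_sq_eq_abs] using this
  -- The three terms are `m k` times the errors made in one factor: the cubic Taylor remainder, the
  -- deviation of the variance from its limit, and the gap between 1 - y and exp(-y).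
  set bd : ℕ → ℝ := fun k => 4 * ((m k : ℝ) * s k ^ 2) * |s k| * K
    + |(m k * s k ^ 2) * (∫ x, U k x ^ 2 ∂(ν k)) - σ2| / 2 + (σ2 / 2) ^ 2 * ((m k : ℝ))⁻¹ with hbd
  have hlim : Tendsto bd atTop (𝓝 0) := by
    have a1 : Tendsto (fun k => 4 * ((m k : ℝ) * s k ^ 2) * |s k| * K) atTop (𝓝 (4 * 1 * 0 * K)) :=
      ((hs.const_mul 4).mul hsabs).mul_const K
    have a2 : Tendsto (fun k => |(m k * s k ^ 2) * (∫ x, U k x ^ 2 ∂(ν k)) - σ2| / 2) atTop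
        (𝓝 (|1 * σ2 - σ2| / 2)) := (((hs.mul hσ).sub_const σ2).abs).div_const 2
    have a3 := hminv.const_mul ((σ2 / 2) ^ 2)
    have := (a1.add a2).add a3
    simpa [hbd] using this
  refine squeeze_zero' (Eventually.of_forall fun k => norm_nonneg _) ?_ hlim
  filter_upwards [hm.eventually_gt_atTop 0] with k hk
  have hmk : (0 : ℝ) < m k := by exact_mod_cast hk
  set a : ℂ := ∫ x, Complex.exp ((s k * U k x : ℝ) * Complex.I) ∂(ν k) with ha_def
  -- The exponent of one factor, chosen so that the `m k`-th power of exp(-y) is exactly the limit.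
  set y : ℝ := σ2 / 2 * ((m k : ℝ))⁻¹ with hy
  set b : ℂ := (Real.exp (-y) : ℂ) with hb_def
  have hy0 : 0 ≤ y := by positivity
  have hb : b ^ (m k) = Complex.exp (-σ2 / 2 : ℝ) := by
    rw [hb_def, Complex.ofReal_exp, ← Complex.exp_nat_mul]
    congr 1
    rw [hy]
    push_cast
    have : (m k : ℂ) ≠ 0 := by exact_mod_cast hmk.ne'
    field_simp
  have ha1 : ‖a‖ ≤ 1 := by
    refine (norm_integral_le_integral_norm _).trans ?_
    simp only [Complex.norm_exp_ofReal_mul_I]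
    simp
  have hb1 : ‖b‖ ≤ 1 := by
    rw [hb_def, Complex.norm_real, Real.norm_of_nonneg (Real.exp_nonneg _)]
    exact Real.exp_le_one_iff.2 (by linarith)
  rw [← hb]
  refine (norm_pow_sub_pow_le_mul ha1 hb1 _).trans ?_
  set w : ℝ := ∫ x, U k x ^ 2 ∂(ν k) with hw
  have e : a - b = (a - (1 - ((s k ^ 2 * w) / 2 : ℝ))) + ((y - (s k ^ 2 * w) / 2 : ℝ) : ℂ)
      + (((1 - y) - Real.exp (-y) : ℝ) : ℂ) := by
    rw [hb_def]; push_cast; ring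
  have b1 := norm_integral_exp_sub_le (hU k) (h0 k) (s k)
  have b3 := exp_neg_sub_le hy0
  have hn : ‖a - b‖ ≤ 4 * |s k| ^ 3 * K + |y - (s k ^ 2 * w) / 2| + y ^ 2 := by
    rw [e]
    refine (norm_add_le _ _).trans (add_le_add ((norm_add_le _ _).trans (add_le_add ?_ ?_)) ?_)
    · exact b1.trans (mul_le_mul_of_nonneg_left (hK k) (by positivity))
    · rw [Complex.norm_real, Real.norm_eq_abs]
    · rw [Complex.norm_real, Real.norm_eq_abs]; exact b3
  refine (mul_le_mul_of_nonneg_left hn hmk.le).trans (le_of_eq ?_)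
  rw [hbd]
  have c1 : (m k : ℝ) * (4 * |s k| ^ 3 * K) = 4 * ((m k : ℝ) * s k ^ 2) * |s k| * K := by
    rw [← sq_abs (s k)]; ring
  have c2 : (m k : ℝ) * |y - (s k ^ 2 * w) / 2| = |(m k * s k ^ 2) * w - σ2| / 2 := by
    rw [← abs_of_pos hmk, ← abs_mul, abs_of_pos hmk, abs_sub_comm, ← abs_of_pos (zero_lt_two' ℝ),
      ← abs_div, abs_of_pos (zero_lt_two' ℝ)]
    congr 1
    rw [hy]; field_simp
  have c3 : (m k : ℝ) * y ^ 2 = (σ2 / 2) ^ 2 * ((m k : ℝ))⁻¹ := by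
    rw [hy]; field_simp
  simp only
  rw [← c1, ← c2, ← c3]
  ring

theorem integral_exp_sum_pi {Ω : Type*} [MeasurableSpace Ω] (ν : Measure Ω)
    [IsProbabilityMeasure ν] (U : Ω → ℝ) (m : ℕ) (s : ℝ) :
    ∫ x : Fin m → Ω, Complex.exp ((s * ∑ j, U (x j) : ℝ) * Complex.I) ∂(Measure.pi fun _ => ν)
      = (∫ x, Complex.exp ((s * U x : ℝ) * Complex.I) ∂ν) ^ m := by
  have := integral_fintype_prod_eq_pow (ι := Fin m) (μ := ν)
    (fun x => Complex.exp ((s * U x : ℝ) * Complex.I))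
  rw [Fintype.card_fin] at this
  rw [← this]
  congr 1
  ext x
  rw [← Complex.exp_sum, Finset.mul_sum, Complex.ofReal_sum, Finset.sum_mul]

theorem norm_exp_I_sub_exp_I_le (x y : ℝ) :
    ‖Complex.exp (x * Complex.I) - Complex.exp (y * Complex.I)‖ ≤ |x - y| := by
  have e : Complex.exp (x * Complex.I) - Complex.exp (y * Complex.I)
      = Complex.exp (y * Complex.I) * (Complex.exp (Complex.I * (x - y : ℝ)) - 1) := by
    rw [mul_sub, ← Complex.exp_add]
    push_cast
    ring_nf
  rw [e, norm_mul, Complex.norm_exp_ofReal_mul_I, one_mul]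
  exact Real.norm_exp_I_mul_ofReal_sub_one_le

/-- Characteristic functions of random vectors that are close in probability are close. -/
theorem norm_integral_exp_inner_sub_le {d : ℕ} {Ω : Type*} [MeasurableSpace Ω] {ν : Measure Ω}
    [IsProbabilityMeasure ν] {X Y : Ω → Param d} (hX : Measurable X) (hY : Measurable Y)
    (t : Param d) {τ : ℝ} (hτ : 0 ≤ τ) :
    ‖∫ x, Complex.exp ((inner ℝ (X x) t : ℝ) * Complex.I) ∂ν
      - ∫ x, Complex.exp ((inner ℝ (Y x) t : ℝ) * Complex.I) ∂ν‖
      ≤ τ * ‖t‖ + 2 * ν.real {x | τ < ‖X x - Y x‖} := by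
  have hint : ∀ {Z : Ω → Param d}, Measurable Z →
      Integrable (fun x => Complex.exp ((inner ℝ (Z x) t : ℝ) * Complex.I)) ν := by
    intro Z hZ
    refine Integrable.of_bound (C := 1) ?_ (ae_of_all _ fun x => ?_)
    · exact (by fun_prop : Measurable
        (fun x => Complex.exp ((inner ℝ (Z x) t : ℝ) * Complex.I))).aestronglyMeasurable
    · rw [Complex.norm_exp_ofReal_mul_I]
  have hS : MeasurableSet {x | τ < ‖X x - Y x‖} :=
    measurableSet_lt measurable_const (hX.sub hY).norm
  rw [← integral_sub (hint hX) (hint hY)]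
  refine (norm_integral_le_integral_norm _).trans ?_
  have hle : ∀ x, ‖Complex.exp ((inner ℝ (X x) t : ℝ) * Complex.I)
      - Complex.exp ((inner ℝ (Y x) t : ℝ) * Complex.I)‖
      ≤ τ * ‖t‖ + Set.indicator {x | τ < ‖X x - Y x‖} (fun _ => (2 : ℝ)) x := by
    intro x
    by_cases hx : τ < ‖X x - Y x‖
    · rw [Set.indicator_of_mem (show x ∈ {x | τ < ‖X x - Y x‖} from hx)]
      refine (norm_sub_le _ _).trans ?_
      rw [Complex.norm_exp_ofReal_mul_I, Complex.norm_exp_ofReal_mul_I]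
      have : 0 ≤ τ * ‖t‖ := by positivity
      linarith
    · rw [Set.indicator_of_notMem (show x ∉ {x | τ < ‖X x - Y x‖} from hx), add_zero]
      refine (norm_exp_I_sub_exp_I_le _ _).trans ?_
      rw [← inner_sub_left]
      exact (abs_real_inner_le_norm _ _).trans
        (mul_le_mul_of_nonneg_right (not_lt.1 hx) (norm_nonneg _))
  have hi2 : Integrable (Set.indicator {x | τ < ‖X x - Y x‖} (fun _ => (2 : ℝ))) ν :=
    (integrable_const _).indicator hS
  have hi3 : Integrable (fun x => τ * ‖t‖
      + Set.indicator {x | τ < ‖X x - Y x‖} (fun _ => (2 : ℝ)) x) ν := (integrable_const _).add hi2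
  refine (integral_mono ((hint hX).sub (hint hY)).norm hi3 hle).trans (le_of_eq ?_)
  rw [integral_add (integrable_const _) hi2, integral_indicator hS]
  simp [mul_comm]

/-- A sequence of random vectors, each on its own probability space, is asymptotically standard
normal if it is close in probability to normalized row sums of an array with bounded third moments
and asymptotically standard covariances. -/
theorem tendsto_integral_of_array {d : ℕ} {Ω : ℕ → Type*} [∀ k, MeasurableSpace (Ω k)]
    {ν : ∀ k, Measure (Ω k)} [∀ k, IsProbabilityMeasure (ν k)] {Y : ∀ k, Ω k → Param d}
    {m : ℕ → ℕ} {s : ℕ → ℝ} {K : ℝ} {X : ∀ k, (Fin (m k) → Ω k) → Param d}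
    (hX : ∀ k, Measurable (X k)) (hYm : ∀ k, Measurable (Y k)) (hY : ∀ k, MemLp (Y k) 3 (ν k))
    (h0 : ∀ k t, ∫ x, inner ℝ (Y k x) t ∂(ν k) = 0)
    (hK : ∀ k, ∫ x, ‖Y k x‖ ^ 3 ∂(ν k) ≤ K)
    (hσ : ∀ t, Tendsto (fun k => ∫ x, (inner ℝ (Y k x) t : ℝ) ^ 2 ∂(ν k)) atTop (𝓝 (‖t‖ ^ 2)))
    (hm : Tendsto m atTop atTop) (hs : Tendsto (fun k => m k * s k ^ 2) atTop (𝓝 1))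
    (hXY : ∀ τ : ℝ, 0 < τ → Tendsto (fun k => (Measure.pi fun _ : Fin (m k) => ν k).real
      {x | τ < ‖X k x - s k • ∑ j, Y k (x j)‖}) atTop (𝓝 0))
    (g : BoundedContinuousFunction (Param d) ℝ) :
    Tendsto (fun k => ∫ x, g (X k x) ∂(Measure.pi fun _ : Fin (m k) => ν k)) atTop
      (𝓝 (∫ z, g z ∂(stdGaussian (Param d)))) := by
  set μ : ∀ k, Measure (Fin (m k) → Ω k) := fun k => Measure.pi fun _ => ν k with hμ
  have hcf : ∀ t : Param d, Tendsto (fun k => charFun ((μ k).map (X k)) t) atTop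
      (𝓝 (charFun (stdGaussian (Param d)) t)) := by
    intro t
    have hU : ∀ k, MemLp (fun x => (inner ℝ (Y k x) t : ℝ)) 3 (ν k) := fun k =>
      (hY k).inner_const t
    have hlim := tendsto_integral_exp_pow (K := K * ‖t‖ ^ 3) hU (fun k => h0 k t) (fun k => ?_)
      (hσ t) hm hs
    · have hsum : Tendsto (fun k => ∫ x, Complex.exp
          ((inner ℝ (s k • ∑ j, Y k (x j)) t : ℝ) * Complex.I) ∂(μ k)) atTop
          (𝓝 (charFun (stdGaussian (Param d)) t)) := by
        rw [charFun_stdGaussian]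
        convert hlim using 2 with k
        · rw [← integral_exp_sum_pi]
          simp only [inner_smul_left, sum_inner, hμ]
          rfl
        · push_cast; rfl
      have hdiff : Tendsto (fun k => ∫ x, Complex.exp ((inner ℝ (X k x) t : ℝ) * Complex.I) ∂(μ k)
          - ∫ x, Complex.exp ((inner ℝ (s k • ∑ j, Y k (x j)) t : ℝ) * Complex.I) ∂(μ k)) atTop
          (𝓝 0) := by
        rw [tendsto_zero_iff_norm_tendsto_zero]
        rw [Metric.tendsto_atTop]
        intro ε hε
        -- With this τ the deterministic part `τ * ‖t‖` is at most ε/4; the probability below ε/8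
        -- enters twice and adds another ε/4.
        set τ : ℝ := ε / (4 * (‖t‖ + 1)) with hτ
        have hτ0 : 0 < τ := by positivity
        obtain ⟨N, hN⟩ := Metric.tendsto_atTop.1 (hXY τ hτ0) (ε / 8) (by positivity)
        refine ⟨N, fun k hk => ?_⟩
        have h1 := hN k hk
        rw [Real.dist_eq, sub_zero, abs_of_nonneg measureReal_nonneg] at h1
        rw [Real.dist_eq, sub_zero, abs_of_nonneg (norm_nonneg _)]
        have hYs : Measurable fun x : Fin (m k) → Ω k => s k • ∑ j, Y k (x j) :=
          (Finset.measurable_fun_sum _ fun j _ =>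
            (hYm k).comp (measurable_pi_apply j)).const_smul (s k)
        refine (norm_integral_exp_inner_sub_le (hX k) hYs t hτ0.le).trans_lt ?_
        have h2 : τ * ‖t‖ ≤ ε / 4 := by
          rw [hτ, div_mul_eq_mul_div, div_le_div_iff₀ (by positivity) (by norm_num)]
          nlinarith [norm_nonneg t]
        linarith
      have := hdiff.add hsum
      rw [zero_add] at this
      refine this.congr fun k => ?_
      rw [sub_add_cancel, charFun_apply, integral_map (hX k).aemeasurable]
      exact (by fun_prop : Measurable
        fun x : Param d => Complex.exp ((inner ℝ x t : ℝ) * Complex.I)).aestronglyMeasurable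
    · have hint : Integrable (fun x => ‖Y k x‖ ^ 3) (ν k) := (hY k).integrable_norm_pow (by norm_num)
      calc ∫ x, |(inner ℝ (Y k x) t : ℝ)| ^ 3 ∂(ν k)
          ≤ ∫ x, ‖Y k x‖ ^ 3 * ‖t‖ ^ 3 ∂(ν k) := by
            refine integral_mono_of_nonneg (ae_of_all _ fun x => by positivity)
              (hint.mul_const _) (ae_of_all _ fun x => ?_)
            simp only
            rw [← mul_pow]
            exact pow_le_pow_left₀ (abs_nonneg _) (abs_real_inner_le_norm _ _) 3
        _ ≤ K * ‖t‖ ^ 3 := by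
            rw [integral_mul_const]
            exact mul_le_mul_of_nonneg_right (hK k) (by positivity)
  have hprob : ∀ k, IsProbabilityMeasure ((μ k).map (X k)) := fun k =>
    Measure.isProbabilityMeasure_map (hX k).aemeasurable
  have hconv := ProbabilityMeasure.tendsto_of_tendsto_charFun
    (μ := fun k => (⟨(μ k).map (X k), hprob k⟩ : ProbabilityMeasure (Param d)))
    (μ₀ := ⟨stdGaussian (Param d), inferInstance⟩) hcf
  refine (ProbabilityMeasure.tendsto_iff_forall_integral_tendsto.1 hconv g).congr fun k => ?_
  exact integral_map (hX k).aemeasurable g.continuous.aestronglyMeasurable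

end RDCS

/-! ### Laws of large numbers for the data and for the pilot sample. -/

namespace RDCS

/-! ### Averages of independent draws -/

theorem integral_mean_pi {S : Type*} [MeasurableSpace S] {ν : Measure S} [IsProbabilityMeasure ν]
    {φ : S → ℝ} (hφ : Integrable φ ν) {m : ℕ} (hm : 0 < m) :
    ∫ x : Fin m → S, (m : ℝ)⁻¹ * ∑ j, φ (x j) ∂(Measure.pi fun _ => ν) = ∫ s, φ s ∂ν := by
  have hi : ∀ j : Fin m, Integrable (fun x : Fin m → S => φ (x j)) (Measure.pi fun _ => ν) :=
    fun j => (measurePreserving_eval (fun _ : Fin m => ν) j).integrable_comp_of_integrable hφ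
  rw [integral_const_mul, integral_finsetSum _ fun j _ => hi j]
  have : ∀ j : Fin m, ∫ x : Fin m → S, φ (x j) ∂(Measure.pi fun _ => ν) = ∫ s, φ s ∂ν := fun j =>
    integral_comp_eval (μ := fun _ : Fin m => ν) hφ.aestronglyMeasurable
  simp only [this, Finset.sum_const, Finset.card_univ, Fintype.card_fin, nsmul_eq_mul]
  rw [inv_mul_cancel_left₀ (by positivity)]

/-- Chebyshev's inequality for the average of independent draws. -/
theorem measure_pi_mean_sub_ge_le {S : Type*} [MeasurableSpace S] {ν : Measure S}
    [IsProbabilityMeasure ν] {φ : S → ℝ} (hφ : MemLp φ 2 ν) {m : ℕ} (hm : 0 < m) {τ : ℝ}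
    (hτ : 0 < τ) : (Measure.pi fun _ : Fin m => ν)
      {x | τ ≤ |(m : ℝ)⁻¹ * ∑ j, φ (x j) - ∫ s, φ s ∂ν|}
      ≤ ENNReal.ofReal ((∫ s, φ s ^ 2 ∂ν) / (m * τ ^ 2)) := by
  have hmR : (0 : ℝ) < m := by exact_mod_cast hm
  have hmem : ∀ j : Fin m, MemLp (fun x : Fin m → S => φ (x j)) 2 (Measure.pi fun _ => ν) :=
    fun j => hφ.comp_measurePreserving (measurePreserving_eval (fun _ : Fin m => ν) j)
  have hsum : MemLp (fun x : Fin m → S => (m : ℝ)⁻¹ * ∑ j, φ (x j)) 2 (Measure.pi fun _ => ν) :=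
    (memLp_finsetSum _ fun j _ => hmem j).const_mul _
  have h := meas_ge_le_variance_div_sq hsum hτ
  rw [integral_mean_pi (hφ.integrable (by norm_num)) hm] at h
  refine h.trans (ENNReal.ofReal_le_ofReal ?_)
  rw [variance_const_mul]
  have hv := variance_sum_pi (μ := fun _ : Fin m => ν) (X := fun _ => φ) fun _ => hφ
  have e : (∑ j : Fin m, fun ω : Fin m → S => φ (ω j)) = fun x : Fin m → S => ∑ j, φ (x j) := by
    ext x; simp
  rw [e] at hv
  rw [hv]
  simp only [Finset.sum_const, Finset.card_univ, Fintype.card_fin, nsmul_eq_mul]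
  have hvar : variance φ ν ≤ ∫ s, φ s ^ 2 ∂ν := by
    simpa using variance_le_expectation_sq (μ := ν) hφ.aestronglyMeasurable
  rw [div_le_div_iff₀ (by positivity) (by positivity)]
  have e2 : (m : ℝ)⁻¹ ^ 2 * (m * variance φ ν) * (m * τ ^ 2) = variance φ ν * τ ^ 2 := by
    field_simp
  rw [e2]
  exact mul_le_mul_of_nonneg_right hvar (by positivity)

/-- Markov's inequality for the average of independent draws. -/
theorem measure_pi_mean_ge_le {S : Type*} [MeasurableSpace S] {ν : Measure S}
    [IsProbabilityMeasure ν] {φ : S → ℝ} (hφ : Integrable φ ν) (h0 : ∀ s, 0 ≤ φ s) {m : ℕ}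
    (hm : 0 < m) {K : ℝ} (hK : 0 < K) : (Measure.pi fun _ : Fin m => ν)
      {x | K ≤ (m : ℝ)⁻¹ * ∑ j, φ (x j)} ≤ ENNReal.ofReal ((∫ s, φ s ∂ν) / K) := by
  have hi : Integrable (fun x : Fin m → S => (m : ℝ)⁻¹ * ∑ j, φ (x j)) (Measure.pi fun _ => ν) :=
    (integrable_finsetSum _ fun j _ =>
      (measurePreserving_eval (fun _ : Fin m => ν) j).integrable_comp_of_integrable hφ).const_mul _
  have h := mul_meas_ge_le_integral_of_nonneg (ae_of_all _ fun x => by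
    simp only [Pi.zero_apply]
    exact mul_nonneg (by positivity) (Finset.sum_nonneg fun j _ => h0 _)) hi K
  rw [integral_mean_pi hφ hm] at h
  rw [← ofReal_measureReal]
  refine ENNReal.ofReal_le_ofReal ?_
  rw [le_div_iff₀ hK]
  linarith

/-! ### The pilot draws -/

instance instIsProbabilityMeasureDataLaw (P : Measure Obs) [IsProbabilityMeasure P] (n : ℕ) :
    IsProbabilityMeasure (dataLaw P n) := by
  unfold dataLaw; infer_instance

/-- One uniform draw from the indices. -/
theorem isProbabilityMeasure_uniformOn_univ {n : ℕ} (hn : 0 < n) :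
    IsProbabilityMeasure (uniformOn (Set.univ : Set (Fin n))) :=
  have : Nonempty (Fin n) := ⟨⟨0, hn⟩⟩
  isProbabilityMeasure_uniformOn Set.finite_univ Set.univ_nonempty

/-- The uniform law on index tuples is a product law, so the inequalities for averages of
independent draws apply to the pilot sample. -/
theorem pilotLaw_eq_pi (n r₀ : ℕ) :
    pilotLaw n r₀ = Measure.pi fun _ : Fin r₀ => uniformOn (Set.univ : Set (Fin n)) := by
  rw [pilotLaw, ← uniformOn_pi, Set.pi_univ]

theorem isProbabilityMeasure_pilotLaw {n : ℕ} (hn : 0 < n) (r₀ : ℕ) :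
    IsProbabilityMeasure (pilotLaw n r₀) := by
  have := isProbabilityMeasure_uniformOn_univ hn
  rw [pilotLaw_eq_pi]
  infer_instance

theorem integral_uniformOn_univ {n : ℕ} (φ : Fin n → ℝ) :
    ∫ i, φ i ∂(uniformOn (Set.univ : Set (Fin n))) = (n : ℝ)⁻¹ * ∑ i, φ i := by
  rw [integral_fintype (Integrable.of_finite), Finset.mul_sum]
  refine Finset.sum_congr rfl fun i _ => ?_
  rw [Measure.real, uniformOn_univ, Measure.count_singleton]
  simp

theorem ae_dataLaw {P : Measure Obs} [IsProbabilityMeasure P] {p : Obs → Prop}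
    (h : ∀ᵐ x ∂P, p x) (n : ℕ) : ∀ᵐ D ∂(dataLaw P n), ∀ i, p (D i) :=
  ae_all_iff.2 fun _ => Measure.tendsto_eval_ae_ae.eventually h

theorem ae_prod_of_ae_dataLaw {P : Measure Obs} [IsProbabilityMeasure P] {n r₀ : ℕ}
    {p : (Fin n → Obs) → Prop} (h : ∀ᵐ D ∂(dataLaw P n), p D) :
    ∀ᵐ ω ∂((dataLaw P n).prod (pilotLaw n r₀)), p ω.1 :=
  Measure.quasiMeasurePreserving_fst.ae h

theorem integral_mean_dataLaw {P : Measure Obs} [IsProbabilityMeasure P] {φ : Obs → ℝ}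
    (hφ : Integrable φ P) {n : ℕ} (hn : 0 < n) :
    ∫ D, (n : ℝ)⁻¹ * ∑ i, φ (D i) ∂(dataLaw P n) = ∫ x, φ x ∂P :=
  integral_mean_pi hφ hn

/-- A conditional bound given the data, linear in a data average, is integrated by Fubini; the
expectation of that average no longer depends on n. -/
theorem measure_prod_le_of_section_le {P : Measure Obs} [IsProbabilityMeasure P] {n r₀ : ℕ}
    (hn : 0 < n) {φ : Obs → ℝ} (hφ : Integrable φ P) (h0 : ∀ x, 0 ≤ φ x) {a : ℝ}
    {S : Set ((Fin n → Obs) × (Fin r₀ → Fin n))} (hS : MeasurableSet S)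
    (h : ∀ D, pilotLaw n r₀ (Prod.mk D ⁻¹' S)
      ≤ ENNReal.ofReal (((n : ℝ)⁻¹ * ∑ i, φ (D i)) / a)) :
    ((dataLaw P n).prod (pilotLaw n r₀)) S ≤ ENNReal.ofReal ((∫ x, φ x ∂P) / a) := by
  have hi : Integrable (fun D : Fin n → Obs => (n : ℝ)⁻¹ * ∑ i, φ (D i)) (dataLaw P n) :=
    (integrable_finsetSum _ fun j _ =>
      (measurePreserving_eval (fun _ : Fin n => P) j).integrable_comp_of_integrable hφ).const_mul _
  rw [Measure.prod_apply hS]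
  refine (lintegral_mono h).trans ?_
  by_cases ha : 0 ≤ a
  · rw [← ofReal_integral_eq_lintegral_ofReal (hi.div_const a) (ae_of_all _ fun D => by
      simp only [Pi.zero_apply]
      exact div_nonneg (mul_nonneg (by positivity) (Finset.sum_nonneg fun j _ => h0 _)) ha),
      integral_div, integral_mean_dataLaw hφ hn]
  · have : ∀ D : Fin n → Obs, ENNReal.ofReal (((n : ℝ)⁻¹ * ∑ i, φ (D i)) / a) = 0 := fun D =>
      ENNReal.ofReal_of_nonpos (div_nonpos_of_nonneg_of_nonpos
        (mul_nonneg (by positivity) (Finset.sum_nonneg fun j _ => h0 _)) (not_le.1 ha).le)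
    simp [this]

/-- Joint measurability holds because there are only finitely many index tuples, and for each of
them the average is measurable in the data. -/
theorem measurable_pilot_mean {n r₀ : ℕ} {φ : Obs → ℝ} (hφ : Measurable φ) :
    Measurable fun ω : (Fin n → Obs) × (Fin r₀ → Fin n) =>
      (r₀ : ℝ)⁻¹ * ∑ j, φ (ω.1 (ω.2 j)) := by
  refine measurable_from_prod_countable_left fun J => ?_
  exact (Finset.measurable_fun_sum _ fun j _ =>
    hφ.comp (measurable_pi_apply (J j))).const_mul _

/-- The pilot average is close to the expectation. -/
theorem measure_pilot_mean_sub_ge_le {P : Measure Obs} [IsProbabilityMeasure P] {n r₀ : ℕ}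
    (hn : 0 < n) (hr₀ : 0 < r₀) {φ : Obs → ℝ} (hφ : MemLp φ 2 P) {τ : ℝ} (hτ : 0 < τ) :
    ((dataLaw P n).prod (pilotLaw n r₀))
      {ω | 2 * τ ≤ |(r₀ : ℝ)⁻¹ * ∑ j, φ (ω.1 (ω.2 j)) - ∫ x, φ x ∂P|}
      ≤ ENNReal.ofReal ((∫ x, φ x ^ 2 ∂P) / (r₀ * τ ^ 2))
        + ENNReal.ofReal ((∫ x, φ x ^ 2 ∂P) / (n * τ ^ 2)) := by
  have := isProbabilityMeasure_uniformOn_univ hn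
  have := isProbabilityMeasure_pilotLaw hn r₀
  -- Fubini needs a measurable event, while φ is only almost everywhere measurable; almost surely no
  -- datum distinguishes φ from its measurable version.
  wlog hmeas : Measurable φ generalizing φ
  · have hmk := hφ.aestronglyMeasurable.ae_eq_mk
    have hmkL : MemLp (hφ.aestronglyMeasurable.mk φ) 2 P := (memLp_congr_ae hmk).1 hφ
    have h := this hmkL hφ.aestronglyMeasurable.stronglyMeasurable_mk.measurable
    have e1 : ∫ x, hφ.aestronglyMeasurable.mk φ x ∂P = ∫ x, φ x ∂P :=
      integral_congr_ae hmk.symm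
    have e2 : ∫ x, hφ.aestronglyMeasurable.mk φ x ^ 2 ∂P = ∫ x, φ x ^ 2 ∂P :=
      integral_congr_ae (hmk.symm.fun_comp (· ^ 2))
    rw [e1, e2] at h
    refine le_trans (measure_mono_ae ?_) h
    filter_upwards [ae_prod_of_ae_dataLaw (r₀ := r₀) (ae_dataLaw hmk n)] with ω hω
    intro (h : _ ≤ _)
    change _ ≤ _
    simpa only [hω] using h
  -- The deviation is split at the full-data average: conditional Chebyshev for the pilot draws,
  -- then Chebyshev for the data. Each part is allowed τ, whence 2τ in the statement.
  set S : Set ((Fin n → Obs) × (Fin r₀ → Fin n)) :=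
    {ω | τ ≤ |(r₀ : ℝ)⁻¹ * ∑ j, φ (ω.1 (ω.2 j)) - (n : ℝ)⁻¹ * ∑ i, φ (ω.1 i)|} with hSdef
  have hS : MeasurableSet S := by
    refine measurableSet_le measurable_const ((measurable_pilot_mean hmeas).sub ?_).abs
    exact (Finset.measurable_fun_sum _ fun i _ =>
      hmeas.comp ((measurable_pi_apply i).comp measurable_fst)).const_mul _
  have h1 : ((dataLaw P n).prod (pilotLaw n r₀)) S
      ≤ ENNReal.ofReal ((∫ x, φ x ^ 2 ∂P) / (r₀ * τ ^ 2)) := by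
    refine measure_prod_le_of_section_le hn hφ.integrable_sq (fun x => sq_nonneg _) hS fun D => ?_
    have h := measure_pi_mean_sub_ge_le (ν := uniformOn (Set.univ : Set (Fin n)))
      (φ := fun i => φ (D i)) MemLp.of_discrete hr₀ hτ
    rw [integral_uniformOn_univ, integral_uniformOn_univ, ← pilotLaw_eq_pi] at h
    exact h
  have h2 : ((dataLaw P n).prod (pilotLaw n r₀))
      (Prod.fst ⁻¹' {D | τ ≤ |(n : ℝ)⁻¹ * ∑ i, φ (D i) - ∫ x, φ x ∂P|})
      ≤ ENNReal.ofReal ((∫ x, φ x ^ 2 ∂P) / (n * τ ^ 2)) := by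
    have := measure_pi_mean_sub_ge_le hφ hn hτ
    rw [← Set.prod_univ, Measure.prod_prod, measure_univ, mul_one]
    exact this
  refine le_trans (measure_mono fun ω hω => ?_) ((measure_union_le _ _).trans (add_le_add h1 h2))
  by_contra hcon
  simp only [Set.mem_union, not_or, hSdef, Set.mem_ofPred_eq, Set.mem_preimage, not_le] at hcon hω
  have := abs_sub_le ((r₀ : ℝ)⁻¹ * ∑ j, φ (ω.1 (ω.2 j))) ((n : ℝ)⁻¹ * ∑ i, φ (ω.1 i))
    (∫ x, φ x ∂P)
  linarith [hcon.1, hcon.2]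

end RDCS

/-! ### Calculus of the log-likelihood, its weighted sums and its expectation. -/

namespace RDCS

/-! ### Derivatives of the log-likelihood -/

variable {d : ℕ}

/-- The Hessian of `l(x, ·)` as a linear map. -/
noncomputable def hessL (f : ℝ → Param d → ℝ) (x : Obs) (θ : Param d) : Param d →L[ℝ] Param d :=
  fderiv ℝ (score f x) θ

theorem hasGradientAt_logLik {f : ℝ → Param d → ℝ} {x : Obs} {θ : Param d}
    (h : ContDiffAt ℝ 2 (fun ϑ => logLik f x ϑ) θ) :
    HasGradientAt (fun ϑ => logLik f x ϑ) (score f x θ) θ :=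
  (h.differentiableAt (by norm_num)).hasGradientAt

theorem differentiableAt_fderiv_logLik {f : ℝ → Param d → ℝ} {x : Obs} {θ : Param d}
    (h : ContDiffAt ℝ 2 (fun ϑ => logLik f x ϑ) θ) :
    DifferentiableAt ℝ (fderiv ℝ (fun ϑ => logLik f x ϑ)) θ :=
  (h.fderiv_right (m := 1) (by norm_num)).differentiableAt (by norm_num)

/-- The Riesz isomorphism as a real-linear map. -/
noncomputable def rieszL (d : ℕ) : StrongDual ℝ (Param d) →L[ℝ] Param d :=
  LinearMap.toContinuousLinearMap
    { toFun := (InnerProductSpace.toDual ℝ (Param d)).symm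
      map_add' := map_add _
      map_smul' := fun c ℓ => by simp }

theorem inner_rieszL (ℓ : StrongDual ℝ (Param d)) (u : Param d) : inner ℝ (rieszL d ℓ) u = ℓ u :=
  InnerProductSpace.toDual_symm_apply

/-- The gradient is the Riesz image of the derivative, so the Hessian is the Riesz image of the
second derivative. In this form the symmetry of second derivatives yields self-adjointness in
`inner_hessL_comm`. -/
theorem hasFDerivAt_score' {f : ℝ → Param d → ℝ} {x : Obs} {θ : Param d}
    (h : ContDiffAt ℝ 2 (fun ϑ => logLik f x ϑ) θ) :
    HasFDerivAt (score f x) ((rieszL d).comp (fderiv ℝ (fderiv ℝ (fun ϑ => logLik f x ϑ)) θ)) θ :=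
  (rieszL d).hasFDerivAt.comp θ (differentiableAt_fderiv_logLik h).hasFDerivAt

theorem hasFDerivAt_score {f : ℝ → Param d → ℝ} {x : Obs} {θ : Param d}
    (h : ContDiffAt ℝ 2 (fun ϑ => logLik f x ϑ) θ) :
    HasFDerivAt (score f x) (hessL f x θ) θ :=
  (hasFDerivAt_score' h).differentiableAt.hasFDerivAt

theorem hess_apply {f : ℝ → Param d → ℝ} {x : Obs} {θ : Param d}
    (h : ContDiffAt ℝ 2 (fun ϑ => logLik f x ϑ) θ) (j k : Fin d) :
    hess f x θ j k = hessL f x θ (EuclideanSpace.single k 1) j := by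
  have h1 := (EuclideanSpace.proj (𝕜 := ℝ) j).hasFDerivAt.comp θ (hasFDerivAt_score h)
  have h2 : (fun ϑ => score f x ϑ j) = (EuclideanSpace.proj (𝕜 := ℝ) j) ∘ score f x := rfl
  rw [hess, Matrix.of_apply, h2, h1.fderiv]
  rfl

theorem inner_hessL_comm {f : ℝ → Param d → ℝ} {x : Obs} {θ : Param d}
    (h : ContDiffAt ℝ 2 (fun ϑ => logLik f x ϑ) θ) (v w : Param d) :
    inner ℝ (hessL f x θ v) w = inner ℝ (hessL f x θ w) v := by
  have hs := h.isSymmSndFDerivAt (by simp)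
  rw [hessL, (hasFDerivAt_score' h).fderiv]
  simp only [ContinuousLinearMap.comp_apply]
  rw [inner_rieszL, inner_rieszL]
  exact hs v w

theorem apply_single_toEuclideanCLM (A : Matrix (Fin d) (Fin d) ℝ) (j k : Fin d) :
    Matrix.toEuclideanCLM (𝕜 := ℝ) A (EuclideanSpace.single k 1) j = A j k := by
  simp [Matrix.ofLp_toEuclideanCLM]

theorem toEuclideanCLM_eq {A : Matrix (Fin d) (Fin d) ℝ} {B : Param d →L[ℝ] Param d}
    (h : ∀ j k, A j k = B (EuclideanSpace.single k 1) j) :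
    Matrix.toEuclideanCLM (𝕜 := ℝ) A = B := by
  have : ‖Matrix.toEuclideanCLM (𝕜 := ℝ) A - B‖ ≤ 0 := by
    refine (opNorm_le_sum_entries _).trans (le_of_eq ?_)
    refine Finset.sum_eq_zero fun j _ => Finset.sum_eq_zero fun k _ => ?_
    rw [abs_eq_zero, sub_apply, PiLp.sub_apply, apply_single_toEuclideanCLM,
      h, sub_self]
  exact sub_eq_zero.1 (norm_le_zero_iff.1 this)

/-- `l(x, ·)` is twice continuously differentiable on `Θ`, and `B` bounds its Hessian and is a
Lipschitz constant for it. -/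
structure Dominated (f : ℝ → Param d → ℝ) (Θ : Set (Param d)) (B : ℝ) (x : Obs) : Prop where
  nonneg : 0 ≤ B
  smooth : ∀ θ ∈ Θ, ContDiffAt ℝ 2 (fun ϑ => logLik f x ϑ) θ
  bound : ∀ θ ∈ Θ, ‖hessL f x θ‖ ≤ B
  lipschitz : ∀ θ ∈ Θ, ∀ θ' ∈ Θ, ‖hessL f x θ - hessL f x θ'‖ ≤ B * ‖θ - θ'‖

theorem Dominated.norm_score_sub_le {f : ℝ → Param d → ℝ} {Θ : Set (Param d)} {B : ℝ} {x : Obs}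
    (h : Dominated f Θ B x) (hΘ : Convex ℝ Θ) {θ θ' : Param d} (hθ : θ ∈ Θ) (hθ' : θ' ∈ Θ) :
    ‖score f x θ - score f x θ'‖ ≤ B * ‖θ - θ'‖ :=
  hΘ.norm_image_sub_le_of_norm_hasFDerivWithin_le
    (fun θ hθ => (hasFDerivAt_score (h.smooth θ hθ)).hasFDerivWithinAt) h.bound hθ' hθ

/-- Boundedness of `Θ` turns control of the Hessian at one point, together with the Lipschitz
condition, into one square-integrable envelope on all of `Θ`. With R the radius of a ball about `θ₀`
containing `Θ`, the factor R + 1 serves twice: R pays for the uniform bound, and the 1 makes the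
same function a Lipschitz constant. -/
theorem exists_dominated {f : ℝ → Param d → ℝ} {Θ : Set (Param d)} {P : Measure Obs}
    [IsProbabilityMeasure P] (hcomp : IsCompact Θ) (hmodel : LifetimeModel f Θ P)
    (hhess : HessianCondition f Θ P) {θ₀ : Param d} (h₀ : θ₀ ∈ Θ) :
    ∃ B : Obs → ℝ, MemLp B 2 P ∧ (∀ x, 0 ≤ B x) ∧ ∀ᵐ x ∂P, Dominated f Θ (B x) x := by
  obtain ⟨ψ, hψ, hlip⟩ := hhess.lipschitz
  obtain ⟨R, hR0, hR⟩ := hcomp.isBounded.subset_ball_lt 0 θ₀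
  refine ⟨fun x => (∑ j, ∑ k, |hess f x θ₀ j k|) + d ^ 2 * |ψ x| * (R + 1), ?_, ?_, ?_⟩
  · refine MemLp.add (memLp_finsetSum _ fun j _ => memLp_finsetSum _ fun k _ =>
      (hhess.memLp_hess θ₀ h₀ j k).abs) ?_
    have := (hψ.abs.const_mul ((d : ℝ) ^ 2)).mul_const (R + 1)
    simpa using this
  · intro x
    positivity
  · filter_upwards [hmodel.smooth, hlip] with x hs hl
    have hdiff : ∀ θ ∈ Θ, ∀ θ' ∈ Θ, ‖hessL f x θ - hessL f x θ'‖ ≤ d ^ 2 * |ψ x| * ‖θ - θ'‖ := by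
      intro θ hθ θ' hθ'
      refine (opNorm_le_sum_entries _).trans ?_
      calc ∑ j, ∑ k, |(hessL f x θ - hessL f x θ') (EuclideanSpace.single k 1) j|
          ≤ ∑ _j : Fin d, ∑ _k : Fin d, |ψ x| * ‖θ - θ'‖ := by
            refine Finset.sum_le_sum fun j _ => Finset.sum_le_sum fun k _ => ?_
            rw [sub_apply, PiLp.sub_apply, ← hess_apply (hs θ hθ),
              ← hess_apply (hs θ' hθ')]
            exact (hl θ hθ θ' hθ' j k).trans
              (mul_le_mul_of_nonneg_right (le_abs_self _) (norm_nonneg _))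
        _ = d ^ 2 * |ψ x| * ‖θ - θ'‖ := by simp; ring
    refine ⟨by positivity, hs, fun θ hθ => ?_, fun θ hθ θ' hθ' => ?_⟩
    · have e : hessL f x θ = hessL f x θ₀ + (hessL f x θ - hessL f x θ₀) := by abel
      rw [e]
      refine (norm_add_le _ _).trans (add_le_add ?_ ?_)
      · refine (opNorm_le_sum_entries _).trans (le_of_eq ?_)
        simp only [hess_apply (hs θ₀ h₀)]
      · refine (hdiff θ hθ θ₀ h₀).trans (mul_le_mul_of_nonneg_left ?_ (by positivity))
        have := hR hθ
        rw [Metric.mem_ball, dist_eq_norm] at this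
        linarith
    · refine (hdiff θ hθ θ' hθ').trans (mul_le_mul_of_nonneg_right ?_ (norm_nonneg _))
      have h1 : 0 ≤ ∑ j, ∑ k, |hess f x θ₀ j k| := by positivity
      have h2 : 0 ≤ (d : ℝ) ^ 2 * |ψ x| * R := by positivity
      linarith

/-! ### Weighted log-likelihoods -/

section Weighted

variable {ι : Type*} [Fintype ι]

theorem hasGradientAt_sum_logLik {f : ℝ → Param d → ℝ} (w : ι → ℝ) (x : ι → Obs) {θ : Param d}
    (h : ∀ i, ContDiffAt ℝ 2 (fun ϑ => logLik f (x i) ϑ) θ) :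
    HasGradientAt (fun ϑ => ∑ i, w i * logLik f (x i) ϑ) (∑ i, w i • score f (x i) θ) θ := by
  rw [hasGradientAt_iff_hasFDerivAt]
  have h1 : HasFDerivAt (fun ϑ => ∑ i, w i * logLik f (x i) ϑ)
      (∑ i, w i • InnerProductSpace.toDual ℝ (Param d) (score f (x i) θ)) θ := by
    refine HasFDerivAt.fun_sum fun i _ => ?_
    exact (hasGradientAt_logLik (h i)).hasFDerivAt.const_mul (w i)
  have e : InnerProductSpace.toDual ℝ (Param d) (∑ i, w i • score f (x i) θ)
      = ∑ i, w i • InnerProductSpace.toDual ℝ (Param d) (score f (x i) θ) := by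
    simp [map_sum]
  rw [e]
  exact h1

theorem hasFDerivAt_sum_score {f : ℝ → Param d → ℝ} (w : ι → ℝ) (x : ι → Obs) {θ : Param d}
    (h : ∀ i, ContDiffAt ℝ 2 (fun ϑ => logLik f (x i) ϑ) θ) :
    HasFDerivAt (fun ϑ => ∑ i, w i • score f (x i) ϑ) (∑ i, w i • hessL f (x i) θ) θ :=
  HasFDerivAt.fun_sum fun i _ => (hasFDerivAt_score (h i)).const_smul (w i)

theorem norm_sum_hessL_sub_le {f : ℝ → Param d → ℝ} {Θ : Set (Param d)} {w : ι → ℝ} {x : ι → Obs}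
    {B : ι → ℝ} (hw : ∀ i, 0 ≤ w i) (h : ∀ i, Dominated f Θ (B i) (x i)) {θ θ' : Param d}
    (hθ : θ ∈ Θ) (hθ' : θ' ∈ Θ) :
    ‖∑ i, w i • hessL f (x i) θ - ∑ i, w i • hessL f (x i) θ'‖ ≤ (∑ i, w i * B i) * ‖θ - θ'‖ := by
  rw [← Finset.sum_sub_distrib, Finset.sum_mul]
  refine (norm_sum_le _ _).trans (Finset.sum_le_sum fun i _ => ?_)
  have e : w i • hessL f (x i) θ - w i • hessL f (x i) θ'
      = w i • (hessL f (x i) θ - hessL f (x i) θ') := (smul_sub _ _ _).symm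
  rw [e, norm_smul, Real.norm_of_nonneg (hw i), mul_assoc]
  exact mul_le_mul_of_nonneg_left ((h i).lipschitz θ hθ θ' hθ') (hw i)

theorem sum_hessL_apply {f : ℝ → Param d → ℝ} (w : ι → ℝ) (x : ι → Obs) {θ : Param d}
    (h : ∀ i, ContDiffAt ℝ 2 (fun ϑ => logLik f (x i) ϑ) θ) (j k : Fin d) :
    (∑ i, w i • hessL f (x i) θ) (EuclideanSpace.single k 1) j = ∑ i, w i * hess f (x i) θ j k := by
  simp [hess_apply (h _)]

/-- A Hessian that is close to a negative definite one is negative definite. -/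
theorem inner_le_of_norm_sub_le {A M : Param d →L[ℝ] Param d} {c τ : ℝ} (h : ‖A - M‖ ≤ τ)
    (hM : ∀ v, inner ℝ (M v) v ≤ -c * ‖v‖ ^ 2) (v : Param d) :
    inner ℝ (A v) v ≤ -(c - τ) * ‖v‖ ^ 2 := by
  have e : inner ℝ (A v) v = inner ℝ (M v) v + inner ℝ ((A - M) v) v := by
    rw [sub_apply, inner_sub_left]; ring
  have h1 : inner ℝ ((A - M) v) v ≤ τ * ‖v‖ ^ 2 := by
    refine (real_inner_le_norm _ _).trans ?_
    rw [sq, ← mul_assoc]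
    exact mul_le_mul_of_nonneg_right (((A - M).le_opNorm v).trans
      (mul_le_mul_of_nonneg_right h (norm_nonneg _))) (norm_nonneg _)
  rw [e]
  linarith [hM v]

end Weighted

/-! ### Population quantities -/

/-- The expected Hessian `E l̈(x, θ)` as a linear map. -/
noncomputable def popHess (f : ℝ → Param d → ℝ) (P : Measure Obs) (θ : Param d) :
    Param d →L[ℝ] Param d :=
  Matrix.toEuclideanCLM (𝕜 := ℝ) (Matrix.of fun j k => ∫ x, hess f x θ j k ∂P)

theorem norm_popHess_sub_le {f : ℝ → Param d → ℝ} {Θ : Set (Param d)} {P : Measure Obs}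
    [IsProbabilityMeasure P] (hhess : HessianCondition f Θ P) {B : Obs → ℝ} (hB : MemLp B 2 P)
    (hdom : ∀ᵐ x ∂P, Dominated f Θ (B x) x) {θ θ' : Param d} (hθ : θ ∈ Θ) (hθ' : θ' ∈ Θ) :
    ‖popHess f P θ - popHess f P θ'‖ ≤ d ^ 2 * (∫ x, B x ∂P) * ‖θ - θ'‖ := by
  refine (opNorm_le_sum_entries _).trans ?_
  calc ∑ j, ∑ k, |(popHess f P θ - popHess f P θ') (EuclideanSpace.single k 1) j|
      ≤ ∑ _j : Fin d, ∑ _k : Fin d, (∫ x, B x ∂P) * ‖θ - θ'‖ := by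
        refine Finset.sum_le_sum fun j _ => Finset.sum_le_sum fun k _ => ?_
        rw [sub_apply, PiLp.sub_apply, popHess, popHess,
          apply_single_toEuclideanCLM, apply_single_toEuclideanCLM, Matrix.of_apply,
          Matrix.of_apply, ← integral_sub ((hhess.memLp_hess θ hθ j k).integrable (by norm_num))
          ((hhess.memLp_hess θ' hθ' j k).integrable (by norm_num)), ← integral_mul_const]
        refine (abs_integral_le_integral_abs).trans (integral_mono_of_nonneg
          (ae_of_all _ fun x => abs_nonneg _) ((hB.integrable (by norm_num)).mul_const _) ?_)
        filter_upwards [hdom] with x hx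
        rw [hess_apply (hx.smooth θ hθ), hess_apply (hx.smooth θ' hθ'), ← PiLp.sub_apply,
          ← sub_apply, ← Real.norm_eq_abs]
        refine (PiLp.norm_apply_le _ j).trans ?_
        refine ((hessL f x θ - hessL f x θ').le_opNorm _).trans ?_
        rw [PiLp.norm_single, norm_one, mul_one]
        exact hx.lipschitz θ hθ θ' hθ'
    _ = d ^ 2 * (∫ x, B x ∂P) * ‖θ - θ'‖ := by simp; ring

theorem continuousOn_popHess {f : ℝ → Param d → ℝ} {Θ : Set (Param d)} {P : Measure Obs}
    [IsProbabilityMeasure P] (hhess : HessianCondition f Θ P)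
    {B : Obs → ℝ} (hB : MemLp B 2 P) (hB0 : ∀ x, 0 ≤ B x)
    (hdom : ∀ᵐ x ∂P, Dominated f Θ (B x) x) : ContinuousOn (popHess f P) Θ := by
  have hb : 0 ≤ (d : ℝ) ^ 2 * ∫ x, B x ∂P := mul_nonneg (by positivity) (integral_nonneg hB0)
  refine (LipschitzOnWith.of_dist_le_mul (K := ⟨_, hb⟩) fun θ hθ θ' hθ' => ?_).continuousOn
  rw [dist_eq_norm, dist_eq_norm]
  exact norm_popHess_sub_le hhess hB hdom hθ hθ'

theorem inner_toEuclideanCLM (A : Matrix (Fin d) (Fin d) ℝ) (v w : Param d) :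
    inner ℝ (Matrix.toEuclideanCLM (𝕜 := ℝ) A v) w = w.ofLp ⬝ᵥ A.mulVec v.ofLp := by
  rw [EuclideanSpace.inner_eq_star_dotProduct]
  simp [Matrix.ofLp_toEuclideanCLM]

theorem inner_popHess_neg {f : ℝ → Param d → ℝ} {Θ : Set (Param d)} {P : Measure Obs}
    (hhess : HessianCondition f Θ P) {θ v : Param d} (hθ : θ ∈ Θ) (hv : v ≠ 0) :
    inner ℝ (popHess f P θ v) v < 0 := by
  have h := (hhess.posDef θ hθ).dotProduct_mulVec_pos (x := v.ofLp) (by simpa using hv)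
  rw [popHess, inner_toEuclideanCLM]
  simp only [Matrix.neg_mulVec, dotProduct_neg, star_trivial] at h
  linarith

/-- A continuous family of negative definite maps on a compact set is uniformly negative definite. -/
theorem exists_inner_le_of_neg (hd : 0 < d) {Θ : Set (Param d)} (hcomp : IsCompact Θ)
    (hne : Θ.Nonempty) {A : Param d → Param d →L[ℝ] Param d} (hA : ContinuousOn A Θ)
    (hneg : ∀ θ ∈ Θ, ∀ v, v ≠ 0 → inner ℝ (A θ v) v < 0) :
    ∃ c : ℝ, 0 < c ∧ ∀ θ ∈ Θ, ∀ v, inner ℝ (A θ v) v ≤ -c * ‖v‖ ^ 2 := by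
  have hK : IsCompact (Θ ×ˢ Metric.sphere (0 : Param d) 1) := hcomp.prod (isCompact_sphere 0 1)
  have : Nonempty (Fin d) := ⟨⟨0, hd⟩⟩
  have hKne : (Θ ×ˢ Metric.sphere (0 : Param d) 1).Nonempty :=
    hne.prod (NormedSpace.sphere_nonempty.2 zero_le_one)
  have hF : ContinuousOn (fun z : Param d × Param d => (inner ℝ (A z.1 z.2) z.2 : ℝ))
      (Θ ×ˢ Metric.sphere (0 : Param d) 1) := by
    have h1 : ContinuousOn (fun z : Param d × Param d => A z.1)
        (Θ ×ˢ Metric.sphere (0 : Param d) 1) :=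
      hA.comp continuousOn_fst fun z hz => hz.1
    exact (h1.clm_apply continuousOn_snd).inner continuousOn_snd
  -- The quadratic form attains its maximum over `Θ` times the unit sphere, so the maximum is
  -- negative; homogeneity extends the bound to all vectors.
  obtain ⟨z, hz, hmax⟩ := hK.exists_isMaxOn hKne hF
  have hz2 : z.2 ≠ 0 := by
    intro h0
    have := hz.2
    simp [h0] at this
  refine ⟨-inner ℝ (A z.1 z.2) z.2, neg_pos.2 (hneg z.1 hz.1 z.2 hz2), fun θ hθ v => ?_⟩
  rw [neg_neg]
  by_cases hv : v = 0
  · simp [hv]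
  have hnv : ‖v‖ ≠ 0 := norm_ne_zero_iff.2 hv
  have h1 : (θ, ‖v‖⁻¹ • v) ∈ Θ ×ˢ Metric.sphere (0 : Param d) 1 := by
    refine ⟨hθ, ?_⟩
    simp [norm_smul, hnv]
  have h2 : inner ℝ (A θ (‖v‖⁻¹ • v)) (‖v‖⁻¹ • v) ≤ inner ℝ (A z.1 z.2) z.2 := hmax h1
  rw [map_smul, real_inner_smul_left, real_inner_smul_right] at h2
  have h3 := mul_le_mul_of_nonneg_right h2 (sq_nonneg ‖v‖)
  refine le_trans (le_of_eq ?_) h3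
  field_simp

theorem exists_popHess_le {f : ℝ → Param d → ℝ} {Θ : Set (Param d)} {P : Measure Obs}
    [IsProbabilityMeasure P] (hd : 0 < d) (hcomp : IsCompact Θ) (hne : Θ.Nonempty)
    (hhess : HessianCondition f Θ P)
    {B : Obs → ℝ} (hB : MemLp B 2 P) (hB0 : ∀ x, 0 ≤ B x)
    (hdom : ∀ᵐ x ∂P, Dominated f Θ (B x) x) :
    ∃ c : ℝ, 0 < c ∧ ∀ θ ∈ Θ, ∀ v, inner ℝ (popHess f P θ v) v ≤ -c * ‖v‖ ^ 2 :=
  exists_inner_le_of_neg hd hcomp hne (continuousOn_popHess hhess hB hB0 hdom)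
    fun _ hθ _ hv => inner_popHess_neg hhess hθ hv

/-- The expected score vanishes at an interior maximizer of the expected log-likelihood. -/
theorem integral_score_eq_zero {f : ℝ → Param d → ℝ} {Θ : Set (Param d)} {P : Measure Obs}
    [IsProbabilityMeasure P] (hΘ : Convex ℝ Θ) (hl : ∀ θ ∈ Θ, MemLp (fun x => logLik f x θ) 2 P)
    (hscore : ∀ θ ∈ Θ, ∀ j, MemLp (fun x => score f x θ j) 2 P)
    {B : Obs → ℝ} (hB : MemLp B 2 P) (hdom : ∀ᵐ x ∂P, Dominated f Θ (B x) x)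
    {θ₀ : Param d} (h₀ : θ₀ ∈ interior Θ)
    (hmax : IsMaxOn (fun θ => ∫ x, logLik f x θ ∂P) Θ θ₀) (j : Fin d) :
    ∫ x, score f x θ₀ j ∂P = 0 := by
  obtain ⟨ρ, hρ, hball⟩ := Metric.isOpen_iff.1 isOpen_interior θ₀ h₀
  have hball' : Metric.ball θ₀ ρ ⊆ Θ := hball.trans interior_subset
  set e : Param d := EuclideanSpace.single j 1 with he
  have hen : ‖e‖ = 1 := by simp [he]
  have hmem : ∀ t ∈ Metric.ball (0 : ℝ) ρ, θ₀ + t • e ∈ Θ := by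
    intro t ht
    refine hball' ?_
    rw [Metric.mem_ball, dist_eq_norm, add_sub_cancel_left, norm_smul, hen, mul_one]
    simpa using ht
  have h00 : θ₀ ∈ Θ := interior_subset h₀
  have hin : ∀ v : Param d, inner ℝ v e = v j := by
    intro v; simp [he, EuclideanSpace.inner_single_right]
  -- Differentiation under the integral along the j-th coordinate line. Within distance ρ of `θ₀`
  -- the score moves by at most `B x * ρ`, which supplies the integrable bound.
  have hder := hasDerivAt_integral_of_dominated_loc_of_deriv_le (μ := P) (𝕜 := ℝ)
    (F := fun t x => logLik f x (θ₀ + t • e)) (F' := fun t x => score f x (θ₀ + t • e) j)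
    (x₀ := 0) (s := Metric.ball 0 ρ) (bound := fun x => |score f x θ₀ j| + B x * ρ)
    (Metric.ball_mem_nhds 0 hρ)
    (by
      filter_upwards [Metric.ball_mem_nhds 0 hρ] with t ht
      exact (hl _ (hmem t ht)).aestronglyMeasurable)
    (by simpa using (hl θ₀ h00).integrable (by norm_num))
    (by simpa using (hscore θ₀ h00 j).aestronglyMeasurable)
    (by
      filter_upwards [hdom] with x hx t ht
      have h1 := hx.norm_score_sub_le hΘ (hmem t ht) h00
      rw [add_sub_cancel_left, norm_smul, hen, mul_one] at h1
      have h2 : |score f x (θ₀ + t • e) j - score f x θ₀ j| ≤ B x * ‖t‖ := by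
        rw [← PiLp.sub_apply, ← Real.norm_eq_abs]
        exact (PiLp.norm_apply_le _ j).trans h1
      have h3 : B x * ‖t‖ ≤ B x * ρ := by
        refine mul_le_mul_of_nonneg_left ?_ hx.nonneg
        simpa using (Metric.mem_ball.1 ht).le
      rw [Real.norm_eq_abs]
      have := abs_sub_abs_le_abs_sub (score f x (θ₀ + t • e) j) (score f x θ₀ j)
      linarith)
    (((hscore θ₀ h00 j).integrable (by norm_num)).abs.add
      ((hB.integrable (by norm_num)).mul_const ρ))
    (by
      filter_upwards [hdom] with x hx t ht
      have h1 : HasDerivAt (fun t : ℝ => θ₀ + t • e) e t := by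
        simpa using ((hasDerivAt_id t).smul_const e).const_add θ₀
      have h2 := (hasGradientAt_logLik
        (hx.smooth _ (hmem t ht))).hasFDerivAt.comp_hasDerivAt t h1
      rw [← hin]
      exact h2)
  have hloc : IsLocalMax (fun t : ℝ => ∫ x, logLik f x (θ₀ + t • e) ∂P) 0 := by
    filter_upwards [Metric.ball_mem_nhds 0 hρ] with t ht
    simpa using hmax (hmem t ht)
  simpa using hloc.hasDerivAt_eq_zero hder.2

end RDCS

/-! ### Moments of the weighted draws and their dependence on the sampling probabilities. -/

namespace RDCS

variable {d n : ℕ}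

/-! ### Sampling probabilities -/

theorem mem_censIdx {D : Fin n → Obs} {i : Fin n} : i ∈ censIdx D ↔ censored (D i) = true := by
  simp [censIdx]

theorem sum_uncensIdx_add_sum_censIdx {M : Type*} [AddCommMonoid M] (D : Fin n → Obs)
    (φ : Fin n → M) : ∑ i ∈ uncensIdx D, φ i + ∑ i ∈ censIdx D, φ i = ∑ i, φ i := by
  rw [add_comm]
  have := Finset.sum_filter_add_sum_filter_not Finset.univ (fun i => censored (D i) = true) φ
  simpa [censIdx, uncensIdx] using this

theorem natCast_sub_numUncens (D : Fin n → Obs) : (n : ℝ) - numUncens D = (censIdx D).card := by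
  have := sum_uncensIdx_add_sum_censIdx D (fun _ => (1 : ℕ))
  simp only [Finset.sum_const, smul_eq_mul, mul_one, Finset.card_univ, Fintype.card_fin] at this
  rw [numUncens, sub_eq_iff_eq_add, add_comm]
  exact_mod_cast this.symm

theorem optProb_nonneg (f : ℝ → Param d → ℝ) (D : Fin n → Obs) (θ : Param d) (i : Fin n) :
    0 ≤ optProb f D θ i :=
  div_nonneg (norm_nonneg _) (Finset.sum_nonneg fun _ _ => norm_nonneg _)

theorem mixProb_nonneg (f : ℝ → Param d → ℝ) {ξ : ℝ} (hξ : 0 < ξ ∧ ξ < 1) (D : Fin n → Obs)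
    (θ : Param d) (i : Fin n) : 0 ≤ mixProb f ξ D θ i := by
  rw [mixProb, natCast_sub_numUncens]
  have := mul_nonneg (sub_nonneg.2 hξ.2.le) (optProb_nonneg f D θ i)
  have : 0 ≤ ξ / ((censIdx D).card : ℝ) := div_nonneg hξ.1.le (by positivity)
  linarith

/-- The uniform component alone gives this floor, since at most n data are censored. It is the
purpose of mixing: no draw gets a weight that could spoil the moment bounds. -/
theorem div_le_mixProb (f : ℝ → Param d → ℝ) {ξ : ℝ} (hξ : 0 < ξ ∧ ξ < 1) {D : Fin n → Obs}
    (θ : Param d) {i : Fin n} (hi : i ∈ censIdx D) : ξ / n ≤ mixProb f ξ D θ i := by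
  rw [mixProb, natCast_sub_numUncens]
  have h1 := mul_nonneg (sub_nonneg.2 hξ.2.le) (optProb_nonneg f D θ i)
  have hc : (0 : ℝ) < (censIdx D).card := by
    exact_mod_cast Finset.card_pos.2 ⟨i, hi⟩
  have hcn : ((censIdx D).card : ℝ) ≤ n := by
    have := Finset.card_le_univ (censIdx D)
    rw [Fintype.card_fin] at this
    exact_mod_cast this
  have h2 : ξ / n ≤ ξ / (censIdx D).card := div_le_div_of_nonneg_left hξ.1.le hc hcn
  linarith

theorem mixProb_pos (f : ℝ → Param d → ℝ) {ξ : ℝ} (hξ : 0 < ξ ∧ ξ < 1) {D : Fin n → Obs}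
    (θ : Param d) {i : Fin n} (hi : i ∈ censIdx D) : 0 < mixProb f ξ D θ i := by
  have hn : (0 : ℝ) < n := by exact_mod_cast i.pos
  exact lt_of_lt_of_le (div_pos hξ.1 hn) (div_le_mixProb f hξ θ hi)

theorem inv_mixProb_le (f : ℝ → Param d → ℝ) {ξ : ℝ} (hξ : 0 < ξ ∧ ξ < 1) {D : Fin n → Obs}
    (θ : Param d) {i : Fin n} (hi : i ∈ censIdx D) : (mixProb f ξ D θ i)⁻¹ ≤ n / ξ := by
  have hn : (0 : ℝ) < n := by exact_mod_cast i.pos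
  have := inv_anti₀ (div_pos hξ.1 hn) (div_le_mixProb f hξ θ hi)
  rwa [inv_div] at this

/-- Positivity cannot be dropped: if all censored scores vanish, the quotients 0/0 are read as 0 and
the total mass is ξ, or 0 when nothing is censored. On good samples positivity comes from
`scoreFloor_le`. -/
theorem sum_mixProb (f : ℝ → Param d → ℝ) (ξ : ℝ) {D : Fin n → Obs} {θ : Param d}
    (h : 0 < ∑ j ∈ censIdx D, ‖score f (D j) θ‖) : ∑ i ∈ censIdx D, mixProb f ξ D θ i = 1 := by
  have hne : (censIdx D).Nonempty := by
    by_contra hcon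
    rw [Finset.not_nonempty_iff_eq_empty] at hcon
    simp [hcon] at h
  have hc : ((censIdx D).card : ℝ) ≠ 0 := by
    exact_mod_cast (Finset.card_pos.2 hne).ne'
  simp only [mixProb, natCast_sub_numUncens, optProb]
  rw [Finset.sum_add_distrib, ← Finset.mul_sum, ← Finset.sum_div, div_self h.ne',
    Finset.sum_const, nsmul_eq_mul]
  field_simp
  ring

theorem isProbabilityMeasure_drawLaw (f : ℝ → Param d → ℝ) {ξ : ℝ} (hξ : 0 < ξ ∧ ξ < 1)
    {D : Fin n → Obs} {θ : Param d} (h : 0 < ∑ j ∈ censIdx D, ‖score f (D j) θ‖) :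
    IsProbabilityMeasure (drawLaw f ξ D θ) := by
  constructor
  rw [drawLaw, Measure.finsetSum_apply]
  simp only [Measure.smul_apply, measure_univ, smul_eq_mul, mul_one]
  rw [← ENNReal.ofReal_sum_of_nonneg fun i _ => mixProb_nonneg f hξ D θ i, sum_mixProb f ξ h,
    ENNReal.ofReal_one]

theorem integral_drawLaw (f : ℝ → Param d → ℝ) {ξ : ℝ} (hξ : 0 < ξ ∧ ξ < 1) (D : Fin n → Obs)
    (θ : Param d) (φ : Fin n → ℝ) :
    ∫ i, φ i ∂(drawLaw f ξ D θ) = ∑ i ∈ censIdx D, mixProb f ξ D θ i * φ i := by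
  rw [drawLaw, integral_finsetSum_measure]
  · refine Finset.sum_congr rfl fun i _ => ?_
    rw [integral_smul_measure, integral_dirac,
      ENNReal.toReal_ofReal (mixProb_nonneg f hξ D θ i), smul_eq_mul]
  · intro i _
    exact (Integrable.of_finite).smul_measure ENNReal.ofReal_ne_top

/-- The weight of a draw in the average over the draws, `1 / (n π_{ξ,i})` for a censored datum. -/
noncomputable def drawWeight (f : ℝ → Param d → ℝ) (ξ : ℝ) (r : ℕ) (D : Fin n → Obs)
    (θ : Param d) (i : Fin n) : ℝ :=
  ((r - numUncens D : ℕ) : ℝ) / n * weight f ξ r D θ i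

theorem drawWeight_eq (f : ℝ → Param d → ℝ) (ξ : ℝ) {r : ℕ} {D : Fin n → Obs} (θ : Param d)
    (hr : numUncens D < r) {i : Fin n} (hi : i ∈ censIdx D) :
    drawWeight f ξ r D θ i = (n * mixProb f ξ D θ i)⁻¹ := by
  have h : (r : ℝ) - numUncens D ≠ 0 := by
    have : (numUncens D : ℝ) < r := by exact_mod_cast hr
    linarith
  rw [drawWeight, weight, if_pos (mem_censIdx.1 hi), Nat.cast_sub hr.le, mul_inv, mul_inv]
  field_simp

theorem drawWeight_nonneg (f : ℝ → Param d → ℝ) {ξ : ℝ} (hξ : 0 < ξ ∧ ξ < 1) {r : ℕ}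
    {D : Fin n → Obs} (θ : Param d) (hr : numUncens D < r) (i : Fin n) :
    0 ≤ drawWeight f ξ r D θ i := by
  have h : (0 : ℝ) ≤ (r : ℝ) - numUncens D := by
    have : (numUncens D : ℝ) < r := by exact_mod_cast hr
    linarith
  refine mul_nonneg (by positivity) ?_
  rw [weight]
  split_ifs
  · exact inv_nonneg.2 (mul_nonneg h (mixProb_nonneg f hξ D θ i))
  · exact zero_le_one

/-- A weighted draw is unbiased for the contribution of the censored data. -/
theorem integral_drawWeight (f : ℝ → Param d → ℝ) {ξ : ℝ} (hξ : 0 < ξ ∧ ξ < 1) {r : ℕ}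
    {D : Fin n → Obs} (θ : Param d) (hr : numUncens D < r) (φ : Fin n → ℝ) :
    ∫ i, drawWeight f ξ r D θ i * φ i ∂(drawLaw f ξ D θ) = (n : ℝ)⁻¹ * ∑ i ∈ censIdx D, φ i := by
  rw [integral_drawLaw f hξ, Finset.mul_sum]
  refine Finset.sum_congr rfl fun i hi => ?_
  have := (mixProb_pos f hξ θ hi).ne'
  rw [drawWeight_eq f ξ θ hr hi]
  field_simp

theorem integral_drawWeight_sq (f : ℝ → Param d → ℝ) {ξ : ℝ} (hξ : 0 < ξ ∧ ξ < 1) {r : ℕ}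
    {D : Fin n → Obs} (θ : Param d) (hr : numUncens D < r) (φ : Fin n → ℝ) :
    ∫ i, (drawWeight f ξ r D θ i * φ i) ^ 2 ∂(drawLaw f ξ D θ)
      = ((n : ℝ) ^ 2)⁻¹ * ∑ i ∈ censIdx D, (mixProb f ξ D θ i)⁻¹ * φ i ^ 2 := by
  rw [integral_drawLaw f hξ, Finset.mul_sum]
  refine Finset.sum_congr rfl fun i hi => ?_
  have := (mixProb_pos f hξ θ hi).ne'
  rw [drawWeight_eq f ξ θ hr hi]
  field_simp

theorem sum_censIdx_le {D : Fin n → Obs} {φ : Fin n → ℝ} (h : ∀ i, 0 ≤ φ i) :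
    ∑ i ∈ censIdx D, φ i ≤ ∑ i, φ i :=
  Finset.sum_le_sum_of_subset_of_nonneg (Finset.subset_univ _) fun i _ _ => h i

theorem sum_inv_mixProb_mul_le (f : ℝ → Param d → ℝ) {ξ : ℝ} (hξ : 0 < ξ ∧ ξ < 1)
    (D : Fin n → Obs) (θ : Param d) {φ : Fin n → ℝ} (h : ∀ i, 0 ≤ φ i) :
    ((n : ℝ) ^ 2)⁻¹ * ∑ i ∈ censIdx D, (mixProb f ξ D θ i)⁻¹ * φ i
      ≤ ξ⁻¹ * ((n : ℝ)⁻¹ * ∑ i ∈ censIdx D, φ i) := by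
  rw [Finset.mul_sum, Finset.mul_sum, Finset.mul_sum]
  refine Finset.sum_le_sum fun i hi => ?_
  have hn : (0 : ℝ) < n := by exact_mod_cast i.pos
  have := mul_le_mul_of_nonneg_right (inv_mixProb_le f hξ θ hi) (h i)
  calc ((n : ℝ) ^ 2)⁻¹ * ((mixProb f ξ D θ i)⁻¹ * φ i) ≤ ((n : ℝ) ^ 2)⁻¹ * (n / ξ * φ i) := by
        gcongr
    _ = ξ⁻¹ * ((n : ℝ)⁻¹ * φ i) := by field_simp

/-- The second moment of a weighted draw. -/
theorem integral_drawWeight_sq_le (f : ℝ → Param d → ℝ) {ξ : ℝ} (hξ : 0 < ξ ∧ ξ < 1) {r : ℕ}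
    {D : Fin n → Obs} (θ : Param d) (hr : numUncens D < r) (φ : Fin n → ℝ) :
    ∫ i, (drawWeight f ξ r D θ i * φ i) ^ 2 ∂(drawLaw f ξ D θ)
      ≤ ξ⁻¹ * ((n : ℝ)⁻¹ * ∑ i, φ i ^ 2) := by
  rw [integral_drawWeight_sq f hξ θ hr]
  refine (sum_inv_mixProb_mul_le f hξ D θ fun i => sq_nonneg _).trans ?_
  have := hξ.1
  exact mul_le_mul_of_nonneg_left (mul_le_mul_of_nonneg_left
    (sum_censIdx_le fun i => sq_nonneg _) (by positivity)) (by positivity)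

/-- The third absolute moment of a weighted draw. -/
theorem integral_drawWeight_cube_le (f : ℝ → Param d → ℝ) {ξ : ℝ} (hξ : 0 < ξ ∧ ξ < 1) {r : ℕ}
    {D : Fin n → Obs} (θ : Param d) (hr : numUncens D < r) {φ : Fin n → ℝ} (h : ∀ i, 0 ≤ φ i) :
    ∫ i, (drawWeight f ξ r D θ i * φ i) ^ 3 ∂(drawLaw f ξ D θ)
      ≤ (ξ ^ 2)⁻¹ * ((n : ℝ)⁻¹ * ∑ i, φ i ^ 3) := by
  have hξ0 := hξ.1
  rw [integral_drawLaw f hξ]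
  refine le_trans ?_ (mul_le_mul_of_nonneg_left (mul_le_mul_of_nonneg_left
    (sum_censIdx_le (D := D) fun i => pow_nonneg (h i) 3) (by positivity)) (by positivity))
  rw [Finset.mul_sum, Finset.mul_sum]
  refine Finset.sum_le_sum fun i hi => ?_
  have hn : (0 : ℝ) < n := by exact_mod_cast i.pos
  have hq := mixProb_pos f hξ θ hi
  have hi2 := pow_le_pow_left₀ (inv_nonneg.2 hq.le) (inv_mixProb_le f hξ θ hi) 2
  rw [drawWeight_eq f ξ θ hr hi]
  calc mixProb f ξ D θ i * ((n * mixProb f ξ D θ i)⁻¹ * φ i) ^ 3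
      = ((n : ℝ) ^ 3)⁻¹ * (mixProb f ξ D θ i)⁻¹ ^ 2 * φ i ^ 3 := by field_simp
    _ ≤ ((n : ℝ) ^ 3)⁻¹ * (n / ξ) ^ 2 * φ i ^ 3 := by
        have := pow_nonneg (h i) 3
        gcongr
    _ = (ξ ^ 2)⁻¹ * ((n : ℝ)⁻¹ * φ i ^ 3) := by field_simp

/-! ### The quadratic form of `Λ_RDCS` -/

/-- The right-hand side is a variance: by `integral_drawWeight_sq` and `integral_drawWeight`, the
two terms are the second moment and the squared mean of one weighted draw of the directional score,
sampled with the probabilities at θ. -/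
theorem inner_covLambda (f : ℝ → Param d → ℝ) (ξ : ℝ) (D : Fin n → Obs) (θ u : Param d) :
    inner ℝ (Matrix.toEuclideanCLM (𝕜 := ℝ) (covLambda f ξ D θ) u) u
      = ((n : ℝ) ^ 2)⁻¹ * ∑ i ∈ censIdx D, (mixProb f ξ D θ i)⁻¹ * inner ℝ (score f (D i) θ) u ^ 2
        - ((n : ℝ)⁻¹ * ∑ i ∈ censIdx D, inner ℝ (score f (D i) θ) u) ^ 2 := by
  have hout : ∀ v : Param d, u.ofLp ⬝ᵥ (outer v).mulVec u.ofLp = inner ℝ v u ^ 2 := by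
    intro v
    have : outer v = Matrix.vecMulVec v.ofLp v.ofLp := rfl
    rw [this, Matrix.vecMulVec_mulVec, EuclideanSpace.inner_eq_star_dotProduct]
    simp [dotProduct_smul, sq, dotProduct_comm v.ofLp u.ofLp]
  rw [inner_toEuclideanCLM, covLambda, Matrix.sub_mulVec, dotProduct_sub, hout,
    real_inner_smul_left, sum_inner, Matrix.smul_mulVec, dotProduct_smul, Matrix.sum_mulVec,
    dotProduct_sum, smul_eq_mul]
  simp only [Matrix.smul_mulVec, dotProduct_smul, hout, smul_eq_mul]

theorem le_inner_of_posSemidef {A : Matrix (Fin d) (Fin d) ℝ} {c : ℝ}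
    (h : (A - c • 1).PosSemidef) (u : Param d) :
    c * ‖u‖ ^ 2 ≤ inner ℝ (Matrix.toEuclideanCLM (𝕜 := ℝ) A u) u := by
  have := h.dotProduct_mulVec_nonneg u.ofLp
  rw [inner_toEuclideanCLM]
  have e : ‖u‖ ^ 2 = u.ofLp ⬝ᵥ u.ofLp := by
    rw [← real_inner_self_eq_norm_sq, EuclideanSpace.inner_eq_star_dotProduct]
    simp
  rw [e]
  simp only [Matrix.sub_mulVec, dotProduct_sub, star_trivial, Matrix.smul_mulVec,
    Matrix.one_mulVec, dotProduct_smul, smul_eq_mul] at this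
  linarith

/-- A lower bound for the mean score norm of the censored data, in terms of the smallest eigenvalue
`c` of `Λ_RDCS` and of a bound `K` for the fourth moment of the scores. -/
noncomputable def scoreFloor (K c ξ : ℝ) : ℝ := c * ξ / (2 * (1 + 2 * K / (c * ξ)))

theorem scoreFloor_pos {K c ξ : ℝ} (hK : 0 ≤ K) (hc : 0 < c) (hξ : 0 < ξ) :
    0 < scoreFloor K c ξ := by
  unfold scoreFloor; positivity

/-- In a unit direction the variance is at least c, and inverse probabilities are at most n/ξ, so
the mean squared score norm over the censored data is at least cξ. Interpolating the square between
the first and the fourth power, a² ≤ A a + a⁴/A, and using the fourth-moment bound K with A so large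
that K/A ≤ cξ/2, leaves at least cξ/(2A) for the first moment. -/
theorem scoreFloor_le (hd : 0 < d) {f : ℝ → Param d → ℝ} {ξ : ℝ} (hξ : 0 < ξ ∧ ξ < 1)
    {D : Fin n → Obs} {θ : Param d} {K c : ℝ} (hK : 0 ≤ K) (hc : 0 < c)
    (hcov : (covLambda f ξ D θ - c • 1).PosSemidef)
    (h4 : (n : ℝ)⁻¹ * ∑ i, ‖score f (D i) θ‖ ^ 4 ≤ K) :
    scoreFloor K c ξ ≤ (n : ℝ)⁻¹ * ∑ i ∈ censIdx D, ‖score f (D i) θ‖ := by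
  have hξ0 := hξ.1
  set u : Param d := EuclideanSpace.single ⟨0, hd⟩ 1 with hu
  have hun : ‖u‖ = 1 := by simp [hu]
  have h1 := le_inner_of_posSemidef hcov u
  rw [inner_covLambda, hun] at h1
  have h2 := sum_inv_mixProb_mul_le f hξ D θ
    (φ := fun i => inner ℝ (score f (D i) θ) u ^ 2) fun i => sq_nonneg _
  have h3 : ∑ i ∈ censIdx D, inner ℝ (score f (D i) θ) u ^ 2
      ≤ ∑ i ∈ censIdx D, ‖score f (D i) θ‖ ^ 2 := by
    refine Finset.sum_le_sum fun i _ => ?_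
    have := abs_real_inner_le_norm (score f (D i) θ) u
    rw [hun, mul_one] at this
    exact sq_le_sq' (by linarith [neg_le_of_abs_le this]) (le_of_abs_le this)
  -- The term 2K/(cξ) gives K/A ≤ cξ/2. The added 1 ensures A ≥ 1, needed where a > A: there a² A ≤
  -- a³ ≤ a⁴.
  set A : ℝ := 1 + 2 * K / (c * ξ) with hA
  have hA1 : 1 ≤ A := by
    have : 0 ≤ 2 * K / (c * ξ) := by positivity
    linarith
  have h5 : (n : ℝ)⁻¹ * ∑ i ∈ censIdx D, ‖score f (D i) θ‖ ^ 2
      ≤ A * ((n : ℝ)⁻¹ * ∑ i ∈ censIdx D, ‖score f (D i) θ‖) + K / A := by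
    calc (n : ℝ)⁻¹ * ∑ i ∈ censIdx D, ‖score f (D i) θ‖ ^ 2
        ≤ (n : ℝ)⁻¹ * ∑ i ∈ censIdx D, (A * ‖score f (D i) θ‖ + ‖score f (D i) θ‖ ^ 4 / A) := by
          gcongr with i _
          set a := ‖score f (D i) θ‖
          have ha : 0 ≤ a := norm_nonneg _
          by_cases hle : a ≤ A
          · have : 0 ≤ a ^ 4 / A := by positivity
            nlinarith
          · push Not at hle
            have h6 : a ^ 2 ≤ a ^ 4 / A := by
              rw [le_div_iff₀ (by linarith)]
              nlinarith [sq_nonneg a, mul_nonneg (sq_nonneg a) ha]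
            have : 0 ≤ A * a := by positivity
            linarith
      _ = A * ((n : ℝ)⁻¹ * ∑ i ∈ censIdx D, ‖score f (D i) θ‖)
          + ((n : ℝ)⁻¹ * ∑ i ∈ censIdx D, ‖score f (D i) θ‖ ^ 4) / A := by
          rw [Finset.sum_add_distrib, ← Finset.mul_sum, ← Finset.sum_div]
          ring
      _ ≤ A * ((n : ℝ)⁻¹ * ∑ i ∈ censIdx D, ‖score f (D i) θ‖) + K / A := by
          gcongr
          exact le_trans (mul_le_mul_of_nonneg_left (sum_censIdx_le fun i => by positivity)
            (by positivity)) h4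
  have h6 : K / A ≤ c * ξ / 2 := by
    rw [div_le_iff₀ (by linarith), hA]
    have : c * ξ / 2 * (1 + 2 * K / (c * ξ)) = c * ξ / 2 + K := by field_simp
    rw [this]
    have : 0 < c * ξ := by positivity
    linarith
  have h7 : c ≤ ξ⁻¹ * ((n : ℝ)⁻¹ * ∑ i ∈ censIdx D, ‖score f (D i) θ‖ ^ 2) := by
    have h8 : ξ⁻¹ * ((n : ℝ)⁻¹ * ∑ i ∈ censIdx D, inner ℝ (score f (D i) θ) u ^ 2)
        ≤ ξ⁻¹ * ((n : ℝ)⁻¹ * ∑ i ∈ censIdx D, ‖score f (D i) θ‖ ^ 2) := by gcongr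
    nlinarith [sq_nonneg ((n : ℝ)⁻¹ * ∑ i ∈ censIdx D, inner ℝ (score f (D i) θ) u)]
  rw [inv_mul_eq_div, le_div_iff₀ hξ0] at h7
  rw [scoreFloor, ← hA, div_le_iff₀ (by linarith)]
  linarith

/-! ### Comparison of the covariances at the pilot and at the full-data estimate -/

theorem mean_norm_score_sub_le {f : ℝ → Param d → ℝ} {Θ : Set (Param d)} (hΘ : Convex ℝ Θ)
    {D : Fin n → Obs} {B : Obs → ℝ} (hdom : ∀ i, Dominated f Θ (B (D i)) (D i)) {θ θ' : Param d}
    (hθ : θ ∈ Θ) (hθ' : θ' ∈ Θ) :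
    |∑ i ∈ censIdx D, ‖score f (D i) θ‖ - ∑ i ∈ censIdx D, ‖score f (D i) θ'‖|
      ≤ (∑ i, B (D i)) * ‖θ - θ'‖ := by
  rw [← Finset.sum_sub_distrib]
  refine (Finset.abs_sum_le_sum_abs _ _).trans ?_
  refine le_trans ?_ (mul_le_mul_of_nonneg_right
    (sum_censIdx_le (D := D) fun i => (hdom i).nonneg) (norm_nonneg _))
  rw [Finset.sum_mul]
  exact Finset.sum_le_sum fun i _ => (abs_norm_sub_norm_le _ _).trans
    ((hdom i).norm_score_sub_le hΘ hθ hθ')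

/-- Pointwise, a^p ≤ 1 + a^q for p ≤ q, by the cases a ≤ 1 and a > 1. Lower moments thus cost only
an additive 1, and n = 0 needs no exception. -/
theorem mean_le_one_add {a : Fin n → ℝ} {K : ℝ} {p q : ℕ} (hpq : p ≤ q) (ha : ∀ i, 0 ≤ a i)
    (h : (n : ℝ)⁻¹ * ∑ i, a i ^ q ≤ K) : (n : ℝ)⁻¹ * ∑ i, a i ^ p ≤ 1 + K := by
  have hle : ∀ i, a i ^ p ≤ 1 + a i ^ q := by
    intro i
    by_cases h1 : a i ≤ 1
    · have := pow_le_one₀ (ha i) h1 (n := p)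
      have := pow_nonneg (ha i) q
      linarith
    · have := pow_le_pow_right₀ (not_le.1 h1).le hpq
      linarith
  calc (n : ℝ)⁻¹ * ∑ i, a i ^ p ≤ (n : ℝ)⁻¹ * ∑ i, (1 + a i ^ q) := by
        gcongr with i _; exact hle i
    _ = (n : ℝ)⁻¹ * n + (n : ℝ)⁻¹ * ∑ i, a i ^ q := by
        rw [Finset.sum_add_distrib, mul_add]; simp
    _ ≤ 1 + K := add_le_add inv_mul_le_one h

theorem abs_div_sub_div_le {a a' A A' k x y : ℝ} (hk : 0 < k) (hx : |a - a'| ≤ x)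
    (hy : |A - A'| ≤ y) (hA : k ≤ A) (hA' : k ≤ A') (ha' : 0 ≤ a') :
    |a / A - a' / A'| ≤ x / k + a' * y / k ^ 2 := by
  have hA0 : 0 < A := hk.trans_le hA
  have hA0' : 0 < A' := hk.trans_le hA'
  have e : a / A - a' / A' = (a - a') / A + a' * (A' - A) / (A * A') := by
    field_simp
    ring
  have f1 : |(a - a') / A| ≤ x / k := by
    rw [abs_div, abs_of_pos hA0]
    exact div_le_div₀ ((abs_nonneg _).trans hx) hx hk hA
  have f2 : |a' * (A' - A) / (A * A')| ≤ a' * y / k ^ 2 := by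
    rw [abs_div, abs_mul, abs_of_nonneg ha', abs_of_pos (mul_pos hA0 hA0'), abs_sub_comm, sq]
    exact div_le_div₀ (mul_nonneg ha' ((abs_nonneg _).trans hy))
      (mul_le_mul_of_nonneg_left hy ha') (mul_pos hk hk) (mul_le_mul hA hA' hk.le hA0.le)
  rw [e]
  exact (abs_add_le _ _).trans (add_le_add f1 f2)

/-- The uniform components cancel in the difference of the probabilities. What remains is a
difference of quotients whose denominators are at least κn, hence of order ‖p - θ‖/n; inverting
costs the factor (n/ξ)², so one factor n survives. -/
theorem abs_inv_sub_inv_mixProb_le {f : ℝ → Param d → ℝ} {Θ : Set (Param d)} (hΘ : Convex ℝ Θ)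
    {ξ : ℝ} (hξ : 0 < ξ ∧ ξ < 1) {D : Fin n → Obs} {B : Obs → ℝ}
    (hdom : ∀ i, Dominated f Θ (B (D i)) (D i)) {θ p : Param d} (hθ : θ ∈ Θ) (hp : p ∈ Θ)
    {κ b : ℝ} (hκ : 0 < κ)
    (hb : (n : ℝ)⁻¹ * ∑ i, B (D i) ≤ b)
    (h1 : κ ≤ (n : ℝ)⁻¹ * ∑ i ∈ censIdx D, ‖score f (D i) θ‖)
    (h2 : κ ≤ (n : ℝ)⁻¹ * ∑ i ∈ censIdx D, ‖score f (D i) p‖) {i : Fin n} (hi : i ∈ censIdx D) :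
    |(mixProb f ξ D p i)⁻¹ - (mixProb f ξ D θ i)⁻¹|
      ≤ n * ((ξ ^ 2)⁻¹ * (B (D i) / κ + b * ‖score f (D i) θ‖ / κ ^ 2) * ‖p - θ‖) := by
  have hn : (0 : ℝ) < n := by exact_mod_cast i.pos
  have hξ0 := hξ.1
  rw [inv_mul_eq_div, le_div_iff₀ hn] at h1 h2
  rw [inv_mul_eq_div, div_le_iff₀ hn] at hb
  have hopt : |optProb f D p i - optProb f D θ i|
      ≤ (B (D i) / κ + b * ‖score f (D i) θ‖ / κ ^ 2) * ‖p - θ‖ / n := by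
    have h := abs_div_sub_div_le (mul_pos hκ hn)
      ((abs_norm_sub_norm_le _ _).trans ((hdom i).norm_score_sub_le hΘ hp hθ))
      ((mean_norm_score_sub_le hΘ hdom hp hθ).trans
        (mul_le_mul_of_nonneg_right hb (norm_nonneg _))) h2 h1 (norm_nonneg (score f (D i) θ))
    refine h.trans (le_of_eq ?_)
    field_simp
  have hq := mixProb_pos f hξ p hi
  have hq' := mixProb_pos f hξ θ hi
  have emix : mixProb f ξ D θ i - mixProb f ξ D p i
      = (1 - ξ) * (optProb f D θ i - optProb f D p i) := by
    simp only [mixProb]; ring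
  have hmix : |mixProb f ξ D θ i - mixProb f ξ D p i|
      ≤ (B (D i) / κ + b * ‖score f (D i) θ‖ / κ ^ 2) * ‖p - θ‖ / n := by
    rw [emix, abs_mul, abs_of_nonneg (by linarith [hξ.2]), abs_sub_comm]
    refine le_trans ?_ hopt
    exact mul_le_of_le_one_left (abs_nonneg _) (by linarith)
  rw [inv_sub_inv hq.ne' hq'.ne', div_eq_mul_inv, abs_mul, mul_inv, abs_of_pos
    (mul_pos (inv_pos.2 hq) (inv_pos.2 hq'))]
  calc |mixProb f ξ D θ i - mixProb f ξ D p i| * ((mixProb f ξ D p i)⁻¹ * (mixProb f ξ D θ i)⁻¹)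
      ≤ ((B (D i) / κ + b * ‖score f (D i) θ‖ / κ ^ 2) * ‖p - θ‖ / n) * (n / ξ * (n / ξ)) := by
        have := inv_mixProb_le f hξ p hi
        have := inv_mixProb_le f hξ θ hi
        have := inv_pos.2 hq
        have := inv_pos.2 hq'
        have : 0 ≤ (B (D i) / κ + b * ‖score f (D i) θ‖ / κ ^ 2) * ‖p - θ‖ / n := (abs_nonneg _).trans hmix
        gcongr
    _ = _ := by field_simp

/-- The conditional second moments of the weighted scores with the sampling probabilities at the
pilot estimate and at the full-data estimate are close. -/
theorem abs_secondMoment_sub_le {f : ℝ → Param d → ℝ} {Θ : Set (Param d)} (hΘ : Convex ℝ Θ)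
    {ξ : ℝ} (hξ : 0 < ξ ∧ ξ < 1) {D : Fin n → Obs} {B : Obs → ℝ}
    (hdom : ∀ i, Dominated f Θ (B (D i)) (D i)) {θ p : Param d} (hθ : θ ∈ Θ) (hp : p ∈ Θ)
    {κ K : ℝ} (hκ : 0 < κ) (hB : (n : ℝ)⁻¹ * ∑ i, B (D i) ^ 2 ≤ K)
    (h4 : (n : ℝ)⁻¹ * ∑ i, ‖score f (D i) θ‖ ^ 4 ≤ K)
    (h1 : κ ≤ (n : ℝ)⁻¹ * ∑ i ∈ censIdx D, ‖score f (D i) θ‖)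
    (h2 : κ ≤ (n : ℝ)⁻¹ * ∑ i ∈ censIdx D, ‖score f (D i) p‖) (u : Param d) :
    |((n : ℝ) ^ 2)⁻¹ * ∑ i ∈ censIdx D, (mixProb f ξ D p i)⁻¹ * inner ℝ (score f (D i) θ) u ^ 2
      - ((n : ℝ) ^ 2)⁻¹ * ∑ i ∈ censIdx D,
        (mixProb f ξ D θ i)⁻¹ * inner ℝ (score f (D i) θ) u ^ 2|
      ≤ (ξ ^ 2)⁻¹ * (2 * K / κ + (1 + K) ^ 2 / κ ^ 2) * ‖p - θ‖ * ‖u‖ ^ 2 := by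
  have hξ0 := hξ.1
  have hb : (n : ℝ)⁻¹ * ∑ i, B (D i) ≤ 1 + K := by
    simpa using mean_le_one_add (p := 1) (by norm_num) (fun i => (hdom i).nonneg) hB
  have h3 := mean_le_one_add (p := 3) (by norm_num) (fun i => norm_nonneg (score f (D i) θ)) h4
  have hK0 : 0 ≤ K := le_trans (by positivity) h4
  rw [← mul_sub, ← Finset.sum_sub_distrib, abs_mul, abs_of_nonneg (by positivity)]
  have hterm : ∀ i ∈ censIdx D, |(mixProb f ξ D p i)⁻¹ * inner ℝ (score f (D i) θ) u ^ 2
      - (mixProb f ξ D θ i)⁻¹ * inner ℝ (score f (D i) θ) u ^ 2|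
      ≤ n * ((ξ ^ 2)⁻¹ * ((B (D i) ^ 2 + ‖score f (D i) θ‖ ^ 4) / κ
        + (1 + K) * ‖score f (D i) θ‖ ^ 3 / κ ^ 2) * ‖p - θ‖ * ‖u‖ ^ 2) := by
    intro i hi
    have hB0 := (hdom i).nonneg
    rw [← sub_mul, abs_mul, abs_of_nonneg (sq_nonneg (inner ℝ (score f (D i) θ) u))]
    have ha := abs_inv_sub_inv_mixProb_le hΘ hξ hdom hθ hp hκ hb h1 h2 hi
    have hin : inner ℝ (score f (D i) θ) u ^ 2 ≤ ‖score f (D i) θ‖ ^ 2 * ‖u‖ ^ 2 := by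
      rw [← sq_abs, ← mul_pow]
      exact pow_le_pow_left₀ (abs_nonneg _) (abs_real_inner_le_norm _ _) 2
    set s := ‖score f (D i) θ‖
    have hs : 0 ≤ s := norm_nonneg _
    -- This separation is why a second moment of the envelope and a fourth moment of the scores
    -- suffice.
    have hamgm : B (D i) * s ^ 2 ≤ B (D i) ^ 2 + s ^ 4 := by
      nlinarith [sq_nonneg (B (D i) - s ^ 2), sq_nonneg (B (D i)), sq_nonneg (s ^ 2)]
    refine (mul_le_mul ha hin (sq_nonneg _) ((abs_nonneg _).trans ha)).trans ?_
    calc n * ((ξ ^ 2)⁻¹ * (B (D i) / κ + (1 + K) * s / κ ^ 2) * ‖p - θ‖) * (s ^ 2 * ‖u‖ ^ 2)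
        = n * ((ξ ^ 2)⁻¹ * ((B (D i) * s ^ 2) / κ + (1 + K) * s ^ 3 / κ ^ 2)
          * ‖p - θ‖ * ‖u‖ ^ 2) := by ring
      _ ≤ _ := by gcongr
  calc ((n : ℝ) ^ 2)⁻¹ * |∑ i ∈ censIdx D, ((mixProb f ξ D p i)⁻¹ * inner ℝ (score f (D i) θ) u ^ 2
      - (mixProb f ξ D θ i)⁻¹ * inner ℝ (score f (D i) θ) u ^ 2)|
      ≤ ((n : ℝ) ^ 2)⁻¹ * ∑ i ∈ censIdx D,
        n * ((ξ ^ 2)⁻¹ * ((B (D i) ^ 2 + ‖score f (D i) θ‖ ^ 4) / κ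
        + (1 + K) * ‖score f (D i) θ‖ ^ 3 / κ ^ 2) * ‖p - θ‖ * ‖u‖ ^ 2) := by
        gcongr
        exact (Finset.abs_sum_le_sum_abs _ _).trans (Finset.sum_le_sum hterm)
    _ ≤ ((n : ℝ) ^ 2)⁻¹ * ∑ i,
        n * ((ξ ^ 2)⁻¹ * ((B (D i) ^ 2 + ‖score f (D i) θ‖ ^ 4) / κ
        + (1 + K) * ‖score f (D i) θ‖ ^ 3 / κ ^ 2) * ‖p - θ‖ * ‖u‖ ^ 2) := by
        refine mul_le_mul_of_nonneg_left (sum_censIdx_le fun i => ?_) (by positivity)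
        have := (hdom i).nonneg
        positivity
    _ = (ξ ^ 2)⁻¹ * (((n : ℝ)⁻¹ * ∑ i, B (D i) ^ 2 + (n : ℝ)⁻¹ * ∑ i, ‖score f (D i) θ‖ ^ 4) / κ
        + (1 + K) * ((n : ℝ)⁻¹ * ∑ i, ‖score f (D i) θ‖ ^ 3) / κ ^ 2) * ‖p - θ‖ * ‖u‖ ^ 2 := by
        rcases Nat.eq_zero_or_pos n with h | h
        · subst h; simp
        have hn : (n : ℝ) ≠ 0 := by positivity
        simp only [← Finset.mul_sum, ← Finset.sum_mul, Finset.sum_add_distrib, ← Finset.sum_div]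
        field_simp
    _ ≤ (ξ ^ 2)⁻¹ * ((K + K) / κ + (1 + K) * (1 + K) / κ ^ 2) * ‖p - θ‖ * ‖u‖ ^ 2 := by gcongr
    _ = _ := by ring

end RDCS

/-! ### From the standardized error to a linearized estimating equation. -/

namespace RDCS

variable {d n : ℕ}

/-! ### Whitening -/

theorem isHermitian_invSqrt (V : Matrix (Fin d) (Fin d) ℝ) : (invSqrt V).transpose = invSqrt V := by
  have h : IsSelfAdjoint (invSqrt V) := cfc_predicate _ V
  simpa [IsSelfAdjoint, Matrix.star_eq_conjTranspose] using h

/-- In the functional calculus this is the identity s^{-1/2} · s · s^{-1/2} = 1 on the spectrum.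
Positive definiteness keeps 0 off the spectrum, where the identity and the continuity of s^{-1/2}
would fail. -/
theorem invSqrt_mul_mul_invSqrt {V : Matrix (Fin d) (Fin d) ℝ} (hV : V.PosDef) :
    invSqrt V * V * invSqrt V = 1 := by
  have hsa : IsSelfAdjoint V := hV.1
  have hpos : ∀ s ∈ spectrum ℝ V, 0 < s := by
    intro s hs
    obtain ⟨i, rfl⟩ := hV.1.spectrum_real_eq_range_eigenvalues ▸ hs
    exact hV.eigenvalues_pos i
  have hc : ContinuousOn (fun s : ℝ => (√s)⁻¹) (spectrum ℝ V) :=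
    Real.continuous_sqrt.continuousOn.inv₀ fun s hs => (Real.sqrt_pos.2 (hpos s hs)).ne'
  have h1 : invSqrt V * V = cfc (fun s : ℝ => (√s)⁻¹ * s) V := by
    rw [cfc_mul (fun s : ℝ => (√s)⁻¹) (fun s => s) V hc continuousOn_id, cfc_id' ℝ V]
    rfl
  have h2 : invSqrt V * V * invSqrt V = cfc (fun s : ℝ => (√s)⁻¹ * s * (√s)⁻¹) V := by
    rw [cfc_mul (fun s : ℝ => (√s)⁻¹ * s) (fun s => (√s)⁻¹) V (hc.mul continuousOn_id) hc, ← h1]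
    rfl
  rw [h2, cfc_congr (g := fun _ => (1 : ℝ)), cfc_const_one ℝ V]
  intro s hs
  have h0 := hpos s hs
  have h3 := Real.mul_self_sqrt h0.le
  have h4 := (Real.sqrt_pos.2 h0).ne'
  simp only
  field_simp
  rw [sq]
  exact h3.symm

/-- Standardization by `V^{-1/2}`, `V = M⁻¹ Λ M⁻¹`, factors through `M` and a map `W` that takes the
covariance `Λ` to the identity; `W'` is the transpose of `W`. -/
theorem exists_whitening {M Λ : Matrix (Fin d) (Fin d) ℝ} {c c' : ℝ} (hc : 0 < c) (hc' : 0 < c')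
    (hMs : M.transpose = M)
    (hM : ∀ v, inner ℝ (Matrix.toEuclideanCLM (𝕜 := ℝ) M v) v ≤ -c' * ‖v‖ ^ 2)
    (hΛ : (Λ - c • 1).PosSemidef) :
    ∃ W W' : Param d →L[ℝ] Param d, (∀ v t, inner ℝ (W v) t = inner ℝ v (W' t))
      ∧ (∀ t, inner ℝ (Matrix.toEuclideanCLM (𝕜 := ℝ) Λ (W' t)) (W' t) = ‖t‖ ^ 2)
      ∧ (∀ t, ‖W' t‖ ≤ ‖t‖ / √c) ∧ (∀ v, ‖W v‖ ≤ ‖v‖ / √c)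
      ∧ ∀ (r : ℕ) (θ θ' : Param d), stdError r (M⁻¹ * Λ * M⁻¹) θ θ'
        = √(r : ℝ) • W (Matrix.toEuclideanCLM (𝕜 := ℝ) M (θ - θ')) := by
  have hMneg : (-M).PosDef := by
    refine Matrix.PosDef.of_dotProduct_mulVec_pos ?_ fun x hx => ?_
    · rw [Matrix.IsHermitian, Matrix.conjTranspose_eq_transpose_of_trivial, Matrix.transpose_neg,
        hMs]
    · have h := hM (WithLp.toLp 2 x)
      rw [inner_toEuclideanCLM] at h
      have hx' : 0 < ‖(WithLp.toLp 2 x : Param d)‖ := norm_pos_iff.2 (by simpa using hx)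
      simp only [Matrix.neg_mulVec, dotProduct_neg, star_trivial]
      nlinarith [mul_pos hc' (pow_pos hx' 2)]
  have hMu : IsUnit M := by simpa using hMneg.isUnit.neg
  have hdet : IsUnit M.det := (Matrix.isUnit_iff_isUnit_det M).1 hMu
  have hinvs : M⁻¹.transpose = M⁻¹ := by rw [Matrix.transpose_nonsing_inv, hMs]
  have hΛpos : Λ.PosDef := by
    have h1 : (c • (1 : Matrix (Fin d) (Fin d) ℝ)).PosDef := Matrix.PosDef.one.smul hc
    have := h1.add_posSemidef hΛ
    rwa [add_sub_cancel] at this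
  have hV : (M⁻¹ * Λ * M⁻¹).PosDef := by
    have h := hΛpos.mul_mul_conjTranspose_same (B := M⁻¹)
      (Matrix.vecMul_injective_of_isUnit (by
        rw [Matrix.isUnit_iff_isUnit_det]; exact Matrix.isUnit_nonsing_inv_det M hdet))
    rwa [Matrix.conjTranspose_eq_transpose_of_trivial, hinvs] at h
  set R := invSqrt (M⁻¹ * Λ * M⁻¹) with hR
  have hRs : R.transpose = R := isHermitian_invSqrt _
  -- The whitening map is W = V^{-1/2} M⁻¹. As M⁻¹ and V^{-1/2} are symmetric, W Λ Wᵀ = V^{-1/2} V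
  -- V^{-1/2}.
  have hWΛ : (R * M⁻¹) * Λ * (R * M⁻¹).transpose = 1 := by
    rw [Matrix.transpose_mul, hinvs, hRs, ← invSqrt_mul_mul_invSqrt hV]
    simp only [hR, Matrix.mul_assoc]
  have hadj : ∀ v t : Param d, inner ℝ (Matrix.toEuclideanCLM (𝕜 := ℝ) (R * M⁻¹) v) t
      = inner ℝ v (Matrix.toEuclideanCLM (𝕜 := ℝ) (R * M⁻¹).transpose t) := by
    intro v t
    rw [inner_toEuclideanCLM, real_inner_comm, inner_toEuclideanCLM, Matrix.dotProduct_mulVec,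
      ← Matrix.mulVec_transpose, dotProduct_comm]
  have hquad : ∀ t : Param d, inner ℝ (Matrix.toEuclideanCLM (𝕜 := ℝ) Λ
      (Matrix.toEuclideanCLM (𝕜 := ℝ) (R * M⁻¹).transpose t))
      (Matrix.toEuclideanCLM (𝕜 := ℝ) (R * M⁻¹).transpose t) = ‖t‖ ^ 2 := by
    intro t
    rw [← hadj, ← mul_apply_eq_comp, ← mul_apply_eq_comp, ← map_mul,
      ← map_mul, hWΛ, map_one, one_apply_eq_self,
      real_inner_self_eq_norm_sq]
  have hsc : 0 < √c := Real.sqrt_pos.2 hc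
  -- The eigenvalue bound on Λ at W't reads c‖W't‖² ≤ ⟨Λ W't, W't⟩ = ‖t‖². The bound for W itself
  -- then follows by duality.
  have hW' : ∀ t : Param d,
      ‖Matrix.toEuclideanCLM (𝕜 := ℝ) (R * M⁻¹).transpose t‖ ≤ ‖t‖ / √c := by
    intro t
    have h := le_inner_of_posSemidef hΛ (Matrix.toEuclideanCLM (𝕜 := ℝ) (R * M⁻¹).transpose t)
    rw [hquad] at h
    rw [le_div_iff₀ hsc]
    refine (sq_le_sq₀ (by positivity) (norm_nonneg _)).1 ?_
    rw [mul_pow, Real.sq_sqrt hc.le]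
    linarith
  refine ⟨Matrix.toEuclideanCLM (𝕜 := ℝ) (R * M⁻¹),
    Matrix.toEuclideanCLM (𝕜 := ℝ) (R * M⁻¹).transpose, hadj, hquad, hW', fun v => ?_,
    fun r θ θ' => ?_⟩
  · have h1 : ‖Matrix.toEuclideanCLM (𝕜 := ℝ) (R * M⁻¹) v‖ ^ 2
        ≤ ‖v‖ * (‖Matrix.toEuclideanCLM (𝕜 := ℝ) (R * M⁻¹) v‖ / √c) := by
      rw [← real_inner_self_eq_norm_sq, hadj]
      exact (real_inner_le_norm _ _).trans (mul_le_mul_of_nonneg_left (hW' _) (norm_nonneg _))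
    rcases (norm_nonneg (Matrix.toEuclideanCLM (𝕜 := ℝ) (R * M⁻¹) v)).eq_or_lt with h0 | h0
    · rw [← h0]; positivity
    · refine le_of_mul_le_mul_right ?_ h0
      calc _ = ‖Matrix.toEuclideanCLM (𝕜 := ℝ) (R * M⁻¹) v‖ ^ 2 := (sq _).symm
        _ ≤ _ := h1
        _ = _ := by ring
  · rw [← mul_apply_eq_comp, ← map_mul, Matrix.mul_assoc R M⁻¹ M,
      Matrix.nonsing_inv_mul M hdet, Matrix.mul_one, stdError, ← hR, Matrix.smul_mulVec]
    apply (WithLp.ofLp_injective 2)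
    simp [Matrix.ofLp_toEuclideanCLM, Matrix.mulVec_sub]

/-! ### The subsample criterion as a weighted log-likelihood -/

/-- The data that enter the subsample criterion: the full data (of which only the uncensored ones
have a nonzero weight) and the draws. -/
def subObs (D : Fin n → Obs) {m : ℕ} (I : Fin m → Fin n) : Fin n ⊕ Fin m → Obs :=
  Sum.elim D fun j => D (I j)

/-- The weights in the subsample criterion, normalized by `r / n`. -/
noncomputable def subWeight (f : ℝ → Param d → ℝ) (ξ : ℝ) (r : ℕ) (D : Fin n → Obs)
    (p : Param d) (I : Fin (r - numUncens D) → Fin n) : Fin n ⊕ Fin (r - numUncens D) → ℝ :=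
  Sum.elim (fun i => if censored (D i) = false then (n : ℝ)⁻¹ else 0)
    fun j => ((r - numUncens D : ℕ) : ℝ)⁻¹ * drawWeight f ξ r D p (I j)

theorem sum_subWeight_smul {E : Type*} [AddCommGroup E] [Module ℝ E] (f : ℝ → Param d → ℝ) (ξ : ℝ)
    (r : ℕ) (D : Fin n → Obs) (p : Param d) (I : Fin (r - numUncens D) → Fin n) (φ : Obs → E) :
    ∑ i, subWeight f ξ r D p I i • φ (subObs D I i)
      = (n : ℝ)⁻¹ • ∑ i ∈ uncensIdx D, φ (D i)
        + ((r - numUncens D : ℕ) : ℝ)⁻¹ • ∑ j, drawWeight f ξ r D p (I j) • φ (D (I j)) := by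
  rw [Fintype.sum_sum_type]
  simp only [subWeight, subObs, Sum.elim_inl, Sum.elim_inr, ite_smul, zero_smul, mul_smul,
    Finset.smul_sum, uncensIdx]
  rw [Finset.sum_filter]

/-- The subsample average of `φ` minus its full-data average. -/
theorem sum_subWeight_smul_sub {E : Type*} [AddCommGroup E] [Module ℝ E] (f : ℝ → Param d → ℝ)
    (ξ : ℝ) (r : ℕ) (D : Fin n → Obs) (p : Param d) (I : Fin (r - numUncens D) → Fin n)
    (φ : Obs → E) :
    ∑ i, subWeight f ξ r D p I i • φ (subObs D I i) - ∑ i, (n : ℝ)⁻¹ • φ (D i)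
      = ((r - numUncens D : ℕ) : ℝ)⁻¹ • ∑ j, drawWeight f ξ r D p (I j) • φ (D (I j))
        - (n : ℝ)⁻¹ • ∑ i ∈ censIdx D, φ (D i) := by
  rw [sum_subWeight_smul, ← Finset.smul_sum, ← sum_uncensIdx_add_sum_censIdx D, smul_add]
  abel

theorem subWeight_nonneg (f : ℝ → Param d → ℝ) {ξ : ℝ} (hξ : 0 < ξ ∧ ξ < 1) {r : ℕ}
    {D : Fin n → Obs} (p : Param d) (hr : numUncens D < r) (I : Fin (r - numUncens D) → Fin n)
    (i : Fin n ⊕ Fin (r - numUncens D)) : 0 ≤ subWeight f ξ r D p I i := by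
  rcases i with i | j
  · simp only [subWeight, Sum.elim_inl]
    split_ifs <;> positivity
  · exact mul_nonneg (by positivity) (drawWeight_nonneg f hξ p hr _)

/-- The factor r/n replaces the normalization by r with one under which the conditional expectation
is the full-data criterion. Since it is nonnegative, maximizers of the original criterion remain
maximizers. -/
theorem sum_subWeight_logLik (f : ℝ → Param d → ℝ) (ξ : ℝ) {r : ℕ} {D : Fin n → Obs}
    (p : Param d) (hr : numUncens D < r) (I : Fin (r - numUncens D) → Fin n) (θ : Param d) :
    ∑ i, subWeight f ξ r D p I i * logLik f (subObs D I i) θ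
      = (r / n) * subsampleLogLik f ξ r D p I θ := by
  have h := sum_subWeight_smul f ξ r D p I fun x => logLik f x θ
  simp only [smul_eq_mul] at h
  rw [h, subsampleLogLik]
  have hr0 : (r : ℝ) ≠ 0 := by
    have : 0 < r := by omega
    positivity
  have hm : ((r - numUncens D : ℕ) : ℝ) ≠ 0 := by
    have : 0 < r - numUncens D := by omega
    positivity
  have h1 : ∑ i ∈ uncensIdx D, weight f ξ r D p i * logLik f (D i) θ
      = ∑ i ∈ uncensIdx D, logLik f (D i) θ := by
    refine Finset.sum_congr rfl fun i hi => ?_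
    have : censored (D i) = false := by simpa [uncensIdx] using hi
    simp [weight, this]
  have h2 : ∑ j, drawWeight f ξ r D p (I j) * logLik f (D (I j)) θ
      = ((r - numUncens D : ℕ) : ℝ) / n * ∑ j, weight f ξ r D p (I j) * logLik f (D (I j)) θ := by
    rw [Finset.mul_sum]
    exact Finset.sum_congr rfl fun j _ => by rw [drawWeight]; ring
  rw [h1, h2]
  field_simp

theorem IsArgmax.const_mul {L : Param d → ℝ} {Θ : Set (Param d)} {θ : Param d}
    (h : IsArgmax L Θ θ) {a : ℝ} (ha : 0 ≤ a) : IsArgmax (fun θ => a * L θ) Θ θ :=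
  ⟨h.1, fun _ hθ => mul_le_mul_of_nonneg_left (h.2 hθ) ha⟩

theorem hess_symm {f : ℝ → Param d → ℝ} {x : Obs} {θ : Param d}
    (h : ContDiffAt ℝ 2 (fun ϑ => logLik f x ϑ) θ) (j k : Fin d) :
    hess f x θ j k = hess f x θ k j := by
  have := inner_hessL_comm h (EuclideanSpace.single k 1) (EuclideanSpace.single j 1)
  rw [EuclideanSpace.inner_single_right, EuclideanSpace.inner_single_right] at this
  rw [hess_apply h, hess_apply h]
  simpa using this

theorem transpose_meanHess {f : ℝ → Param d → ℝ} {D : Fin n → Obs} {θ : Param d}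
    (h : ∀ i, ContDiffAt ℝ 2 (fun ϑ => logLik f (D i) ϑ) θ) :
    (meanHess f D θ).transpose = meanHess f D θ := by
  ext j k
  simp [meanHess, Matrix.transpose_apply, Matrix.sum_apply, hess_symm (h _) k j]

theorem toEuclideanCLM_meanHess {f : ℝ → Param d → ℝ} {D : Fin n → Obs} {θ : Param d}
    (h : ∀ i, ContDiffAt ℝ 2 (fun ϑ => logLik f (D i) ϑ) θ) :
    Matrix.toEuclideanCLM (𝕜 := ℝ) (meanHess f D θ) = ∑ i, (n : ℝ)⁻¹ • hessL f (D i) θ := by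
  refine toEuclideanCLM_eq fun j k => ?_
  rw [sum_hessL_apply _ _ h]
  simp [meanHess, Matrix.sum_apply, Finset.mul_sum]

/-! ### Samples on which the subsample estimate behaves well -/

/-- Regularity of the data `D`, of the full-data estimate `θhat` and of the pilot estimate `p`, under
which the conditional law of the standardized error of `θt` is close to normal for small `η`. -/
structure GoodSample (f : ℝ → Param d → ℝ) (Θ : Set (Param d)) (ξ : ℝ) (B : Obs → ℝ)
    (K c ρ η : ℝ) (r : ℕ) (D : Fin n → Obs) (θhat p : Param d)
    (θt : (Fin (r - numUncens D) → Fin n) → Param d) : Prop where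
  dominated : ∀ i, Dominated f Θ (B (D i)) (D i)
  argmax : IsArgmax (fullLogLik f D) Θ θhat
  ball_subset : Metric.ball θhat ρ ⊆ Θ
  pilot_mem : p ∈ Θ
  argmax_sub : ∀ I, IsArgmax (subsampleLogLik f ξ r D p I) Θ (θt I)
  inner_hess_le : ∀ θ ∈ Θ, ∀ v, inner ℝ ((∑ i, (n : ℝ)⁻¹ • hessL f (D i) θ) v) v ≤ -c * ‖v‖ ^ 2
  mean_sq_le : (n : ℝ)⁻¹ * ∑ i, B (D i) ^ 2 ≤ K
  fourth_moment_le : (n : ℝ)⁻¹ * ∑ i, ‖score f (D i) θhat‖ ^ 4 ≤ K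
  cov : (covLambda f ξ D θhat - c • 1).PosSemidef
  uncens_le : (numUncens D : ℝ) ≤ η * r
  inv_le : η⁻¹ ≤ r
  pilot_close : ‖p - θhat‖ ≤ η

/-- The requirement on `η` under which the draws are well defined. -/
structure SmallTol (K c ξ η : ℝ) : Prop where
  pos : 0 < η
  le_half : η ≤ 1 / 2
  mul_le : (1 + K) * η ≤ scoreFloor K c ξ / 2

namespace GoodSample

variable {f : ℝ → Param d → ℝ} {Θ : Set (Param d)} {ξ : ℝ} {B : Obs → ℝ} {K c ρ η : ℝ} {r : ℕ}
  {D : Fin n → Obs} {θhat p : Param d} {θt : (Fin (r - numUncens D) → Fin n) → Param d}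

theorem nonneg_bound (h : GoodSample f Θ ξ B K c ρ η r D θhat p θt) : 0 ≤ K :=
  le_trans (by positivity) h.fourth_moment_le

theorem mean_le (h : GoodSample f Θ ξ B K c ρ η r D θhat p θt) :
    (n : ℝ)⁻¹ * ∑ i, B (D i) ≤ 1 + K := by
  simpa using mean_le_one_add (p := 1) (by norm_num) (fun i => (h.dominated i).nonneg) h.mean_sq_le

theorem two_le (h : GoodSample f Θ ξ B K c ρ η r D θhat p θt) (hη : SmallTol K c ξ η) :
    (2 : ℝ) ≤ r := by
  refine le_trans ?_ h.inv_le
  rw [le_inv_comm₀ (by norm_num) hη.pos]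
  linarith [hη.le_half]

theorem uncens_lt (h : GoodSample f Θ ξ B K c ρ η r D θhat p θt) (hη : SmallTol K c ξ η) :
    numUncens D < r := by
  have h1 := h.two_le hη
  have h2 := h.uncens_le
  have : (numUncens D : ℝ) < r := by nlinarith [hη.le_half]
  exact_mod_cast this

theorem cast_sub (h : GoodSample f Θ ξ B K c ρ η r D θhat p θt) (hη : SmallTol K c ξ η) :
    ((r - numUncens D : ℕ) : ℝ) = r - numUncens D := Nat.cast_sub (h.uncens_lt hη).le

theorem draws_ge (h : GoodSample f Θ ξ B K c ρ η r D θhat p θt) (hη : SmallTol K c ξ η) :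
    (1 - η) * r ≤ ((r - numUncens D : ℕ) : ℝ) := by
  rw [h.cast_sub hη]
  linarith [h.uncens_le]

theorem half_le (h : GoodSample f Θ ξ B K c ρ η r D θhat p θt) (hη : SmallTol K c ξ η) :
    (r : ℝ) / 2 ≤ ((r - numUncens D : ℕ) : ℝ) := by
  have := h.draws_ge hη
  nlinarith [hη.le_half, h.two_le hη]

theorem draws_pos (h : GoodSample f Θ ξ B K c ρ η r D θhat p θt) (hη : SmallTol K c ξ η) :
    0 < r - numUncens D := Nat.sub_pos_of_lt (h.uncens_lt hη)

theorem floor_le (h : GoodSample f Θ ξ B K c ρ η r D θhat p θt) (hd : 0 < d)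
    (hξ : 0 < ξ ∧ ξ < 1) (hc : 0 < c) :
    scoreFloor K c ξ ≤ (n : ℝ)⁻¹ * ∑ i ∈ censIdx D, ‖score f (D i) θhat‖ :=
  scoreFloor_le hd hξ h.nonneg_bound hc h.cov h.fourth_moment_le

/-- The mean score norm is Lipschitz with constant at most 1 + K, so moving from `θhat` to the pilot
estimate loses at most (1 + K)η, which `SmallTol` limits to half of the floor. -/
theorem floor_le_pilot (h : GoodSample f Θ ξ B K c ρ η r D θhat p θt) (hη : SmallTol K c ξ η)
    (hΘ : Convex ℝ Θ) (hd : 0 < d) (hξ : 0 < ξ ∧ ξ < 1) (hc : 0 < c) :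
    scoreFloor K c ξ / 2 ≤ (n : ℝ)⁻¹ * ∑ i ∈ censIdx D, ‖score f (D i) p‖ := by
  have h1 := h.floor_le hd hξ hc
  have h2 := mean_norm_score_sub_le hΘ h.dominated h.pilot_mem h.argmax.1
  have h3 := neg_le_of_abs_le h2
  have h4 : (n : ℝ)⁻¹ * ((∑ i, B (D i)) * ‖p - θhat‖) ≤ (1 + K) * η := by
    rw [← mul_assoc]
    exact mul_le_mul h.mean_le h.pilot_close (norm_nonneg _) (by linarith [h.nonneg_bound])
  have h5 : -((n : ℝ)⁻¹ * ((∑ i, B (D i)) * ‖p - θhat‖))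
      ≤ (n : ℝ)⁻¹ * ∑ i ∈ censIdx D, ‖score f (D i) p‖
        - (n : ℝ)⁻¹ * ∑ i ∈ censIdx D, ‖score f (D i) θhat‖ := by
    rw [← mul_sub, ← mul_neg]
    exact mul_le_mul_of_nonneg_left h3 (by positivity)
  linarith [hη.mul_le]

theorem sum_score_pilot_pos (h : GoodSample f Θ ξ B K c ρ η r D θhat p θt)
    (hη : SmallTol K c ξ η) (hΘ : Convex ℝ Θ) (hd : 0 < d) (hξ : 0 < ξ ∧ ξ < 1) (hc : 0 < c) :
    0 < ∑ i ∈ censIdx D, ‖score f (D i) p‖ := by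
  have h1 := h.floor_le_pilot hη hΘ hd hξ hc
  have h2 := scoreFloor_pos h.nonneg_bound hc hξ.1
  by_contra hcon
  have : (n : ℝ)⁻¹ * ∑ i ∈ censIdx D, ‖score f (D i) p‖ ≤ 0 :=
    mul_nonpos_of_nonneg_of_nonpos (by positivity) (not_lt.1 hcon)
  linarith

theorem isProbabilityMeasure (h : GoodSample f Θ ξ B K c ρ η r D θhat p θt)
    (hη : SmallTol K c ξ η) (hΘ : Convex ℝ Θ) (hd : 0 < d) (hξ : 0 < ξ ∧ ξ < 1) (hc : 0 < c) :
    IsProbabilityMeasure (drawLaw f ξ D p) :=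
  isProbabilityMeasure_drawLaw f hξ (h.sum_score_pilot_pos hη hΘ hd hξ hc)

/-- At the full-data estimate the mean score of all the data vanishes. -/
theorem sum_score_eq_zero (h : GoodSample f Θ ξ B K c ρ η r D θhat p θt) (hρ : 0 < ρ) :
    ∑ i, (n : ℝ)⁻¹ • score f (D i) θhat = 0 := by
  have h1 := hasGradientAt_sum_logLik (fun _ : Fin n => (n : ℝ)⁻¹) D
    fun i => (h.dominated i).smooth θhat h.argmax.1
  have e : (fun ϑ => ∑ i, (n : ℝ)⁻¹ * logLik f (D i) ϑ) = fullLogLik f D := by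
    ext ϑ; rw [fullLogLik, Finset.mul_sum]
  rw [e] at h1
  exact h.argmax.gradient_eq_zero hρ h.ball_subset h1

/-- The estimating equation of the subsample, linearized at the full-data estimate. -/
theorem norm_linearization_le (h : GoodSample f Θ ξ B K c ρ η r D θhat p θt)
    (hη : SmallTol K c ξ η) (hΘ : Convex ℝ Θ) (hξ : 0 < ξ ∧ ξ < 1)
    (hc : 0 < c) {τ a : ℝ} (hτc : τ ≤ c / 2)
    (I : Fin (r - numUncens D) → Fin n)
    (hH : ∀ θ ∈ Θ, ‖∑ i, subWeight f ξ r D p I i • hessL f (subObs D I i) θ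
      - ∑ i, (n : ℝ)⁻¹ • hessL f (D i) θ‖ ≤ τ)
    (hG : ‖∑ i, subWeight f ξ r D p I i • score f (subObs D I i) θhat‖ ≤ a)
    (ha : 2 * a / c < ρ) :
    ‖(∑ i, (n : ℝ)⁻¹ • hessL f (D i) θhat) (θt I - θhat)
      + ∑ i, subWeight f ξ r D p I i • score f (subObs D I i) θhat‖
      ≤ (τ + (1 + K) * (2 * a / c)) * (2 * a / c) := by
  have hr := h.uncens_lt hη
  have hdomI : ∀ i, Dominated f Θ (B (subObs D I i)) (subObs D I i) := by
    rintro (i | j)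
    · exact h.dominated i
    · exact h.dominated (I j)
  have hL : ∀ θ ∈ Θ, HasGradientAt
      (fun ϑ => ∑ i, subWeight f ξ r D p I i * logLik f (subObs D I i) ϑ)
      (∑ i, subWeight f ξ r D p I i • score f (subObs D I i) θ) θ := fun θ hθ =>
    hasGradientAt_sum_logLik _ _ fun i => (hdomI i).smooth θ hθ
  have hGd : ∀ θ ∈ Θ, HasFDerivAt
      (fun ϑ => ∑ i, subWeight f ξ r D p I i • score f (subObs D I i) ϑ)
      (∑ i, subWeight f ξ r D p I i • hessL f (subObs D I i) θ) θ := fun θ hθ =>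
    hasFDerivAt_sum_score _ _ fun i => (hdomI i).smooth θ hθ
  have hmax : IsArgmax (fun ϑ => ∑ i, subWeight f ξ r D p I i * logLik f (subObs D I i) ϑ) Θ
      (θt I) := by
    have := (h.argmax_sub I).const_mul (a := (r : ℝ) / n) (by positivity)
    rwa [← funext (sum_subWeight_logLik f ξ p hr I)] at this
  have hneg : ∀ θ ∈ Θ, ∀ v, inner ℝ
      ((∑ i, subWeight f ξ r D p I i • hessL f (subObs D I i) θ) v) v ≤ -(c / 2) * ‖v‖ ^ 2 := by
    intro θ hθ v
    refine (inner_le_of_norm_sub_le (hH θ hθ) (h.inner_hess_le θ hθ) v).trans ?_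
    nlinarith [sq_nonneg ‖v‖]
  have hdist := mul_norm_sub_le_of_strongConcave hΘ hL hGd hneg hmax h.argmax.1
  have hΔ : ‖θt I - θhat‖ ≤ 2 * a / c := by
    rw [le_div_iff₀ hc]
    linarith
  have hball : θt I ∈ Metric.ball θhat ρ := by
    rw [Metric.mem_ball, dist_eq_norm]; linarith
  have hzero : ∑ i, subWeight f ξ r D p I i • score f (subObs D I i) (θt I) = 0 := by
    refine hmax.gradient_eq_zero (ρ := ρ - ‖θt I - θhat‖) (by linarith) ?_ (hL _ hmax.1)
    refine (Metric.ball_subset_ball' ?_).trans h.ball_subset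
    rw [dist_eq_norm]; linarith
  have hKd := h.nonneg_bound
  -- Two sources of error in the derivative along the segment: τ from replacing the subsample
  -- Hessian by the full-data one, and the Lipschitz variation of the latter away from `θhat`.
  have hlin := norm_sub_sub_le_of_fderiv_close hΘ (M := ∑ i, (n : ℝ)⁻¹ • hessL f (D i) θhat)
    (τ := τ + (1 + K) * ‖θt I - θhat‖) hGd hmax.1 h.argmax.1 (by
      intro θ hθ hle
      have h1 := norm_sum_hessL_sub_le (w := fun _ : Fin n => (n : ℝ)⁻¹)
        (fun _ => by positivity) h.dominated hθ h.argmax.1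
      rw [← Finset.mul_sum] at h1
      have h2 : (n : ℝ)⁻¹ * (∑ i, B (D i)) * ‖θ - θhat‖ ≤ (1 + K) * ‖θt I - θhat‖ :=
        mul_le_mul h.mean_le hle (norm_nonneg _) (by linarith)
      refine (norm_sub_le_norm_sub_add_norm_sub _ (∑ i, (n : ℝ)⁻¹ • hessL f (D i) θ) _).trans ?_
      linarith [hH θ hθ])
  have e : (∑ i, (n : ℝ)⁻¹ • hessL f (D i) θhat) (θt I - θhat)
      + ∑ i, subWeight f ξ r D p I i • score f (subObs D I i) θhat
      = -(∑ i, subWeight f ξ r D p I i • score f (subObs D I i) (θt I)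
        - ∑ i, subWeight f ξ r D p I i • score f (subObs D I i) θhat
        - (∑ i, (n : ℝ)⁻¹ • hessL f (D i) θhat) (θt I - θhat)) := by
    rw [hzero]; abel
  rw [e, norm_neg]
  refine hlin.trans ?_
  have hτ0 : 0 ≤ τ := (norm_nonneg _).trans (hH θhat h.argmax.1)
  have ha0 : 0 ≤ 2 * a / c := (norm_nonneg _).trans hΔ
  gcongr

end GoodSample

end RDCS

/-! ### The conditional limit theorem on good samples. -/

namespace RDCS

variable {d n : ℕ}

namespace GoodSample

variable {f : ℝ → Param d → ℝ} {Θ : Set (Param d)} {ξ : ℝ} {B : Obs → ℝ} {K c ρ η : ℝ} {r : ℕ}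
  {D : Fin n → Obs} {θhat p : Param d} {θt : (Fin (r - numUncens D) → Fin n) → Param d}

/-! ### Conditional probabilities given the data and the pilot estimate -/

/-- The subsample average of a function is close to its full-data average. -/
theorem measureReal_sub_ge_le (h : GoodSample f Θ ξ B K c ρ η r D θhat p θt)
    (hη : SmallTol K c ξ η) (hΘ : Convex ℝ Θ) (hd : 0 < d) (hξ : 0 < ξ ∧ ξ < 1) (hc : 0 < c)
    (φ : Obs → ℝ) {K' τ : ℝ} (hφ : (n : ℝ)⁻¹ * ∑ i, φ (D i) ^ 2 ≤ K') (hτ : 0 < τ) :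
    (subsampleLaw f ξ r D p).real
      {I | τ ≤ |∑ i, subWeight f ξ r D p I i • φ (subObs D I i) - ∑ i, (n : ℝ)⁻¹ • φ (D i)|}
      ≤ ξ⁻¹ * K' / (((r - numUncens D : ℕ) : ℝ) * τ ^ 2) := by
  have := h.isProbabilityMeasure hη hΘ hd hξ hc
  have hξ0 := hξ.1
  have hK' : 0 ≤ K' := le_trans (by positivity) hφ
  have hch := measure_pi_mean_sub_ge_le (ν := drawLaw f ξ D p)
    (φ := fun i => drawWeight f ξ r D p i * φ (D i)) MemLp.of_discrete (h.draws_pos hη) hτ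
  rw [integral_drawWeight f hξ p (h.uncens_lt hη) fun i => φ (D i)] at hch
  refine ENNReal.toReal_le_of_le_ofReal (by positivity) (le_trans ?_ (hch.trans
    (ENNReal.ofReal_le_ofReal ?_)))
  · refine measure_mono fun I hI => ?_
    change τ ≤ |_ - _|
    change τ ≤ |_ - _| at hI
    rw [sum_subWeight_smul_sub] at hI
    simpa only [smul_eq_mul] using hI
  · gcongr
    refine (integral_drawWeight_sq_le f hξ p (h.uncens_lt hη) fun i => φ (D i)).trans ?_
    gcongr

/-- The conditional law of the subsample gradient at the full-data estimate. -/
theorem measureReal_gradient_ge_le (h : GoodSample f Θ ξ B K c ρ η r D θhat p θt)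
    (hη : SmallTol K c ξ η) (hΘ : Convex ℝ Θ) (hd : 0 < d) (hξ : 0 < ξ ∧ ξ < 1) (hc : 0 < c)
    (hρ : 0 < ρ) {a : ℝ} (ha : 0 < a) :
    (subsampleLaw f ξ r D p).real
      {I | a ≤ ‖∑ i, subWeight f ξ r D p I i • score f (subObs D I i) θhat‖}
      ≤ d * (ξ⁻¹ * (1 + K) / (((r - numUncens D : ℕ) : ℝ) * (a / d) ^ 2)) := by
  have := h.isProbabilityMeasure hη hΘ hd hξ hc
  have hP : IsProbabilityMeasure (subsampleLaw f ξ r D p) := by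
    unfold subsampleLaw; infer_instance
  have hdR : (0 : ℝ) < d := by exact_mod_cast hd
  -- A vector of norm at least a has a coordinate of absolute value at least a/d. The full-data mean
  -- it is compared with is 0, because `θhat` is an interior maximizer.
  have hsub : {I | a ≤ ‖∑ i, subWeight f ξ r D p I i • score f (subObs D I i) θhat‖}
      ⊆ ⋃ j ∈ (Finset.univ : Finset (Fin d)), {I | a / d ≤
        |∑ i, subWeight f ξ r D p I i • score f (subObs D I i) θhat j
          - ∑ i, (n : ℝ)⁻¹ • score f (D i) θhat j|} := by
    intro I hI
    by_contra hcon
    simp only [Finset.mem_univ, Set.iUnion_true, Set.mem_iUnion, not_exists] at hcon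
    have hz : ∀ j, ∑ i, (n : ℝ)⁻¹ • score f (D i) θhat j = 0 := by
      intro j
      have := congrArg (fun v : Param d => v j) (h.sum_score_eq_zero hρ)
      simpa using this
    have hlt : ∀ j, |(∑ i, subWeight f ξ r D p I i • score f (subObs D I i) θhat) j| < a / d := by
      intro j
      have h1 := hcon j
      change ¬ (a / d ≤ |_ - _|) at h1
      rw [hz, sub_zero, not_le] at h1
      simpa using h1
    have hle : ‖∑ i, subWeight f ξ r D p I i • score f (subObs D I i) θhat‖
        ≤ ∑ j, |(∑ i, subWeight f ξ r D p I i • score f (subObs D I i) θhat) j| :=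
      norm_le_sum_abs _
    have hs : ∑ j, |(∑ i, subWeight f ξ r D p I i • score f (subObs D I i) θhat) j|
        < ∑ _j : Fin d, a / d :=
      Finset.sum_lt_sum_of_nonempty ⟨⟨0, hd⟩, Finset.mem_univ _⟩ fun j _ => hlt j
    have e : ∑ _j : Fin d, a / d = a := by
      simp only [Finset.sum_const, Finset.card_univ, Fintype.card_fin, nsmul_eq_mul]
      field_simp
    rw [e] at hs
    exact absurd (show a ≤ _ from hI) (not_le.2 (hle.trans_lt hs))
  refine (measureReal_mono hsub (measure_ne_top _ _)).trans ((measureReal_biUnion_finset_le _ _).trans ?_)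
  calc _ ≤ ∑ _j : Fin d, ξ⁻¹ * (1 + K) / (((r - numUncens D : ℕ) : ℝ) * (a / d) ^ 2) := by
        refine Finset.sum_le_sum fun j _ => ?_
        refine h.measureReal_sub_ge_le hη hΘ hd hξ hc (fun x => score f x θhat j) ?_ (by positivity)
        refine le_trans ?_ (mean_le_one_add (p := 2) (by norm_num)
          (fun i => norm_nonneg (score f (D i) θhat)) h.fourth_moment_le)
        refine mul_le_mul_of_nonneg_left (Finset.sum_le_sum fun i _ => ?_) (by positivity)
        rw [← sq_abs, ← Real.norm_eq_abs]
        exact pow_le_pow_left₀ (norm_nonneg _) (PiLp.norm_apply_le _ j) 2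
    _ = _ := by simp

/-- The subsample average of the domination constants is bounded in probability. -/
theorem measureReal_sum_dominating_ge_le (h : GoodSample f Θ ξ B K c ρ η r D θhat p θt)
    (hη : SmallTol K c ξ η) (hΘ : Convex ℝ Θ) (hd : 0 < d) (hξ : 0 < ξ ∧ ξ < 1) (hc : 0 < c)
    {A : ℝ} (hA : 0 < A) :
    (subsampleLaw f ξ r D p).real
      {I | (1 + K) + A ≤ ∑ i, subWeight f ξ r D p I i * B (subObs D I i)} ≤ (1 + K) / A := by
  have := h.isProbabilityMeasure hη hΘ hd hξ hc
  have hK := h.nonneg_bound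
  have hMk := measure_pi_mean_ge_le (ν := drawLaw f ξ D p)
    (φ := fun i => drawWeight f ξ r D p i * B (D i)) Integrable.of_finite
    (fun i => mul_nonneg (drawWeight_nonneg f hξ p (h.uncens_lt hη) i) (h.dominated i).nonneg)
    (h.draws_pos hη) hA
  rw [integral_drawWeight f hξ p (h.uncens_lt hη) fun i => B (D i)] at hMk
  refine ENNReal.toReal_le_of_le_ofReal (by positivity) (le_trans ?_ (hMk.trans
    (ENNReal.ofReal_le_ofReal ?_)))
  · refine measure_mono fun I hI => ?_
    change (_ : ℝ) ≤ _
    change (_ : ℝ) ≤ _ at hI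
    have hs := sum_subWeight_smul f ξ r D p I B
    simp only [smul_eq_mul] at hs
    rw [hs] at hI
    -- The uncensored part is not random given the data and accounts for at most 1 + K; only the
    -- excess A is left to Markov's inequality for the draws.
    have hun : (n : ℝ)⁻¹ * ∑ i ∈ uncensIdx D, B (D i) ≤ 1 + K := by
      refine le_trans ?_ h.mean_le
      gcongr
      · exact fun i _ _ => (h.dominated i).nonneg
      · exact Finset.subset_univ _
    linarith
  · gcongr
    exact le_trans (mul_le_mul_of_nonneg_left
      (sum_censIdx_le fun i => (h.dominated i).nonneg) (by positivity)) h.mean_le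

end GoodSample

/-- The Hessian of the subsample criterion is uniformly close to that of the full data, with high
conditional probability. -/
theorem exists_measureReal_hess_le {f : ℝ → Param d → ℝ} {Θ : Set (Param d)} {ξ : ℝ} {B : Obs → ℝ}
    {K c ρ : ℝ} (hcomp : IsCompact Θ) (hΘ : Convex ℝ Θ) (hd : 0 < d) (hξ : 0 < ξ ∧ ξ < 1)
    (hc : 0 < c) (hK : 0 ≤ K) {τ δ : ℝ} (hτ : 0 < τ) (hδ : 0 < δ) :
    ∃ N : ℝ, ∀ {n r : ℕ} {D : Fin n → Obs} {θhat p : Param d}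
      {θt : (Fin (r - numUncens D) → Fin n) → Param d} {η : ℝ},
      GoodSample f Θ ξ B K c ρ η r D θhat p θt → SmallTol K c ξ η →
      N ≤ ((r - numUncens D : ℕ) : ℝ) →
      (subsampleLaw f ξ r D p).real {I | ¬ ∀ θ ∈ Θ,
        ‖∑ i, subWeight f ξ r D p I i • hessL f (subObs D I i) θ
          - ∑ i, (n : ℝ)⁻¹ • hessL f (D i) θ‖ ≤ τ} ≤ δ := by
  have hξ0 := hξ.1
  have hdR : (0 : ℝ) < d := by exact_mod_cast hd
  -- Budget: A makes the Markov bound for the Lipschitz constants δ/2; the mesh κ makes the loss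
  -- between net points τ/2; the entrywise tolerance e sums to τ/2 over d² entries; C/m is the union
  -- bound over net points and entries, at most δ/2 for m ≥ 2C/δ. None of these depends on the
  -- sample, so neither does the threshold.
  set A : ℝ := 2 * (1 + K) / δ with hA
  have hA0 : 0 < A := by positivity
  set κ : ℝ := τ / (2 * ((1 + K + A) + (1 + K))) with hκ
  have hκ0 : 0 < κ := by positivity
  obtain ⟨T, hTΘ, hT⟩ := exists_finite_net hcomp hκ0
  set e : ℝ := τ / (2 * (d * d)) with he
  have he0 : 0 < e := by positivity
  set C : ℝ := T.card * (d * (d * (ξ⁻¹ * K))) / e ^ 2 with hC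
  refine ⟨2 * C / δ + 1, fun {n r D θhat p θt η} h hη hN => ?_⟩
  have := h.isProbabilityMeasure hη hΘ hd hξ hc
  have hP : IsProbabilityMeasure (subsampleLaw f ξ r D p) := by
    unfold subsampleLaw; infer_instance
  set m : ℝ := ((r - numUncens D : ℕ) : ℝ) with hm
  have hm0 : 0 < m := by
    have : 0 ≤ 2 * C / δ := by positivity
    linarith
  set S : Set (Fin (r - numUncens D) → Fin n) :=
    {I | (1 + K) + A ≤ ∑ i, subWeight f ξ r D p I i * B (subObs D I i)} with hS
  set U : Param d → Fin d → Fin d → Set (Fin (r - numUncens D) → Fin n) := fun t j k =>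
    {I | e ≤ |∑ i, subWeight f ξ r D p I i • hess f (subObs D I i) t j k
      - ∑ i, (n : ℝ)⁻¹ • hess f (D i) t j k|} with hU
  have hsub : {I | ¬ ∀ θ ∈ Θ, ‖∑ i, subWeight f ξ r D p I i • hessL f (subObs D I i) θ
      - ∑ i, (n : ℝ)⁻¹ • hessL f (D i) θ‖ ≤ τ}
      ⊆ S ∪ ⋃ t ∈ T, ⋃ j ∈ (Finset.univ : Finset (Fin d)),
        ⋃ k ∈ (Finset.univ : Finset (Fin d)), U t j k := by
    intro I hI
    by_contra hcon
    simp only [Set.mem_union, Set.mem_iUnion, Finset.mem_univ, exists_prop, true_and, not_or,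
      not_exists, not_and] at hcon
    obtain ⟨hc1, hc2⟩ := hcon
    refine hI ?_
    have hdomI : ∀ i, Dominated f Θ (B (subObs D I i)) (subObs D I i) := by
      rintro (i | j)
      · exact h.dominated i
      · exact h.dominated (I j)
    have hw := subWeight_nonneg f hξ p (h.uncens_lt hη) I
    have hl1 : ∑ i, subWeight f ξ r D p I i * B (subObs D I i) ≤ 1 + K + A :=
      (not_le.1 (show ¬ (1 + K) + A ≤ _ from hc1)).le
    have hnet := norm_sub_le_of_net (K₁ := 1 + K + A) (K₂ := 1 + K) (τ := τ / 2) (κ := κ)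
      (H₁ := fun θ => ∑ i, subWeight f ξ r D p I i • hessL f (subObs D I i) θ)
      (H₂ := fun θ => ∑ i, (n : ℝ)⁻¹ • hessL f (D i) θ) hTΘ hT (by positivity) (by positivity)
      (fun θ hθ θ' hθ' => (norm_sum_hessL_sub_le hw hdomI hθ hθ').trans
        (mul_le_mul_of_nonneg_right hl1 (norm_nonneg _)))
      (fun θ hθ θ' hθ' => by
        have h1 := norm_sum_hessL_sub_le (w := fun _ : Fin n => (n : ℝ)⁻¹)
          (fun _ => by positivity) h.dominated hθ hθ'
        rw [← Finset.mul_sum] at h1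
        exact h1.trans (mul_le_mul_of_nonneg_right h.mean_le (norm_nonneg _)))
      (fun t ht => by
        refine (opNorm_le_sum_entries _).trans ?_
        calc _ ≤ ∑ _j : Fin d, ∑ _k : Fin d, e := by
              refine Finset.sum_le_sum fun j _ => Finset.sum_le_sum fun k _ => ?_
              rw [sub_apply, PiLp.sub_apply,
                sum_hessL_apply _ _ fun i => (hdomI i).smooth t (hTΘ ht),
                sum_hessL_apply _ _ fun i => (h.dominated i).smooth t (hTΘ ht)]
              have := hc2 t ht j k
              simp only [hU] at this
              exact (not_le.1 (show ¬ e ≤ _ from this)).le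
          _ = τ / 2 := by
              simp only [Finset.sum_const, Finset.card_univ, Fintype.card_fin, nsmul_eq_mul, he]
              field_simp)
    intro θ hθ
    refine (hnet θ hθ).trans (le_of_eq ?_)
    have : (1 + K + A + (1 + K)) ≠ 0 := by positivity
    rw [hκ]
    field_simp
    ring
  have hentry : ∀ t ∈ T, ∀ j k, (subsampleLaw f ξ r D p).real (U t j k)
      ≤ ξ⁻¹ * K / (m * e ^ 2) := by
    intro t ht j k
    refine h.measureReal_sub_ge_le hη hΘ hd hξ hc (fun x => hess f x t j k) ?_ he0
    refine le_trans ?_ h.mean_sq_le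
    refine mul_le_mul_of_nonneg_left (Finset.sum_le_sum fun i _ => ?_) (by positivity)
    have hdi := h.dominated i
    rw [← sq_abs, hess_apply (hdi.smooth t (hTΘ ht)), ← Real.norm_eq_abs]
    refine pow_le_pow_left₀ (norm_nonneg _) ((PiLp.norm_apply_le _ j).trans ?_) 2
    refine ((hessL f (D i) t).le_opNorm _).trans ?_
    rw [PiLp.norm_single, norm_one, mul_one]
    exact hdi.bound t (hTΘ ht)
  refine (measureReal_mono hsub (measure_ne_top _ _)).trans ((measureReal_union_le _ _).trans ?_)
  have h1 : (subsampleLaw f ξ r D p).real S ≤ δ / 2 := by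
    refine (h.measureReal_sum_dominating_ge_le hη hΘ hd hξ hc hA0).trans (le_of_eq ?_)
    rw [hA]
    field_simp
  have h2 : (subsampleLaw f ξ r D p).real (⋃ t ∈ T, ⋃ j ∈ (Finset.univ : Finset (Fin d)),
        ⋃ k ∈ (Finset.univ : Finset (Fin d)), U t j k) ≤ δ / 2 := by
    have hb : ∀ t ∈ T, (subsampleLaw f ξ r D p).real (⋃ j ∈ (Finset.univ : Finset (Fin d)),
        ⋃ k ∈ (Finset.univ : Finset (Fin d)), U t j k)
        ≤ ∑ _j : Fin d, ∑ _k : Fin d, ξ⁻¹ * K / (m * e ^ 2) := fun t ht =>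
      (measureReal_biUnion_finset_le _ _).trans (Finset.sum_le_sum fun j _ =>
        (measureReal_biUnion_finset_le _ _).trans (Finset.sum_le_sum fun k _ => hentry t ht j k))
    refine (measureReal_biUnion_finset_le _ _).trans ((Finset.sum_le_sum hb).trans ?_)
    simp only [Finset.sum_const, Finset.card_univ, Fintype.card_fin, nsmul_eq_mul]
    have e1 : (T.card : ℝ) * (d * (d * (ξ⁻¹ * K / (m * e ^ 2)))) = C / m := by
      rw [hC]; field_simp
    rw [e1, div_le_iff₀ hm0]
    have : 2 * C / δ ≤ m := by linarith
    rw [div_le_iff₀ hδ] at this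
    linarith
  linarith

/-- The bound for the third moments of the normalized draws. -/
noncomputable def cubeBound (K c ξ : ℝ) : ℝ :=
  (√c)⁻¹ ^ 3 * (4 * ((ξ ^ 2)⁻¹ * (1 + K) + (1 + K) ^ 3))

/-- The rate at which the covariance of the normalized draws approaches the identity. -/
noncomputable def covRate (K c ξ : ℝ) : ℝ :=
  (ξ ^ 2)⁻¹ * (2 * K / (scoreFloor K c ξ / 2) + (1 + K) ^ 2 / (scoreFloor K c ξ / 2) ^ 2) / c

/-- On a good sample the standardized error is approximated by a normalized sum of centred draws. -/
theorem GoodSample.exists_summand {f : ℝ → Param d → ℝ} {Θ : Set (Param d)} {ξ : ℝ} {B : Obs → ℝ}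
    {K c ρ η : ℝ} {r : ℕ} {D : Fin n → Obs} {θhat p : Param d}
    {θt : (Fin (r - numUncens D) → Fin n) → Param d}
    (h : GoodSample f Θ ξ B K c ρ η r D θhat p θt)
    (hη : SmallTol K c ξ η) (hΘ : Convex ℝ Θ) (hd : 0 < d) (hξ : 0 < ξ ∧ ξ < 1) (hc : 0 < c)
    (hρ : 0 < ρ) :
    ∃ Y : Fin n → Param d, (∀ t, ∫ i, inner ℝ (Y i) t ∂(drawLaw f ξ D p) = 0)
      ∧ ∫ i, ‖Y i‖ ^ 3 ∂(drawLaw f ξ D p) ≤ cubeBound K c ξ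
      ∧ (∀ t, |∫ i, (inner ℝ (Y i) t : ℝ) ^ 2 ∂(drawLaw f ξ D p) - ‖t‖ ^ 2|
        ≤ covRate K c ξ * η * ‖t‖ ^ 2)
      ∧ ∀ (I : Fin (r - numUncens D) → Fin n) (τ a : ℝ), τ ≤ c / 2 → 2 * a / c < ρ →
        (∀ θ ∈ Θ, ‖∑ i, subWeight f ξ r D p I i • hessL f (subObs D I i) θ
          - ∑ i, (n : ℝ)⁻¹ • hessL f (D i) θ‖ ≤ τ) →
        ‖∑ i, subWeight f ξ r D p I i • score f (subObs D I i) θhat‖ ≤ a →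
        ‖stdError r (covV f ξ D θhat) (θt I) θhat
          - (√(r : ℝ) / ((r - numUncens D : ℕ) : ℝ)) • ∑ j, Y (I j)‖
          ≤ √(r : ℝ) * ((τ + (1 + K) * (2 * a / c)) * (2 * a / c) / √c) := by
  have hr := h.uncens_lt hη
  have hprob := h.isProbabilityMeasure hη hΘ hd hξ hc
  have hK := h.nonneg_bound
  have hξ0 := hξ.1
  have hsc : 0 < √c := Real.sqrt_pos.2 hc
  have hsm : ∀ i, ContDiffAt ℝ 2 (fun ϑ => logLik f (D i) ϑ) θhat := fun i =>
    (h.dominated i).smooth θhat h.argmax.1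
  obtain ⟨W, W', hadj, hquad, hW', hW, hstd⟩ := exists_whitening hc hc (transpose_meanHess hsm)
    (by rw [toEuclideanCLM_meanHess hsm]; exact h.inner_hess_le θhat h.argmax.1) h.cov
  rw [toEuclideanCLM_meanHess hsm] at hstd
  set μ : Param d := (n : ℝ)⁻¹ • ∑ i ∈ censIdx D, score f (D i) θhat with hμ
  have hin : ∀ i t, inner ℝ (-W (drawWeight f ξ r D p i • score f (D i) θhat - μ)) t
      = -(drawWeight f ξ r D p i * inner ℝ (score f (D i) θhat) (W' t) - inner ℝ μ (W' t)) := by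
    intro i t
    rw [inner_neg_left, hadj, inner_sub_left, real_inner_smul_left]
  have hmean : ∀ u, ∫ i, drawWeight f ξ r D p i * inner ℝ (score f (D i) θhat) u
      ∂(drawLaw f ξ D p) = inner ℝ μ u := by
    intro u
    rw [integral_drawWeight f hξ p hr, hμ, real_inner_smul_left, sum_inner]
  -- The summand is a whitened, centred weighted score. The minus sign comes from the linearized
  -- equation: the Hessian applied to the error is minus the gradient.
  refine ⟨fun i => -W (drawWeight f ξ r D p i • score f (D i) θhat - μ), fun t => ?_, ?_,
    fun t => ?_, fun I τ a hτ ha hH hG => ?_⟩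
  · simp only [hin]
    rw [integral_neg, integral_sub Integrable.of_finite Integrable.of_finite, hmean]
    simp
  · have hμn : ‖μ‖ ≤ 1 + K := by
      rw [hμ, norm_smul, Real.norm_of_nonneg (by positivity)]
      refine le_trans (mul_le_mul_of_nonneg_left ((norm_sum_le _ _).trans
        (sum_censIdx_le fun i => norm_nonneg _)) (by positivity)) ?_
      simpa using mean_le_one_add (p := 1) (by norm_num)
        (fun i => norm_nonneg (score f (D i) θhat)) h.fourth_moment_le
    have hle : ∀ i, ‖-W (drawWeight f ξ r D p i • score f (D i) θhat - μ)‖ ^ 3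
        ≤ (√c)⁻¹ ^ 3 * (4 * ((drawWeight f ξ r D p i * ‖score f (D i) θhat‖) ^ 3
          + (1 + K) ^ 3)) := by
      intro i
      have hdw := drawWeight_nonneg f hξ p hr i
      have h1 : ‖drawWeight f ξ r D p i • score f (D i) θhat - μ‖
          ≤ drawWeight f ξ r D p i * ‖score f (D i) θhat‖ + (1 + K) := by
        refine (norm_sub_le _ _).trans (add_le_add (le_of_eq ?_) hμn)
        rw [norm_smul, Real.norm_of_nonneg hdw]
      -- Convexity of the cube, (x + y)³ ≤ 4(x³ + y³), is the origin of the 4 in `cubeBound`.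
      have h2 := add_pow_le (mul_nonneg hdw (norm_nonneg (score f (D i) θhat)))
        (by linarith : 0 ≤ 1 + K) 3
      norm_num at h2
      calc ‖-W (drawWeight f ξ r D p i • score f (D i) θhat - μ)‖ ^ 3
          ≤ ((drawWeight f ξ r D p i * ‖score f (D i) θhat‖ + (1 + K)) * (√c)⁻¹) ^ 3 := by
            rw [norm_neg]
            refine pow_le_pow_left₀ (norm_nonneg _) ((hW _).trans ?_) 3
            rw [div_eq_mul_inv]
            gcongr
        _ = (√c)⁻¹ ^ 3 * (drawWeight f ξ r D p i * ‖score f (D i) θhat‖ + (1 + K)) ^ 3 := by ring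
        _ ≤ _ := by gcongr
    refine (integral_mono Integrable.of_finite Integrable.of_finite hle).trans ?_
    rw [integral_const_mul, integral_const_mul,
      integral_add Integrable.of_finite Integrable.of_finite, cubeBound]
    simp only [integral_const, probReal_univ, one_smul]
    have h3 := integral_drawWeight_cube_le f hξ p hr (φ := fun i => ‖score f (D i) θhat‖)
      fun i => norm_nonneg _
    have h4 := mean_le_one_add (p := 3) (by norm_num)
      (fun i => norm_nonneg (score f (D i) θhat)) h.fourth_moment_le
    have h5 := h3.trans (mul_le_mul_of_nonneg_left h4 (by positivity))
    gcongr
  · simp only [hin, neg_sq]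
    have hvar : ∫ i, (drawWeight f ξ r D p i * inner ℝ (score f (D i) θhat) (W' t)
        - inner ℝ μ (W' t)) ^ 2 ∂(drawLaw f ξ D p)
        = ((n : ℝ) ^ 2)⁻¹ * ∑ i ∈ censIdx D, (mixProb f ξ D p i)⁻¹
          * inner ℝ (score f (D i) θhat) (W' t) ^ 2 - inner ℝ μ (W' t) ^ 2 := by
      rw [← integral_drawWeight_sq f hξ p hr]
      have e : ∀ i, (drawWeight f ξ r D p i * inner ℝ (score f (D i) θhat) (W' t)
          - inner ℝ μ (W' t)) ^ 2
          = (drawWeight f ξ r D p i * inner ℝ (score f (D i) θhat) (W' t)) ^ 2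
            - 2 * inner ℝ μ (W' t) * (drawWeight f ξ r D p i
              * inner ℝ (score f (D i) θhat) (W' t)) + inner ℝ μ (W' t) ^ 2 := fun i => by ring
      simp only [e]
      rw [integral_add Integrable.of_finite Integrable.of_finite,
        integral_sub Integrable.of_finite Integrable.of_finite, integral_const_mul, hmean]
      simp only [integral_const, probReal_univ, one_smul]
      ring
    have hq := hquad t
    rw [inner_covLambda] at hq
    have hμu : (n : ℝ)⁻¹ * ∑ i ∈ censIdx D, inner ℝ (score f (D i) θhat) (W' t)
        = inner ℝ μ (W' t) := by rw [hμ, real_inner_smul_left, sum_inner]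
    rw [hμu] at hq
    rw [hvar, ← hq]
    have hfl := scoreFloor_pos hK hc hξ0
    -- Weighted draws are unbiased whatever the sampling probabilities, so the squared means at the
    -- pilot and at the full-data estimate agree and only the second moments need comparison.
    have hdiff := abs_secondMoment_sub_le hΘ hξ h.dominated h.argmax.1 h.pilot_mem
      (half_pos hfl) h.mean_sq_le h.fourth_moment_le
      (by linarith [h.floor_le hd hξ hc]) (h.floor_le_pilot hη hΘ hd hξ hc) (W' t)
    rw [sub_sub_sub_cancel_right, hq]
    refine hdiff.trans ?_
    have hu : ‖W' t‖ ^ 2 ≤ ‖t‖ ^ 2 / c := by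
      refine (pow_le_pow_left₀ (norm_nonneg _) (hW' t) 2).trans (le_of_eq ?_)
      rw [div_pow, Real.sq_sqrt hc.le]
    calc _ ≤ (ξ ^ 2)⁻¹ * (2 * K / (scoreFloor K c ξ / 2)
          + (1 + K) ^ 2 / (scoreFloor K c ξ / 2) ^ 2) * η * (‖t‖ ^ 2 / c) := by
          have := h.pilot_close
          have := hη.pos
          gcongr
      _ = _ := by rw [covRate]; ring
  · have hlin := h.norm_linearization_le hη hΘ hξ hc hτ I hH hG ha
    have hm : ((r - numUncens D : ℕ) : ℝ) ≠ 0 := by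
      have := h.draws_pos hη
      positivity
    -- Because the full-data score vanishes at `θhat`, the uncensored data contribute exactly minus
    -- the centring term, and the normalized sum is -√r W applied to the whole subsample gradient.
    have hsum : (√(r : ℝ) / ((r - numUncens D : ℕ) : ℝ)) • ∑ j,
        -W (drawWeight f ξ r D p (I j) • score f (D (I j)) θhat - μ)
        = -(√(r : ℝ) • W (∑ i, subWeight f ξ r D p I i • score f (subObs D I i) θhat)) := by
      have e1 := sum_subWeight_smul_sub f ξ r D p I fun x => score f x θhat
      rw [h.sum_score_eq_zero hρ, sub_zero] at e1
      rw [e1, Finset.sum_neg_distrib, ← map_sum, Finset.sum_sub_distrib, smul_neg, neg_inj,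
        div_eq_mul_inv, mul_smul, ← map_smul, smul_sub]
      congr 3
      rw [Finset.sum_const, Finset.card_univ, Fintype.card_fin, ← Nat.cast_smul_eq_nsmul ℝ,
        smul_smul, inv_mul_cancel₀ hm, one_smul]
    rw [hsum, covV, hstd, sub_neg_eq_add, ← smul_add, ← map_add, norm_smul,
      Real.norm_of_nonneg (Real.sqrt_nonneg _)]
    gcongr
    refine (hW _).trans ?_
    gcongr

/-- Conditional asymptotic normality along a sequence of good samples. -/
theorem tendsto_of_goodSample {f : ℝ → Param d → ℝ} {Θ : Set (Param d)} {ξ : ℝ} {B : Obs → ℝ}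
    {K c ρ : ℝ} (hcomp : IsCompact Θ) (hΘ : Convex ℝ Θ) (hd : 0 < d) (hξ : 0 < ξ ∧ ξ < 1)
    (hc : 0 < c) (hρ : 0 < ρ) {n r : ℕ → ℕ} {D : ∀ k, Fin (n k) → Obs} {θhat p : ℕ → Param d}
    {θt : ∀ k, (Fin (r k - numUncens (D k)) → Fin (n k)) → Param d} {η : ℕ → ℝ}
    (hη : Tendsto η atTop (𝓝 0)) (hsmall : ∀ k, SmallTol K c ξ (η k))
    (h : ∀ k, GoodSample f Θ ξ B K c ρ (η k) (r k) (D k) (θhat k) (p k) (θt k))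
    (g : BoundedContinuousFunction (Param d) ℝ) :
    Tendsto (fun k => ∫ I, g (stdError (r k) (covV f ξ (D k) (θhat k)) (θt k I) (θhat k))
      ∂(subsampleLaw f ξ (r k) (D k) (p k))) atTop (𝓝 (∫ z, g z ∂(stdGaussian (Param d)))) := by
  have hK : 0 ≤ K := (h 0).nonneg_bound
  have hξ0 := hξ.1
  have hdR : (0 : ℝ) < d := by exact_mod_cast hd
  have hprob : ∀ k, IsProbabilityMeasure (drawLaw f ξ (D k) (p k)) := fun k =>
    (h k).isProbabilityMeasure (hsmall k) hΘ hd hξ hc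
  choose Y hY0 hY3 hY2 hYlin using fun k => (h k).exists_summand (hsmall k) hΘ hd hξ hc hρ
  set m : ℕ → ℕ := fun k => r k - numUncens (D k) with hm_def
  have hr_top : Tendsto (fun k => (r k : ℝ)) atTop atTop := by
    refine tendsto_atTop_mono (fun k => (h k).inv_le) ?_
    refine Tendsto.inv_tendsto_nhdsGT_zero (tendsto_nhdsWithin_iff.2 ⟨hη, ?_⟩)
    exact Eventually.of_forall fun k => (hsmall k).pos
  have hmR_top : Tendsto (fun k => (m k : ℝ)) atTop atTop :=
    tendsto_atTop_mono (fun k => (h k).half_le (hsmall k)) (hr_top.atTop_div_const two_pos)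
  have hm_top : Tendsto m atTop atTop := tendsto_natCast_atTop_iff.1 hmR_top
  have hm_pos : ∀ k, (0 : ℝ) < m k := fun k => by exact_mod_cast (h k).draws_pos (hsmall k)
  -- The quantity is r/m, squeezed between 1 and 1/(1 - η). This is where a vanishing fraction n₀/r
  -- is needed: scaling by √r instead of √m is then harmless.
  have hs : Tendsto (fun k => m k * (√(r k : ℝ) / m k) ^ 2) atTop (𝓝 1) := by
    have e : ∀ k, m k * (√(r k : ℝ) / m k) ^ 2 = r k / m k := by
      intro k
      have := (hm_pos k).ne'
      rw [div_pow, Real.sq_sqrt (Nat.cast_nonneg _)]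
      field_simp
    simp only [e]
    have hup : Tendsto (fun k => (1 - η k)⁻¹) atTop (𝓝 1) := by
      have := (hη.const_sub 1).inv₀ (by norm_num)
      simpa using this
    refine tendsto_of_tendsto_of_tendsto_of_le_of_le tendsto_const_nhds hup (fun k => ?_)
      fun k => ?_
    · simp only
      rw [le_div_iff₀ (hm_pos k), one_mul]
      exact_mod_cast Nat.sub_le _ _
    · simp only
      have h1 : 0 < 1 - η k := by linarith [(hsmall k).le_half]
      rw [div_le_iff₀ (hm_pos k), inv_mul_eq_div, le_div_iff₀ h1, mul_comm]
      exact (h k).draws_ge (hsmall k)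
  -- Given the data, the draws live in a finite discrete space, so measurability and integrability
  -- are automatic and the estimators need no measurability.
  refine tendsto_integral_of_array (ν := fun k => drawLaw f ξ (D k) (p k)) (Y := Y) (m := m)
    (s := fun k => √(r k : ℝ) / m k) (K := cubeBound K c ξ)
    (X := fun k I => stdError (r k) (covV f ξ (D k) (θhat k)) (θt k I) (θhat k))
    (fun k => measurable_of_countable _) (fun k => measurable_of_countable _)
    (fun k => MemLp.of_discrete) hY0 hY3 (fun t => ?_) hm_top hs (fun τ' hτ' => ?_) g
  · rw [tendsto_iff_norm_sub_tendsto_zero]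
    refine squeeze_zero (fun k => norm_nonneg _) (fun k => hY2 k t) ?_
    have := (hη.const_mul (covRate K c ξ)).mul_const (‖t‖ ^ 2)
    simpa using this
  · rw [Metric.tendsto_atTop]
    intro δ hδ
    -- For the gradient level a = A/√m the Chebyshev bound equals C/A², which is at most δ/3 for A =
    -- 1 + 3C/δ since A ≤ A². The tolerance τ is then chosen so that, with √r ≤ 2√m, the limiting
    -- linearization error 4Aτ/(c√c) is at most τ'/2.
    set C : ℝ := d * (ξ⁻¹ * (1 + K)) * d ^ 2 with hC
    have hC0 : 0 < C := by positivity
    set A : ℝ := 1 + 3 * C / δ with hA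
    have hA1 : 1 ≤ A := by
      have : 0 ≤ 3 * C / δ := by positivity
      linarith
    have hA0 : 0 < A := by linarith
    have hsc : 0 < √c := Real.sqrt_pos.2 hc
    set τ : ℝ := min (c / 2) (τ' * (c * √c) / (8 * A)) with hτ_def
    have hτ0 : 0 < τ := lt_min (by positivity) (by positivity)
    obtain ⟨N, hN⟩ := exists_measureReal_hess_le (f := f) (B := B) (ρ := ρ) hcomp hΘ hd hξ hc hK
      hτ0 (by positivity : 0 < δ / 3)
    have ha0 : Tendsto (fun k => A / √(m k : ℝ)) atTop (𝓝 0) :=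
      tendsto_const_nhds.div_atTop (Real.tendsto_sqrt_atTop.comp hmR_top)
    have hρlim : Tendsto (fun k => 2 * (A / √(m k : ℝ)) / c) atTop (𝓝 0) := by
      simpa using (ha0.const_mul 2).div_const c
    have hblim : Tendsto (fun k => (τ + (1 + K) * (2 * (A / √(m k : ℝ)) / c)) * (4 * A / c) / √c)
        atTop (𝓝 ((τ + (1 + K) * 0) * (4 * A / c) / √c)) :=
      (((hρlim.const_mul (1 + K)).const_add τ).mul_const _).div_const _
    have hblt : (τ + (1 + K) * 0) * (4 * A / c) / √c < τ' := by
      have h1 : τ ≤ τ' * (c * √c) / (8 * A) := min_le_right _ _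
      have h2 : τ * (4 * A / c) / √c ≤ τ' * (c * √c) / (8 * A) * (4 * A / c) / √c := by gcongr
      have h3 : τ' * (c * √c) / (8 * A) * (4 * A / c) / √c = τ' / 2 := by field_simp; norm_num
      rw [mul_zero, add_zero]
      linarith
    obtain ⟨k₀, hk₀⟩ := eventually_atTop.1 ((hmR_top.eventually_ge_atTop N).and
      ((hρlim.eventually_lt_const hρ).and (hblim.eventually_lt_const hblt)))
    refine ⟨k₀, fun k hk => ?_⟩
    obtain ⟨hk1, hk2, hk3⟩ := hk₀ k hk
    have hP : IsProbabilityMeasure (subsampleLaw f ξ (r k) (D k) (p k)) := by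
      unfold subsampleLaw; infer_instance
    have hsm : 0 < √(m k : ℝ) := Real.sqrt_pos.2 (hm_pos k)
    rw [Real.dist_eq, sub_zero, abs_of_nonneg measureReal_nonneg]
    have hsub : {I : Fin (m k) → Fin (n k) |
        τ' < ‖stdError (r k) (covV f ξ (D k) (θhat k)) (θt k I) (θhat k)
          - (√(r k : ℝ) / m k) • ∑ j, Y k (I j)‖}
        ⊆ {I | ¬ ∀ θ ∈ Θ, ‖∑ i, subWeight f ξ (r k) (D k) (p k) I i • hessL f (subObs (D k) I i) θ
            - ∑ i, (n k : ℝ)⁻¹ • hessL f (D k i) θ‖ ≤ τ}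
          ∪ {I | A / √(m k : ℝ) ≤ ‖∑ i, subWeight f ξ (r k) (D k) (p k) I i
            • score f (subObs (D k) I i) (θhat k)‖} := by
      intro I hI
      by_contra hcon
      simp only [Set.mem_union, Set.mem_ofPred_eq, not_or, not_not, not_le] at hcon
      have hb := hYlin k I τ (A / √(m k : ℝ)) (min_le_left _ _) hk2 hcon.1 hcon.2.le
      have hsr : √(r k : ℝ) ≤ 2 * √(m k : ℝ) := by
        rw [Real.sqrt_le_left (by positivity), mul_pow, Real.sq_sqrt (hm_pos k).le]
        have : (r k : ℝ) / 2 ≤ m k := (h k).half_le (hsmall k)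
        have := hm_pos k
        linarith
      have hb2 : √(r k : ℝ) * ((τ + (1 + K) * (2 * (A / √(m k : ℝ)) / c))
          * (2 * (A / √(m k : ℝ)) / c) / √c)
          ≤ (τ + (1 + K) * (2 * (A / √(m k : ℝ)) / c)) * (4 * A / c) / √c := by
        calc _ ≤ 2 * √(m k : ℝ) * ((τ + (1 + K) * (2 * (A / √(m k : ℝ)) / c))
          * (2 * (A / √(m k : ℝ)) / c) / √c) := by gcongr
          _ = _ := by
            generalize τ + (1 + K) * (2 * (A / √(m k : ℝ)) / c) = z
            field_simp
            ring
      exact absurd (show τ' < _ from hI) (not_lt.2 ((hb.trans hb2).trans hk3.le))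
    refine lt_of_le_of_lt ((measureReal_mono (μ := subsampleLaw f ξ (r k) (D k) (p k))
      hsub).trans (measureReal_union_le _ _)) ?_
    have h1 := hN (h k) (hsmall k) hk1
    have h2 := (h k).measureReal_gradient_ge_le (hsmall k) hΘ hd hξ hc hρ
      (a := A / √(m k : ℝ)) (by positivity)
    have h3 : d * (ξ⁻¹ * (1 + K) / ((m k : ℝ) * (A / √(m k : ℝ) / d) ^ 2)) ≤ δ / 3 := by
      have e : d * (ξ⁻¹ * (1 + K) / ((m k : ℝ) * (A / √(m k : ℝ) / d) ^ 2)) = C / A ^ 2 := by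
        rw [div_pow, div_pow, Real.sq_sqrt (hm_pos k).le, hC]
        have := (hm_pos k).ne'
        field_simp
      rw [e, div_le_iff₀ (by positivity)]
      have : A ≤ A ^ 2 := by nlinarith
      have h4 : δ / 3 * (3 * C / δ) = C := by field_simp
      have h5 : δ / 3 * (3 * C / δ) ≤ δ / 3 * A ^ 2 := by gcongr; linarith
      linarith
    have := h2.trans h3
    linarith

end RDCS

/-! ### Probability of good samples, consistency, and uniformity. -/

namespace RDCS

/-! ### Events with probability tending to one -/

/-- The event `p n` has (inner) probability tending to one. -/
def HighProb {Ω : ℕ → Type*} [∀ n, MeasurableSpace (Ω n)] (μ : ∀ n, Measure (Ω n))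
    (p : ∀ n, Ω n → Prop) : Prop :=
  Tendsto (fun n => μ n {ω | ¬ p n ω}) atTop (𝓝 0)

namespace HighProb

variable {Ω : ℕ → Type*} [∀ n, MeasurableSpace (Ω n)] {μ : ∀ n, Measure (Ω n)}
  {p q : ∀ n, Ω n → Prop}

theorem of_measure_le {u : ℕ → ENNReal} (hu : Tendsto u atTop (𝓝 0))
    (h : ∀ᶠ n in atTop, μ n {ω | ¬ p n ω} ≤ u n) : HighProb μ p :=
  tendsto_of_tendsto_of_tendsto_of_le_of_le' tendsto_const_nhds hu
    (Eventually.of_forall fun _ => zero_le) h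

theorem of_eventually_ae (h : ∀ᶠ n in atTop, ∀ᵐ ω ∂(μ n), p n ω) : HighProb μ p :=
  of_measure_le tendsto_const_nhds (h.mono fun _ hn => (ae_iff.1 hn).le)

theorem mono (h : HighProb μ p) (hpq : ∀ n ω, p n ω → q n ω) : HighProb μ q :=
  of_measure_le h (Eventually.of_forall fun n => measure_mono fun ω hω hp => hω (hpq n ω hp))

theorem and (hp : HighProb μ p) (hq : HighProb μ q) : HighProb μ fun n ω => p n ω ∧ q n ω := by
  have h : Tendsto (fun n => μ n {ω | ¬ p n ω} + μ n {ω | ¬ q n ω}) atTop (𝓝 0) := by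
    simpa using Tendsto.add (show Tendsto _ _ _ from hp) (show Tendsto _ _ _ from hq)
  refine of_measure_le h (Eventually.of_forall fun n => ?_)
  refine (measure_mono fun ω hω => ?_).trans (measure_union_le _ _)
  exact not_and_or.1 hω

theorem finset_forall {κ : Type*} (s : Finset κ) {p : κ → ∀ n, Ω n → Prop}
    (h : ∀ t ∈ s, HighProb μ (p t)) : HighProb μ fun n ω => ∀ t ∈ s, p t n ω := by
  have h' : Tendsto (fun n => ∑ t ∈ s, μ n {ω | ¬ p t n ω}) atTop (𝓝 0) := by
    have := tendsto_finsetSum s h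
    simpa using this
  refine of_measure_le h' (Eventually.of_forall fun n => ?_)
  refine (measure_mono fun ω hω => ?_).trans (measure_biUnion_finset_le _ _)
  have hω : ¬ ∀ t ∈ s, p t n ω := hω
  push Not at hω
  obtain ⟨t, ht, hpt⟩ := hω
  exact Set.mem_biUnion ht hpt

end HighProb

theorem tendsto_ofReal_div_natCast_mul {m : ℕ → ℕ} (hm : Tendsto m atTop atTop) (a : ℝ) {b : ℝ}
    (hb : 0 < b) : Tendsto (fun n => ENNReal.ofReal (a / (m n * b))) atTop (𝓝 0) := by
  have h1 : Tendsto (fun n => (m n : ℝ) * b) atTop atTop :=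
    (tendsto_natCast_atTop_atTop.comp hm).atTop_mul_const hb
  simpa using ENNReal.tendsto_ofReal (tendsto_const_nhds (x := a).div_atTop h1)

/-! ### Consistency of maximizers of average log-likelihoods -/

variable {d : ℕ}

section Consistency

variable {f : ℝ → Param d → ℝ} {Θ : Set (Param d)} {P : Measure Obs} [IsProbabilityMeasure P]
  {B : Obs → ℝ} {Ω : ℕ → Type*} [∀ n, MeasurableSpace (Ω n)] {μ : ∀ n, Measure (Ω n)}
  {m : ℕ → ℕ} {x : ∀ n, Ω n → Fin (m n) → Obs}

/-- The average Hessians converge uniformly in probability. -/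
theorem highProb_norm_hess_sub_le (hd : 0 < d) (hcomp : IsCompact Θ) (hhess : HessianCondition f Θ P)
    (hB : MemLp B 2 P) (hB0 : ∀ x, 0 ≤ B x) (hdom : ∀ᵐ x ∂P, Dominated f Θ (B x) x)
    (hdomx : HighProb μ fun n ω => ∀ i, Dominated f Θ (B (x n ω i)) (x n ω i))
    (hlln : ∀ φ : Obs → ℝ, MemLp φ 2 P → ∀ τ : ℝ, 0 < τ → HighProb μ fun n ω =>
      |(m n : ℝ)⁻¹ * ∑ i, φ (x n ω i) - ∫ x, φ x ∂P| < τ) {τ : ℝ} (hτ : 0 < τ) :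
    HighProb μ fun n ω => ∀ θ ∈ Θ,
      ‖∑ i, (m n : ℝ)⁻¹ • hessL f (x n ω i) θ - popHess f P θ‖ ≤ τ := by
  have hdR : (0 : ℝ) < d := by exact_mod_cast hd
  set b : ℝ := ∫ x, B x ∂P with hb
  have hb0 : 0 ≤ b := integral_nonneg hB0
  set κ : ℝ := τ / (2 * ((b + 1) + d ^ 2 * b)) with hκ
  have hκ0 : 0 < κ := by positivity
  obtain ⟨T, hTΘ, hT⟩ := exists_finite_net hcomp hκ0
  set e : ℝ := τ / (2 * (d * d)) with he
  have he0 : 0 < e := by positivity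
  -- The law of large numbers is invoked only for finitely many integrands, the Hessian entries at
  -- net points; the Lipschitz bounds extend it to all of `Θ`.
  have hent := HighProb.finset_forall T fun t ht =>
    HighProb.finset_forall (Finset.univ : Finset (Fin d)) fun j _ =>
      HighProb.finset_forall (Finset.univ : Finset (Fin d)) fun k _ =>
        hlln (fun x => hess f x t j k) (hhess.memLp_hess t (hTΘ ht) j k) e he0
  refine ((hdomx.and (hlln B hB 1 one_pos)).and hent).mono ?_
  rintro n ω ⟨⟨hD, hmB⟩, hH⟩
  have hl1 : ∑ i, (m n : ℝ)⁻¹ * B (x n ω i) ≤ b + 1 := by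
    rw [← Finset.mul_sum]
    linarith [(abs_lt.1 hmB).2]
  have hnet := norm_sub_le_of_net (K₁ := b + 1) (K₂ := d ^ 2 * b) (τ := τ / 2) (κ := κ)
    (H₁ := fun θ => ∑ i, (m n : ℝ)⁻¹ • hessL f (x n ω i) θ)
    (H₂ := popHess f P) hTΘ hT (by positivity) (by positivity)
    (fun θ hθ θ' hθ' => (norm_sum_hessL_sub_le (fun _ => by positivity) hD hθ hθ').trans
      (mul_le_mul_of_nonneg_right hl1 (norm_nonneg _)))
    (fun θ hθ θ' hθ' => norm_popHess_sub_le hhess hB hdom hθ hθ')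
    (fun t ht => by
      refine (opNorm_le_sum_entries _).trans ?_
      calc _ ≤ ∑ _j : Fin d, ∑ _k : Fin d, e := by
            refine Finset.sum_le_sum fun j _ => Finset.sum_le_sum fun k _ => ?_
            rw [sub_apply, PiLp.sub_apply,
              sum_hessL_apply _ _ fun i => (hD i).smooth t (hTΘ ht), popHess,
              apply_single_toEuclideanCLM, Matrix.of_apply, ← Finset.mul_sum]
            exact (hH t ht j (Finset.mem_univ _) k (Finset.mem_univ _)).le
        _ = τ / 2 := by
            simp only [Finset.sum_const, Finset.card_univ, Fintype.card_fin, nsmul_eq_mul, he]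
            field_simp)
  intro θ hθ
  refine (hnet θ hθ).trans (le_of_eq ?_)
  have : b + 1 + d ^ 2 * b ≠ 0 := by positivity
  rw [hκ]
  field_simp
  ring

/-- The average Hessians are uniformly negative definite with probability tending to one. -/
theorem highProb_inner_hess_le (hd : 0 < d) (hcomp : IsCompact Θ) (hhess : HessianCondition f Θ P)
    (hB : MemLp B 2 P) (hB0 : ∀ x, 0 ≤ B x) (hdom : ∀ᵐ x ∂P, Dominated f Θ (B x) x)
    (hdomx : HighProb μ fun n ω => ∀ i, Dominated f Θ (B (x n ω i)) (x n ω i))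
    (hlln : ∀ φ : Obs → ℝ, MemLp φ 2 P → ∀ τ : ℝ, 0 < τ → HighProb μ fun n ω =>
      |(m n : ℝ)⁻¹ * ∑ i, φ (x n ω i) - ∫ x, φ x ∂P| < τ) {c : ℝ} (hc : 0 < c)
    (hpop : ∀ θ ∈ Θ, ∀ v, inner ℝ (popHess f P θ v) v ≤ -(2 * c) * ‖v‖ ^ 2) :
    HighProb μ fun n ω => ∀ θ ∈ Θ, ∀ v,
      inner ℝ ((∑ i, (m n : ℝ)⁻¹ • hessL f (x n ω i) θ) v) v ≤ -c * ‖v‖ ^ 2 := by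
  refine (highProb_norm_hess_sub_le hd hcomp hhess hB hB0 hdom hdomx hlln hc).mono ?_
  intro n ω h θ hθ v
  have := inner_le_of_norm_sub_le (h θ hθ) (hpop θ hθ) v
  rwa [two_mul, add_sub_cancel_right] at this

/-- The maximizers of average log-likelihoods are consistent. -/
theorem highProb_norm_argmax_sub_le (hd : 0 < d) (hcomp : IsCompact Θ) (hΘ : Convex ℝ Θ)
    (hhess : HessianCondition f Θ P)
    (hB : MemLp B 2 P) (hB0 : ∀ x, 0 ≤ B x) (hdom : ∀ᵐ x ∂P, Dominated f Θ (B x) x)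
    (hdomx : HighProb μ fun n ω => ∀ i, Dominated f Θ (B (x n ω i)) (x n ω i))
    (hlln : ∀ φ : Obs → ℝ, MemLp φ 2 P → ∀ τ : ℝ, 0 < τ → HighProb μ fun n ω =>
      |(m n : ℝ)⁻¹ * ∑ i, φ (x n ω i) - ∫ x, φ x ∂P| < τ) {c : ℝ} (hc : 0 < c)
    (hpop : ∀ θ ∈ Θ, ∀ v, inner ℝ (popHess f P θ v) v ≤ -(2 * c) * ‖v‖ ^ 2)
    {θ₀ : Param d} (h₀ : θ₀ ∈ Θ) (hmem : ∀ j, MemLp (fun x => score f x θ₀ j) 2 P)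
    (hzero : ∀ j, ∫ x, score f x θ₀ j ∂P = 0) {τ : ℝ} (hτ : 0 < τ) :
    HighProb μ fun n ω => ∀ θs,
      IsArgmax (fun θ => (m n : ℝ)⁻¹ * ∑ i, logLik f (x n ω i) θ) Θ θs → ‖θs - θ₀‖ ≤ τ := by
  have hdR : (0 : ℝ) < d := by exact_mod_cast hd
  have hs := HighProb.finset_forall (Finset.univ : Finset (Fin d)) fun j _ =>
    hlln (fun x => score f x θ₀ j) (hmem j) (c * τ / d) (by positivity)
  refine ((hdomx.and (highProb_inner_hess_le hd hcomp hhess hB hB0 hdom hdomx hlln hc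
    hpop)).and hs).mono ?_
  rintro n ω ⟨⟨hD, hH⟩, hS⟩ θs hθs
  simp only [Finset.mul_sum] at hθs
  -- Consistency without comparing criterion values: the maximizer is as close to `θ₀` as the
  -- average score at `θ₀` is to its expectation 0, up to the concavity constant.
  have h1 := mul_norm_sub_le_of_strongConcave hΘ
    (fun θ hθ => hasGradientAt_sum_logLik (fun _ => (m n : ℝ)⁻¹) (x n ω)
      fun i => (hD i).smooth θ hθ)
    (fun θ hθ => hasFDerivAt_sum_score (fun _ => (m n : ℝ)⁻¹) (x n ω)
      fun i => (hD i).smooth θ hθ) hH hθs h₀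
  have h2 : ‖∑ i, (m n : ℝ)⁻¹ • score f (x n ω i) θ₀‖ ≤ c * τ := by
    have hle : ‖∑ i, (m n : ℝ)⁻¹ • score f (x n ω i) θ₀‖
        ≤ ∑ j, |(∑ i, (m n : ℝ)⁻¹ • score f (x n ω i) θ₀) j| :=
      norm_le_sum_abs _
    refine hle.trans ?_
    calc _ ≤ ∑ _j : Fin d, c * τ / d := by
          refine Finset.sum_le_sum fun j _ => ?_
          have := (hS j (Finset.mem_univ _)).le
          rw [hzero, sub_zero, Finset.mul_sum] at this
          simpa using this
      _ = c * τ := by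
          simp only [Finset.sum_const, Finset.card_univ, Fintype.card_fin, nsmul_eq_mul]
          field_simp
  exact le_of_mul_le_mul_left (h1.trans h2) hc

end Consistency

/-! ### Averages over the data and over the pilot sample -/

/-- The product formula for rectangles needs no measurability, so this applies to the events in the
assumptions, which involve arbitrary choices of estimators. -/
theorem measure_prod_fst_le {P : Measure Obs} {n k : ℕ} (hn : 0 < n) (S : Set (Fin n → Obs)) :
    ((dataLaw P n).prod (pilotLaw n k)) {ω | ω.1 ∈ S} ≤ dataLaw P n S := by
  have := isProbabilityMeasure_pilotLaw hn k
  have e : {ω : (Fin n → Obs) × (Fin k → Fin n) | ω.1 ∈ S} = S ×ˢ Set.univ := by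
    ext ω
    simp
  rw [e, Measure.prod_prod, measure_univ, mul_one]

section Averages

variable {P : Measure Obs} [IsProbabilityMeasure P] {r₀ : ℕ → ℕ}

theorem highProb_full_mean {φ : Obs → ℝ} (hφ : MemLp φ 2 P) {τ : ℝ} (hτ : 0 < τ) :
    HighProb (fun n => (dataLaw P n).prod (pilotLaw n (r₀ n))) fun n ω =>
      |(n : ℝ)⁻¹ * ∑ i, φ (ω.1 i) - ∫ x, φ x ∂P| < τ := by
  refine .of_measure_le (tendsto_ofReal_div_natCast_mul tendsto_id (∫ x, φ x ^ 2 ∂P)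
    (b := τ ^ 2) (by positivity)) ?_
  filter_upwards [eventually_gt_atTop 0] with n hn
  refine le_trans ?_ (measure_pi_mean_sub_ge_le hφ hn hτ)
  simp only [not_lt]
  exact measure_prod_fst_le hn _

theorem highProb_pilot_mean (hr₀ : Tendsto r₀ atTop atTop) {φ : Obs → ℝ} (hφ : MemLp φ 2 P)
    {τ : ℝ} (hτ : 0 < τ) :
    HighProb (fun n => (dataLaw P n).prod (pilotLaw n (r₀ n))) fun n ω =>
      |(r₀ n : ℝ)⁻¹ * ∑ j, φ (ω.1 (ω.2 j)) - ∫ x, φ x ∂P| < τ := by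
  have hlim := (tendsto_ofReal_div_natCast_mul hr₀ (∫ x, φ x ^ 2 ∂P)
    (b := (τ / 2) ^ 2) (by positivity)).add (tendsto_ofReal_div_natCast_mul tendsto_id
      (∫ x, φ x ^ 2 ∂P) (b := (τ / 2) ^ 2) (by positivity))
  rw [add_zero] at hlim
  refine .of_measure_le hlim ?_
  filter_upwards [eventually_gt_atTop 0, hr₀.eventually_gt_atTop 0] with n hn hrn
  refine le_trans (measure_mono fun ω hω => ?_)
    (measure_pilot_mean_sub_ge_le hn hrn hφ (half_pos hτ))
  change 2 * (τ / 2) ≤ _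
  rw [mul_div_cancel₀ _ two_ne_zero]
  exact not_lt.1 hω

end Averages

/-! ### Uniformity over good samples -/

theorem SmallTol.mono {K c ξ η η' : ℝ} (h : SmallTol K c ξ η) (hK : 0 ≤ K) (h0 : 0 < η')
    (hle : η' ≤ η) : SmallTol K c ξ η' where
  pos := h0
  le_half := hle.trans h.le_half
  mul_le := le_trans (by gcongr) h.mul_le

theorem exists_smallTol {K c ξ : ℝ} (hK : 0 ≤ K) (hc : 0 < c) (hξ : 0 < ξ) :
    ∃ η, SmallTol K c ξ η := by
  have hfl := scoreFloor_pos hK hc hξ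
  refine ⟨min (1 / 2) (scoreFloor K c ξ / 2 / (1 + K)), lt_min (by norm_num) (by positivity),
    min_le_left _ _, ?_⟩
  refine (mul_le_mul_of_nonneg_left (min_le_right _ _) (by positivity)).trans (le_of_eq ?_)
  field_simp

/-- The normal approximation holds uniformly over good samples. -/
theorem exists_forall_goodSample {f : ℝ → Param d → ℝ} {Θ : Set (Param d)} {ξ : ℝ} {B : Obs → ℝ}
    {K c ρ : ℝ} (hcomp : IsCompact Θ) (hΘ : Convex ℝ Θ) (hd : 0 < d) (hξ : 0 < ξ ∧ ξ < 1)
    (hc : 0 < c) (hρ : 0 < ρ) (hK : 0 ≤ K) (g : BoundedContinuousFunction (Param d) ℝ) {ε : ℝ}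
    (hε : 0 < ε) :
    ∃ η : ℝ, 0 < η ∧ ∀ (n r : ℕ) (D : Fin n → Obs) (θhat p : Param d)
      (θt : (Fin (r - numUncens D) → Fin n) → Param d),
      GoodSample f Θ ξ B K c ρ η r D θhat p θt →
      |∫ I, g (stdError r (covV f ξ D θhat) (θt I) θhat) ∂(subsampleLaw f ξ r D p)
        - ∫ z, g z ∂(stdGaussian (Param d))| < ε := by
  -- Failure at every tolerance gives a sequence of good samples with η → 0 whose approximation
  -- errors stay above ε, against the sequential limit theorem. The sizes n and r are free along the
  -- sequence; `inv_le` forces r → ∞.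
  by_contra hcon
  push Not at hcon
  obtain ⟨η₀, hη₀⟩ := exists_smallTol hK hc hξ.1
  have hpos : ∀ k : ℕ, 0 < η₀ / ((k : ℝ) + 1) := fun k => div_pos hη₀.pos (by positivity)
  choose n r D θhat p θt hgood hge using fun k : ℕ => hcon (η₀ / ((k : ℝ) + 1)) (hpos k)
  have hlim : Tendsto (fun k : ℕ => η₀ / ((k : ℝ) + 1)) atTop (𝓝 0) :=
    tendsto_const_nhds.div_atTop (tendsto_natCast_atTop_atTop.atTop_add tendsto_const_nhds)
  have h := tendsto_of_goodSample hcomp hΘ hd hξ hc hρ hlim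
    (fun k => hη₀.mono hK (hpos k) (div_le_self hη₀.pos.le (by
      have : (0 : ℝ) ≤ k := by positivity
      linarith))) hgood g
  obtain ⟨k, hk⟩ := (Metric.tendsto_nhds.1 h ε hε).exists
  rw [Real.dist_eq] at hk
  exact absurd hk (not_lt.2 (hge k))

theorem posSemidef_sub_smul_of_le {A : Matrix (Fin d) (Fin d) ℝ} {c c' : ℝ}
    (h : (A - c • 1).PosSemidef) (hle : c' ≤ c) : (A - c' • 1).PosSemidef := by
  have h1 := h.add ((Matrix.PosSemidef.one (n := Fin d) (R := ℝ)).smul (sub_nonneg.2 hle))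
  rwa [sub_smul, sub_add_sub_cancel] at h1

end RDCS

/-! ### The main theorem: bad samples have vanishing probability. -/

theorem proposition2 (d : ℕ) (hd : 0 < d)
    (f : ℝ → RDCS.Param d → ℝ) (Θ : Set (RDCS.Param d))
    (P : Measure RDCS.Obs) [IsProbabilityMeasure P]
    (ξ : ℝ) (hξ : 0 < ξ ∧ ξ < 1)
    -- pilot size and subsample size as functions of the size `n` of the full data
    (r₀ r : ℕ → ℕ)
    -- the full-data MLE, the pilot estimate and the RDCS estimate
    (θhat : ∀ n, (Fin n → RDCS.Obs) → RDCS.Param d)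
    (θpilot : ∀ n, (Fin n → RDCS.Obs) → (Fin (r₀ n) → Fin n) → RDCS.Param d)
    (θtilde : ∀ n (D : Fin n → RDCS.Obs), RDCS.Param d →
      (Fin (r n - RDCS.numUncens D) → Fin n) → RDCS.Param d)
    (hθhat : ∀ n, ∀ᵐ D ∂(RDCS.dataLaw P n),
      RDCS.IsArgmax (RDCS.fullLogLik f D) Θ (θhat n D))
    (hθpilot : ∀ n, ∀ᵐ D ∂(RDCS.dataLaw P n), ∀ J,
      RDCS.IsArgmax (RDCS.pilotLogLik f D J) Θ (θpilot n D J))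
    (hθtilde : ∀ n, ∀ᵐ D ∂(RDCS.dataLaw P n), ∀ J I,
      RDCS.IsArgmax (RDCS.subsampleLogLik f ξ (r n) D (θpilot n D J) I) Θ
        (θtilde n D (θpilot n D J) I))
    -- model and assumptions
    (hmodel : RDCS.LifetimeModel f Θ P)
    (hmle : RDCS.UniqueMLE f Θ P θhat)
    (hhess : RDCS.HessianCondition f Θ P)
    (hscore : RDCS.ScoreCondition f Θ P θhat)
    -- the (true) parameter, which maximizes the expected log-likelihood, is interior
    (hinterior : ∃ θ₀ ∈ interior Θ, IsMaxOn (fun θ => ∫ x, RDCS.logLik f x θ ∂P) Θ θ₀)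
    (hcov : RDCS.NondegenerateCov f ξ P θhat)
    -- `r₀, r, n → ∞` and `n₀ / r → 0` in probability
    (hr₀ : Tendsto r₀ atTop atTop) (hr : Tendsto r atTop atTop)
    (hn₀ : ∀ ε : ℝ, 0 < ε → Tendsto (fun n => RDCS.dataLaw P n
      {D | ε ≤ (RDCS.numUncens D : ℝ) / r n}) atTop (𝓝 0)) :
    -- the conditional law of the standardized error, given the full data and the pilot estimate,
    -- converges weakly to `N(0, I)`, in probability
    ∀ g : BoundedContinuousFunction (RDCS.Param d) ℝ, ∀ ε : ℝ, 0 < ε →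
      Tendsto (fun n => ((RDCS.dataLaw P n).prod (RDCS.pilotLaw n (r₀ n)))
        {ω | ε ≤ |∫ I, g (RDCS.stdError (r n) (RDCS.covV f ξ ω.1 (θhat n ω.1))
              (θtilde n ω.1 (θpilot n ω.1 ω.2) I) (θhat n ω.1))
            ∂(RDCS.subsampleLaw f ξ (r n) ω.1 (θpilot n ω.1 ω.2))
          - ∫ z, g z ∂(stdGaussian (RDCS.Param d))|}) atTop (𝓝 0) := by
  intro g ε hε
  obtain ⟨θ₀, hθ₀, hmax⟩ := hinterior
  have h₀ : θ₀ ∈ Θ := interior_subset hθ₀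
  have hcomp := hmle.isCompact
  have hΘ := hmle.convex
  obtain ⟨ρ₀, hρ₀, hball⟩ := Metric.isOpen_iff.1 isOpen_interior θ₀ hθ₀
  obtain ⟨B, hB, hB0, hdom⟩ := RDCS.exists_dominated hcomp hmodel hhess h₀
  obtain ⟨c₀, hc₀, hpop⟩ := RDCS.exists_popHess_le hd hcomp ⟨θ₀, h₀⟩ hhess hB hB0 hdom
  have hzero := RDCS.integral_score_eq_zero hΘ hmle.memLp_logLik hscore.memLp_score hB hdom hθ₀ hmax
  obtain ⟨δ, hδ, hfour⟩ := hscore.fourth_moment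
  have hpop' : ∀ θ ∈ Θ, ∀ v, inner ℝ (RDCS.popHess f P θ v) v ≤ -(2 * (c₀ / 2)) * ‖v‖ ^ 2 := by
    rwa [mul_div_cancel₀ _ two_ne_zero]
  have hdomD : ∀ n, ∀ᵐ ω ∂((RDCS.dataLaw P n).prod (RDCS.pilotLaw n (r₀ n))),
      ∀ i, RDCS.Dominated f Θ (B (ω.1 i)) (ω.1 i) := fun n =>
    RDCS.ae_prod_of_ae_dataLaw (RDCS.ae_dataLaw hdom n)
  have hfull : RDCS.HighProb (fun n => (RDCS.dataLaw P n).prod (RDCS.pilotLaw n (r₀ n)))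
      fun n ω => ∀ i, RDCS.Dominated f Θ (B (ω.1 i)) (ω.1 i) :=
    .of_eventually_ae (.of_forall hdomD)
  have hpil : RDCS.HighProb (fun n => (RDCS.dataLaw P n).prod (RDCS.pilotLaw n (r₀ n)))
      fun n ω => ∀ j, RDCS.Dominated f Θ (B (ω.1 (ω.2 j))) (ω.1 (ω.2 j)) :=
    hfull.mono fun _ _ h _ => h _
  rw [ENNReal.tendsto_nhds_zero]
  intro e he
  -- The allowed probability e is shared by four events. Three are bounds in probability (fourth
  -- moments, smallest eigenvalue, mean of B²) whose constants depend on e; the fourth collects all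
  -- events of probability tending to one.
  have he4 : 0 < e / 4 := ENNReal.div_pos he.ne' (by norm_num)
  obtain ⟨K₁, hK₁⟩ := hfour (e / 4) he4
  obtain ⟨c₁, hc₁, hcov₁⟩ := hcov (e / 4) he4
  obtain ⟨K₂, hK₂, hK₂0⟩ : ∃ K : ℝ, ENNReal.ofReal ((∫ x, B x ^ 2 ∂P) / K) ≤ e / 4 ∧ 0 < K := by
    have h : Tendsto (fun K : ℝ => ENNReal.ofReal ((∫ x, B x ^ 2 ∂P) / K)) atTop (𝓝 0) := by
      simpa using ENNReal.tendsto_ofReal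
        (tendsto_const_nhds (x := ∫ x, B x ^ 2 ∂P).div_atTop tendsto_id)
    exact ((ENNReal.tendsto_nhds_zero.1 h _ he4).and (eventually_gt_atTop 0)).exists
  set K : ℝ := max K₁ K₂ with hK
  set c : ℝ := min c₁ (c₀ / 2) with hc_def
  have hc : 0 < c := lt_min hc₁ (by positivity)
  have hK0 : 0 ≤ K := hK₂0.le.trans (le_max_right _ _)
  -- The tolerance η may depend on e through K and c, since the events that involve η have
  -- probability tending to one for every fixed η.
  obtain ⟨η, hη, huni⟩ := RDCS.exists_forall_goodSample (f := f) (B := B) hcomp hΘ hd hξ hc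
    (half_pos hρ₀) hK0 g hε
  have hlln := fun φ (hφ : MemLp φ 2 P) τ (hτ : (0 : ℝ) < τ) =>
    RDCS.highProb_full_mean (r₀ := r₀) hφ hτ
  have hllnp := fun φ (hφ : MemLp φ 2 P) τ (hτ : (0 : ℝ) < τ) =>
    RDCS.highProb_pilot_mean hr₀ hφ hτ
  -- Both estimates within η/2 of `θ₀` puts them within η of each other; `θhat` within ρ₀/2 of `θ₀`
  -- leaves a ball of radius ρ₀/2 about `θhat` inside `Θ`.
  have hτ : 0 < min (η / 2) (ρ₀ / 2) := lt_min (by positivity) (by positivity)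
  have hae : RDCS.HighProb (fun n => (RDCS.dataLaw P n).prod (RDCS.pilotLaw n (r₀ n))) fun n ω =>
      RDCS.IsArgmax (RDCS.fullLogLik f ω.1) Θ (θhat n ω.1)
      ∧ (∀ J, RDCS.IsArgmax (RDCS.pilotLogLik f ω.1 J) Θ (θpilot n ω.1 J))
      ∧ (∀ J I, RDCS.IsArgmax (RDCS.subsampleLogLik f ξ (r n) ω.1 (θpilot n ω.1 J) I) Θ
        (θtilde n ω.1 (θpilot n ω.1 J) I)) := by
    refine .of_eventually_ae (.of_forall fun n => ?_)
    filter_upwards [RDCS.ae_prod_of_ae_dataLaw (hθhat n), RDCS.ae_prod_of_ae_dataLaw (hθpilot n),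
      RDCS.ae_prod_of_ae_dataLaw (hθtilde n)] with ω h1 h2 h3
    exact ⟨h1, h2, h3⟩
  have hrat : RDCS.HighProb (fun n => (RDCS.dataLaw P n).prod (RDCS.pilotLaw n (r₀ n))) fun n ω =>
      (RDCS.numUncens ω.1 : ℝ) / r n < η := by
    refine .of_measure_le (hn₀ η hη) ?_
    filter_upwards [eventually_gt_atTop 0] with n hn
    simp only [not_lt]
    exact RDCS.measure_prod_fst_le hn _
  have hgood := (hfull.and hae).and ((hrat.and
    (RDCS.highProb_inner_hess_le hd hcomp hhess hB hB0 hdom hfull hlln (half_pos hc₀) hpop')).and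
    ((RDCS.highProb_norm_argmax_sub_le hd hcomp hΘ hhess hB hB0 hdom hfull hlln (half_pos hc₀)
      hpop' h₀ (hscore.memLp_score θ₀ h₀) hzero hτ).and
    (RDCS.highProb_norm_argmax_sub_le hd hcomp hΘ hhess hB hB0 hdom hpil hllnp (half_pos hc₀)
      hpop' h₀ (hscore.memLp_score θ₀ h₀) hzero hτ)))
  filter_upwards [ENNReal.tendsto_nhds_zero.1 hgood _ he4, hK₁, hcov₁, eventually_gt_atTop 0,
    hr.eventually_gt_atTop 0,
    (tendsto_natCast_atTop_atTop.comp hr).eventually_ge_atTop η⁻¹] with n h1 h2 h3 hn hrn hrη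
  set S₂ : Set (Fin n → RDCS.Obs) := {D | ∃ θ ∈ Θ, ‖θ - θhat n D‖ < δ ∧
    K₁ < (n : ℝ)⁻¹ * ∑ i, ‖RDCS.score f (D i) θ‖ ^ 4} with hS₂
  set S₃ : Set (Fin n → RDCS.Obs) :=
    {D | ¬ (RDCS.covLambda f ξ D (θhat n D) - c₁ • 1).PosSemidef} with hS₃
  set S₄ : Set (Fin n → RDCS.Obs) := {D | K₂ ≤ (n : ℝ)⁻¹ * ∑ i, B (D i) ^ 2} with hS₄
  have h4 : RDCS.dataLaw P n S₄ ≤ e / 4 :=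
    (RDCS.measure_pi_mean_ge_le hB.integrable_sq (fun x => sq_nonneg (B x)) hn hK₂0).trans hK₂
  have he4' : e / 4 + (e / 4 + (e / 4 + e / 4)) = e := by
    have h : e / 4 * 4 = e := ENNReal.div_mul_cancel (by norm_num) (by norm_num)
    calc _ = e / 4 * 4 := by ring
      _ = e := h
  rw [← he4']
  refine le_trans (measure_mono fun ω hω => ?_) ((measure_union_le _ _).trans (add_le_add h1
    ((measure_union_le _ _).trans (add_le_add ((RDCS.measure_prod_fst_le hn S₂).trans h2)
    ((measure_union_le _ _).trans (add_le_add ((RDCS.measure_prod_fst_le hn S₃).trans h3)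
    ((RDCS.measure_prod_fst_le hn S₄).trans h4)))))))
  by_contra hcon
  simp only [Set.mem_union, Set.mem_ofPred_eq, not_or, not_not] at hcon
  obtain ⟨⟨⟨hD, hhat, hpilot, htilde⟩, ⟨hun, hHess⟩, hclose, hclosep⟩, hn2, hn3, hn4⟩ := hcon
  have hd1 := hclose _ hhat
  have hd2 := hclosep _ (hpilot ω.2)
  refine absurd (show ε ≤ _ from hω) (not_le.2 (huni n (r n) ω.1 (θhat n ω.1) (θpilot n ω.1 ω.2)
    (θtilde n ω.1 (θpilot n ω.1 ω.2)) ?_))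
  exact
    { dominated := hD
      argmax := hhat
      ball_subset := by
        refine (Metric.ball_subset_ball' ?_).trans (hball.trans interior_subset)
        rw [dist_eq_norm]
        linarith [min_le_right (η / 2) (ρ₀ / 2)]
      pilot_mem := (hpilot ω.2).1
      argmax_sub := htilde ω.2
      inner_hess_le := fun θ hθ v => (hHess θ hθ v).trans (by
        have : c ≤ c₀ / 2 := min_le_right _ _
        gcongr)
      mean_sq_le := (not_le.1 hn4).le.trans (le_max_right _ _)
      fourth_moment_le := by
        refine le_trans (not_lt.1 fun hlt => hn2 ?_) (le_max_left _ _)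
        -- The uniform fourth-moment bound is used at the centre `θhat` of the neighbourhood, at
        -- distance 0 < δ.
        exact ⟨θhat n ω.1, hhat.1, by simpa using hδ, hlt⟩
      cov := RDCS.posSemidef_sub_smul_of_le (not_not.1 hn3) (min_le_left _ _)
      uncens_le := by
        rw [div_lt_iff₀ (by exact_mod_cast hrn)] at hun
        exact hun.le
      inv_le := hrη
      pilot_close := by
        have e1 : θpilot n ω.1 ω.2 - θhat n ω.1
            = (θpilot n ω.1 ω.2 - θ₀) - (θhat n ω.1 - θ₀) := by abel
        rw [e1]
        refine (norm_sub_le _ _).trans ?_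
        linarith [min_le_left (η / 2) (ρ₀ / 2)] }
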